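/- Let $\mathbb K\in\{\mathbb R,\mathbb C\}$ be the field of scalars and let $T>0$. Let $\widetilde H^0(\mathbb R^2)$ be the closed subspace of $L^2(\mathbb R^2)=L^2(\mathbb R^2;\mathbb K)$ of all $f$ with $f(-x_1,x_2)=-f(x_1,x_2)$ for a.e. $(x_1,x_2)$, and let $$U[0,T]=\Big\{u\in L^\infty(\mathbb R\times(0,T);\mathbb K)\ :\ x_2\mapsto \operatorname*{ess\,sup}_{t\in(0,T)}|u(x_2,t)|\ \text{ belongs to } L^2(\mathbb R)\Big\}.$$ For $W^0\in\widetilde H^0(\mathbb R^2)$ and $u\in U[0,T]$, a solution of $$W_t=\Delta W-2u(x_2,t)\,\delta'(x_1),\quad t\in(0,T),\qquad W(\cdot,0)=W^0, \tag{1}$$ is a map $W:[0,T]\to\widetilde H^0(\mathbb R^2)$ with $W(0)=W^0$ such that, for every real $\varphi\in\mathscr S(\mathbb R^2)$, the function $s\mapsto \int_{\mathbb R^2} W(s)\,\Delta\varphi\,dx+2\int_{\mathbb R}u(x_2,s)\,\partial_{x_1}\varphi(0,x_2)\,dx_2$ is integrable on $(0,T)$ and, for all $t\in[0,T]$, $$\int_{\mathbb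 R^2}W(t)\varphi\,dx=\int_{\mathbb R^2}W^0\varphi\,dx+\int_0^t\Big(\int_{\mathbb R^2} W(s)\,\Delta\varphi\,dx+2\int_{\mathbb R}u(x_2,s)\,\partial_{x_1}\varphi(0,x_2)\,dx_2\Big)ds .$$ Let $\mathscr R_T(W^0)$ be the set of all $W^T\in\widetilde H^0(\mathbb R^2)$ for which there is $u\in U[0,T]$ such that (1) has a unique solution $W$ and $W(T)=W^T$. The state $W^0$ is called approximately controllable to $W^T$ in time $T$ if $W^T\in\overline{\mathscr R_T(W^0)}$, the closure being taken in $\widetilde H^0(\mathbb R^2)$ with the $L^2$ norm. **Theorem.** Every $W^0\in\widetilde H^0(\mathbb R^2)$ is approximately controllable to every $W^T\in\widetilde H^0(\mathbb R^2)$ in time $T$; that is, $\overline{\mathscr R_T(W^0)}=\widetilde H^0(\mathbb R^2)$. Moreover, the same holds for the Dirichlet-controlled heat equation on the half-plane, $$w_t=\Delta w\ \ (x_1>0,\ x_2\in\mathbb R,\ t\in(0,T)),\qquad w(0,x_2,t)=u(x_2,t),\qquad w(\cdot,0)=w^0. \tag{2}$$ For all $w^0,w^T\in L^2(\mathbb R_+\times\mathbb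 R)$, the state $w^T$ lies in the $L^2(\mathbb R_+\times\mathbb R)$-closure of the set of all $w(T)$, where $w$ is the unique solution of (2) for some $u\in U[0,T]$. Here a solution of (2) is meant in the very weak (transposition) sense: a map $w:[0,T]\to L^2(\mathbb R_+\times\mathbb R)$ with $w(0)=w^0$ such that, for every real $\varphi\in\mathscr S(\mathbb R^2)$ with $\varphi(0,\cdot)=0$, the function $s\mapsto \int_{x_1>0} w(s)\,\Delta\varphi\,dx+\int_{\mathbb R}u(x_2,s)\,\partial_{x_1}\varphi(0,x_2)\,dx_2$ is integrable on $(0,T)$ and, for all $t\in[0,T]$, $$\int_{x_1>0}w(t)\varphi\,dx=\int_{x_1>0}w^0\varphi\,dx+\int_0^t\Big(\int_{x_1>0} w(s)\,\Delta\varphi\,dx+\int_{\mathbb R}u(x_2,s)\,\partial_{x_1}\varphi(0,x_2)\,dx_2\Big)ds .$$ -/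

import Mathlib

open MeasureTheory Set
open scoped ENNReal SchwartzMap LineDeriv

noncomputable section

namespace HeatHalfPlane

/-! Points of the plane are pairs `x = (x₁, x₂)`.  The scalar field `𝕜` is `ℝ` or `ℂ`. -/

/-- Admissible controls on `[0,T]`: functions `u = u(x₂, t)`, (essentially) bounded and measurable
on `ℝ × (0,T)`, for which `x₂ ↦ ess sup_{t ∈ (0,T)} |u(x₂, t)|` has a finite `L²(ℝ)` norm. -/
def IsControl {𝕜 : Type*} [RCLike 𝕜] (T : ℝ) (u : ℝ × ℝ → 𝕜) : Prop :=
  MemLp u ∞ (volume.restrict ((univ : Set ℝ) ×ˢ Ioo 0 T)) ∧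
    eLpNorm (fun x₂ : ℝ => essSup (fun t : ℝ => ‖u (x₂, t)‖ₑ) (volume.restrict (Ioo 0 T)))
      2 (volume : Measure ℝ) < ∞

/-- The Laplacian `∂₁²φ + ∂₂²φ` of a test function on the plane. -/
def lap (φ : 𝓢(ℝ × ℝ, ℝ)) : 𝓢(ℝ × ℝ, ℝ) :=
  ∂_{((1, 0) : ℝ × ℝ)} (∂_{((1, 0) : ℝ × ℝ)} φ) + ∂_{((0, 1) : ℝ × ℝ)} (∂_{((0, 1) : ℝ × ℝ)} φ)

/-- The value `∫ ∂₁φ(0, x₂) v(x₂) dx₂` for a function `v` on the line, that is, the value on `φ` of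
the distribution `-v(x₂) δ'(x₁)`. -/
def normalTrace {𝕜 : Type*} [RCLike 𝕜] (v : ℝ → 𝕜) (φ : 𝓢(ℝ × ℝ, ℝ)) : 𝕜 :=
  ∫ x₂ : ℝ, (∂_{((1, 0) : ℝ × ℝ)} φ) (0, x₂) • v x₂

/-! ### The odd-extended system on the plane -/

/-- The subspace of `L²(ℝ²)` of the functions that are odd with respect to `x₁`. -/
def oddL2 (𝕜 : Type*) [RCLike 𝕜] : Submodule 𝕜 (Lp 𝕜 2 (volume : Measure (ℝ × ℝ))) where
  carrier := {f | ∀ᵐ x : ℝ × ℝ, f (-x.1, x.2) = -f x}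
  zero_mem' := by
    have h0 := Lp.coeFn_zero 𝕜 2 (volume : Measure (ℝ × ℝ))
    have hq : Measure.QuasiMeasurePreserving (fun x : ℝ × ℝ => (-x.1, x.2)) :=
      ((Measure.measurePreserving_neg (volume : Measure ℝ)).prod
        (MeasurePreserving.id (volume : Measure ℝ))).quasiMeasurePreserving
    filter_upwards [h0, hq.ae h0] with x h1 h2
    simp only [h1, h2, Pi.zero_apply, neg_zero]
  add_mem' := by
    intro f g hf hg
    have h0 := Lp.coeFn_add f g
    have hq : Measure.QuasiMeasurePreserving (fun x : ℝ × ℝ => (-x.1, x.2)) :=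
      ((Measure.measurePreserving_neg (volume : Measure ℝ)).prod
        (MeasurePreserving.id (volume : Measure ℝ))).quasiMeasurePreserving
    filter_upwards [hf, hg, h0, hq.ae h0] with x h3 h4 h1 h2
    simp only [h1, h2, h3, h4, Pi.add_apply]
    ring
  smul_mem' := by
    intro c f hf
    have h0 := Lp.coeFn_smul c f
    have hq : Measure.QuasiMeasurePreserving (fun x : ℝ × ℝ => (-x.1, x.2)) :=
      ((Measure.measurePreserving_neg (volume : Measure ℝ)).prod
        (MeasurePreserving.id (volume : Measure ℝ))).quasiMeasurePreserving
    filter_upwards [hf, h0, hq.ae h0] with x h3 h1 h2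
    simp only [h1, h2, h3, Pi.smul_apply, smul_neg]

/-- `W : [0,T] → oddL2` solves `W_t = ΔW - 2 u(x₂,t) δ'(x₁)`, `W(0) = W⁰`: for every test function
`φ` the function `t ↦ ⟨W(t), φ⟩` is absolutely continuous on `[0,T]` with derivative
`⟨ΔW(t) - 2 u(·,t) δ', φ⟩ = ⟨W(t), Δφ⟩ + 2 ∫ ∂₁φ(0,x₂) u(x₂,t) dx₂` (written in integrated form).
The values of `W` outside `[0,T]` are irrelevant. -/
structure IsSolution {𝕜 : Type*} [RCLike 𝕜] (T : ℝ) (W0 : oddL2 𝕜) (u : ℝ × ℝ → 𝕜)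
    (W : ℝ → oddL2 𝕜) : Prop where
  initial : W 0 = W0
  integrable : ∀ φ : 𝓢(ℝ × ℝ, ℝ), IntervalIntegrable
    (fun s : ℝ => (∫ x : ℝ × ℝ, lap φ x • (W s).1 x)
      + (2 : ℝ) • normalTrace (fun x₂ => u (x₂, s)) φ) volume 0 T
  weak : ∀ φ : 𝓢(ℝ × ℝ, ℝ), ∀ t ∈ Icc 0 T,
    ∫ x : ℝ × ℝ, φ x • (W t).1 x = (∫ x : ℝ × ℝ, φ x • W0.1 x)
      + ∫ s in (0 : ℝ)..t, ((∫ x : ℝ × ℝ, lap φ x • (W s).1 x)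
          + (2 : ℝ) • normalTrace (fun x₂ => u (x₂, s)) φ)

/-- The set of states reachable from `W0` at time `T`: the values at time `T` of the unique
solutions for admissible controls. -/
def reachableSet {𝕜 : Type*} [RCLike 𝕜] (T : ℝ) (W0 : oddL2 𝕜) : Set (oddL2 𝕜) :=
  {WT | ∃ u : ℝ × ℝ → 𝕜, IsControl T u ∧ ∃ W : ℝ → oddL2 𝕜, IsSolution T W0 u W ∧
    (∀ W' : ℝ → oddL2 𝕜, IsSolution T W0 u W' → EqOn W' W (Icc 0 T)) ∧ W T = WT}

/-- `W0` is approximately controllable to `WT` in time `T`; the closure is taken in the odd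
subspace of `L²(ℝ²)`. -/
def ApproxControllable {𝕜 : Type*} [RCLike 𝕜] (T : ℝ) (W0 WT : oddL2 𝕜) : Prop :=
  WT ∈ closure (reachableSet T W0)

/-! ### The Dirichlet-controlled system on the half-plane -/

/-- Lebesgue measure on the half-plane `x₁ > 0`. -/
def halfVol : Measure (ℝ × ℝ) := volume.restrict (Ioi (0 : ℝ) ×ˢ (univ : Set ℝ))

/-- `w : [0,T] → L²(ℝ₊ × ℝ)` is the (very weak, or transposition) solution of `w_t = Δw` for
`x₁ > 0`, `w(0,x₂,t) = u(x₂,t)`, `w(0) = w⁰`: the equation is tested against functions that vanish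
on the boundary `x₁ = 0`, and the Dirichlet datum enters through Green's formula. -/
structure IsDirichletSolution {𝕜 : Type*} [RCLike 𝕜] (T : ℝ) (w0 : Lp 𝕜 2 halfVol)
    (u : ℝ × ℝ → 𝕜) (w : ℝ → Lp 𝕜 2 halfVol) : Prop where
  initial : w 0 = w0
  integrable : ∀ φ : 𝓢(ℝ × ℝ, ℝ), (∀ x₂ : ℝ, φ (0, x₂) = 0) → IntervalIntegrable
    (fun s : ℝ => (∫ x, lap φ x • w s x ∂halfVol)
      + normalTrace (fun x₂ => u (x₂, s)) φ) volume 0 T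
  weak : ∀ φ : 𝓢(ℝ × ℝ, ℝ), (∀ x₂ : ℝ, φ (0, x₂) = 0) → ∀ t ∈ Icc 0 T,
    ∫ x, φ x • w t x ∂halfVol = (∫ x, φ x • w0 x ∂halfVol)
      + ∫ s in (0 : ℝ)..t, ((∫ x, lap φ x • w s x ∂halfVol)
          + normalTrace (fun x₂ => u (x₂, s)) φ)

/-- The set of states of the half-plane system reachable from `w0` at time `T`. -/
def dirichletReachableSet {𝕜 : Type*} [RCLike 𝕜] (T : ℝ) (w0 : Lp 𝕜 2 halfVol) :
    Set (Lp 𝕜 2 halfVol) :=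
  {wT | ∃ u : ℝ × ℝ → 𝕜, IsControl T u ∧ ∃ w : ℝ → Lp 𝕜 2 halfVol, IsDirichletSolution T w0 u w ∧
    (∀ w' : ℝ → Lp 𝕜 2 halfVol, IsDirichletSolution T w0 u w' → EqOn w' w (Icc 0 T)) ∧ w T = wT}

/-- Approximate controllability of `w0` to `wT` in time `T` for the half-plane system. -/
def DirichletApproxControllable {𝕜 : Type*} [RCLike 𝕜] (T : ℝ) (w0 wT : Lp 𝕜 2 halfVol) : Prop :=
  wT ∈ closure (dirichletReachableSet T w0)

end HeatHalfPlane

end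

noncomputable section

namespace HeatHalfPlane

open Filter Topology ContDiff

/-! ### Sums and bounded families of Schwartz functions -/

section Summable

variable {E F ι : Type*} [NormedAddCommGroup E] [NormedSpace ℝ E] [NormedAddCommGroup F]
  [NormedSpace ℝ F] [CompleteSpace F]

/-! For functions odd in x₁ the plane system is twice the half-plane Dirichlet system tested on odd
functions (`weak_integrand_eq`), so the work is done on the half-plane. The only explicit functions
are the dipole Gaussians `heatFun τ (τ + ε) c`: they solve the heat equation in τ, vanish on x₁ = 0,
and as τ → 0 their pairing with a test function tends to that of a boundary source with the smooth
profile `traceProfile ε c` (`tendsto_inner_heatSchwartz`).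

Controllability. By Duhamel's principle, holding the control at this profile during the last r units
of time steers 0 to the integral of the Gaussians over 0 < τ < r
(`isDirichletSolution_switchedControl`). States reachable from 0 by dominated controls form a
subspace, so difference quotients in r are reachable, and their limit, the Gaussian at time r, lies
in the closure (`dominatedReachable_dense`). With ε = r this gives all `heatFun r (2r) c` for 0 < r
< T. Their span is dense (`ae_eq_zero_of_integral_heatFun`): up to a fixed weight they are
exponentials forming a multiplicative monoid that separates points in the coordinates (x₁², x₂), and
such a monoid determines finite measures. An initial state is handled by adding its free evolution.

Uniqueness. A solution is a bare map into L², with no norm continuity or bound assumed. The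
difference d of two solutions is paired with a Gaussian run backwards, s ↦ ⟨Q(τ₀ + t - s), d s⟩;
this function is continuous with zero right derivative, and the uniform estimates behind that come
from Banach–Steinhaus on the Schwartz space (`eq_zero_of_odd_weak_heat`).

Free evolution. Inner products of Gaussians depend on the times only through their sum, so a
combination w of evolving Gaussians satisfies ‖w t‖² = ⟨w 0, w (2t)⟩. A bounded w with this property
cannot exceed its initial norm, and the contraction extends the evolution to all of L² by density
(`exists_free_solution`). -/

theorem schwartz_exists_hasSum (f : ι → 𝓢(E, F))
    (hf : ∀ k n : ℕ, Summable fun i => SchwartzMap.seminorm ℝ k n (f i)) :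
    ∃ g : 𝓢(E, F), HasSum f g := by
  have hv : ∀ k : ℕ, (k : ℕ∞) ≤ ⊤ → Summable fun i => SchwartzMap.seminorm ℝ 0 k (f i) :=
    fun k _ => hf 0 k
  have hb : ∀ (k : ℕ) (i : ι) (x : E), (k : ℕ∞) ≤ ⊤ →
      ‖iteratedFDeriv ℝ k (f i) x‖ ≤ SchwartzMap.seminorm ℝ 0 k (f i) :=
    fun k i x _ => (f i).norm_iteratedFDeriv_le_seminorm ℝ k x
  have hsm : ∀ i, ContDiff ℝ ((⊤ : ℕ∞) : ℕ∞ω) (f i) := fun i => (f i).smooth ⊤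
  have hder : ∀ (n : ℕ) (x : E), iteratedFDeriv ℝ n (fun y => ∑' i, f i y) x
      = ∑' i, iteratedFDeriv ℝ n (f i) x := fun n x =>
    iteratedFDeriv_tsum_apply hsm hv hb (k := n) le_top x
  have hsum : ∀ (k n : ℕ) (x : E), Summable fun i => ‖x‖ ^ k * ‖iteratedFDeriv ℝ n (f i) x‖ :=
    fun k n x => Summable.of_nonneg_of_le (fun i => by positivity)
      (fun i => (f i).le_seminorm ℝ k n x) (hf k n)
  have hsum0 : ∀ (n : ℕ) (x : E), Summable fun i => ‖iteratedFDeriv ℝ n (f i) x‖ :=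
    fun n x => by simpa using hsum 0 n x
  let g : 𝓢(E, F) :=
    { toFun := fun y => ∑' i, f i y
      smooth' := contDiff_tsum hsm hv hb
      decay' := by
        intro k n
        refine ⟨∑' i, SchwartzMap.seminorm ℝ k n (f i), fun x => ?_⟩
        rw [hder]
        calc ‖x‖ ^ k * ‖∑' i, iteratedFDeriv ℝ n (f i) x‖
            ≤ ‖x‖ ^ k * ∑' i, ‖iteratedFDeriv ℝ n (f i) x‖ := by
              gcongr; exact norm_tsum_le_tsum_norm (hsum0 n x)
          _ = ∑' i, ‖x‖ ^ k * ‖iteratedFDeriv ℝ n (f i) x‖ := tsum_mul_left.symm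
          _ ≤ _ := (hsum k n x).tsum_le_tsum (fun i => (f i).le_seminorm ℝ k n x) (hf k n) }
  refine ⟨g, ?_⟩
  rw [HasSum, SummationFilter.unconditional_filter,
    (schwartz_withSeminorms ℝ E F).tendsto_nhds _ _]
  rintro ⟨k, n⟩ ε hε
  have hs0 : ∀ x, Summable fun i => f i x := fun x =>
    Summable.of_norm (by simpa [norm_iteratedFDeriv_zero] using hsum0 0 x)
  -- Each Schwartz seminorm of the remainder is at most the tail of the series of seminorms.
  have htail := tendsto_order.1 (tendsto_tsum_compl_atTop_zero
    fun i => SchwartzMap.seminorm ℝ k n (f i))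
  filter_upwards [htail.2 ε hε] with s hs
  refine lt_of_le_of_lt ?_ hs
  rw [SchwartzMap.schwartzSeminormFamily_apply]
  refine SchwartzMap.seminorm_le_bound ℝ k n _ (tsum_nonneg fun i => apply_nonneg _ _) fun x => ?_
  have e1 : iteratedFDeriv ℝ n (⇑(∑ i ∈ s, f i - g)) x
      = (∑ i ∈ s, iteratedFDeriv ℝ n (f i) x) - ∑' i, iteratedFDeriv ℝ n (f i) x := by
    have e2 : (⇑(∑ i ∈ s, f i - g) : E → F) = (fun y => ∑ i ∈ s, f i y) - ⇑g := by
      ext y; simp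
    rw [e2, iteratedFDeriv_sub_apply, ← hder]
    · congr 1
      rw [iteratedFDeriv_fun_sum_apply]
      exact fun i _ => ((f i).smooth n).contDiffAt
    · exact (ContDiff.sum fun i _ => (f i).smooth n).contDiffAt
    · exact (g.smooth n).contDiffAt
  rw [e1, ← Summable.sum_add_tsum_compl (s := s) (hsum0 n x).of_norm, sub_add_cancel_left,
    norm_neg]
  have h1 := (hsum k n x).subtype (fun i => i ∉ s)
  calc ‖x‖ ^ k * ‖∑' i : {i // i ∉ s}, iteratedFDeriv ℝ n (f i) x‖
      ≤ ‖x‖ ^ k * ∑' i : {i // i ∉ s}, ‖iteratedFDeriv ℝ n (f i) x‖ := by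
        gcongr; exact norm_tsum_le_tsum_norm ((hsum0 n x).subtype _)
    _ = ∑' i : {i // i ∉ s}, ‖x‖ ^ k * ‖iteratedFDeriv ℝ n (f i) x‖ := tsum_mul_left.symm
    _ ≤ _ := h1.tsum_le_tsum (fun i => (f i).le_seminorm ℝ k n x) ((hf k n).subtype _)

/-- Banach–Steinhaus on the Schwartz space, in the form: a pointwise bounded family of continuous
linear maps is bounded on every bounded family. -/
theorem schwartz_banach_steinhaus {G κ : Type*} [NormedAddCommGroup G] [NormedSpace ℝ G]
    (Λ : κ → 𝓢(E, F) →L[ℝ] G) (hΛ : ∀ φ, ∃ C, ∀ t, ‖Λ t φ‖ ≤ C) (f : ι → 𝓢(E, F))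
    (hf : ∀ k n : ℕ, ∃ C, ∀ i, SchwartzMap.seminorm ℝ k n (f i) ≤ C) :
    ∃ C, ∀ t i, ‖Λ t (f i)‖ ≤ C := by
  -- The family `f` defines a synthesis map c ↦ ∑ cᵢ fᵢ from ℓ¹ into the Schwartz space. Composing
  -- each `Λ t` with it moves the question to the Banach space ℓ¹, where the normed Banach–Steinhaus
  -- theorem applies; the unit vectors then recover the `f i`.
  have hc : ∀ c : lp (fun _ : ι => ℝ) 1, Summable fun i => |c i| := fun c => by
    simpa using (lp.memℓp c).summable (by simp)
  have hsumm : ∀ c : lp (fun _ : ι => ℝ) 1, ∃ g : 𝓢(E, F), HasSum (fun i => c i • f i) g := by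
    intro c
    refine schwartz_exists_hasSum _ fun k n => ?_
    obtain ⟨C, hC⟩ := hf k n
    refine Summable.of_nonneg_of_le (fun i => apply_nonneg _ _) (fun i => ?_) ((hc c).mul_right C)
    rw [map_smul_eq_mul, Real.norm_eq_abs]
    exact mul_le_mul_of_nonneg_left (hC i) (abs_nonneg _)
  choose g hg using hsumm
  -- A single continuous map is controlled by finitely many seminorms, hence bounded on the family;
  -- uniformity in `t` is the issue left.
  have hbd : ∀ t, ∃ M, ∀ i, ‖Λ t (f i)‖ ≤ M := by
    intro t
    let p : Seminorm ℝ 𝓢(E, F) := (normSeminorm ℝ G).comp (Λ t).toLinearMap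
    have hp : Continuous p := by
      change Continuous fun φ => ‖Λ t φ‖
      fun_prop
    obtain ⟨s, C, -, hsC⟩ := Seminorm.bound_of_continuous (schwartz_withSeminorms ℝ E F) p hp
    choose B hB using hf
    refine ⟨C * ∑ m ∈ s, |B m.1 m.2|, fun i => ?_⟩
    refine (hsC (f i)).trans ?_
    rw [smul_apply, NNReal.smul_def, smul_eq_mul]
    refine mul_le_mul_of_nonneg_left ?_ C.2
    refine Seminorm.finset_sup_apply_le (Finset.sum_nonneg fun _ _ => abs_nonneg _) fun m hm => ?_
    refine ((hB m.1 m.2 i).trans (le_abs_self _)).trans ?_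
    exact Finset.single_le_sum (f := fun m : ℕ × ℕ => |B m.1 m.2|) (fun _ _ => abs_nonneg _) hm
  have hT : ∀ t, ∃ S : lp (fun _ : ι => ℝ) 1 →L[ℝ] G, ∀ c, S c = Λ t (g c) := by
    intro t
    obtain ⟨M, hM⟩ := hbd t
    let S : lp (fun _ : ι => ℝ) 1 →ₗ[ℝ] G :=
      { toFun := fun c => Λ t (g c)
        map_add' := fun c d => by
          have h := (hg c).add (hg d)
          rw [← map_add]
          congr 1
          refine (hg (c + d)).unique ?_
          convert h using 2 with i
          simp [add_smul]
        map_smul' := fun r c => by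
          have h := (hg c).const_smul r
          rw [RingHom.id_apply, ← map_smul]
          congr 1
          refine (hg (r • c)).unique ?_
          convert h using 2 with i
          simp [mul_smul] }
    refine ⟨S.mkContinuous M fun c => ?_, fun c => rfl⟩
    have h1 : HasSum (fun i => c i • Λ t (f i)) (S c) := by
      have := (hg c).mapL (Λ t)
      simp only [map_smul] at this
      exact this
    have h2 : Summable fun i => |c i| * M := (hc c).mul_right M
    have h3 : ∀ i, ‖c i • Λ t (f i)‖ ≤ |c i| * M := fun i => by
      rw [norm_smul, Real.norm_eq_abs]
      exact mul_le_mul_of_nonneg_left (hM i) (abs_nonneg _)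
    rw [← h1.tsum_eq]
    refine (norm_tsum_le_tsum_norm (h2.of_nonneg_of_le (fun _ => norm_nonneg _) h3)).trans ?_
    refine ((h2.of_nonneg_of_le (fun _ => norm_nonneg _) h3).tsum_le_tsum h3 h2).trans ?_
    rw [tsum_mul_right, mul_comm, lp.norm_eq_tsum_rpow (by simp)]
    simp
  choose S hS using hT
  obtain ⟨C, hC⟩ := banach_steinhaus (g := S) fun c => by
    obtain ⟨C, hC⟩ := hΛ (g c)
    exact ⟨C, fun t => by rw [hS]; exact hC t⟩
  classical
  refine ⟨C, fun t i => ?_⟩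
  have h1 : g (lp.single 1 i (1 : ℝ)) = f i := by
    refine (hg _).unique ?_
    convert hasSum_single i ?_ using 1
    · simp
    · intro j hj
      simp [hj]
  have h2 := (S t).le_of_opNorm_le (hC t) (lp.single 1 i (1 : ℝ))
  rw [hS, h1, lp.norm_single (by simp)] at h2
  simpa using h2

end Summable

/-! ### Gaussian test functions -/

theorem one_add_pow_mul_exp_neg_sq_le (N : ℕ) {r : ℝ} (hr : 0 ≤ r) :
    (1 + r) ^ N * Real.exp (-r ^ 2) ≤ N.factorial * Real.exp 2 := by
  have h1 := Real.pow_div_factorial_le_exp (1 + r) (by linarith) N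
  rw [div_le_iff₀ (by positivity)] at h1
  calc (1 + r) ^ N * Real.exp (-r ^ 2)
      ≤ (Real.exp (1 + r) * N.factorial) * Real.exp (-r ^ 2) := by gcongr
    _ = N.factorial * Real.exp (1 + r - r ^ 2) := by
        rw [sub_eq_add_neg, Real.exp_add (1 + r)]; ring
    _ ≤ _ := by
        gcongr
        nlinarith [sq_nonneg (r - 1)]

/-- The exponential of a function of temperate growth which is at most `-‖x‖²`. -/
def expSchwartz {E : Type*} [NormedAddCommGroup E] [NormedSpace ℝ E] {f : E → ℝ}
    (hf : f.HasTemperateGrowth) (hle : ∀ x, f x ≤ -‖x‖ ^ 2) : 𝓢(E, ℝ) where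
  toFun x := Real.exp (f x)
  smooth' := Real.contDiff_exp.comp hf.1
  decay' := by
    intro k n
    obtain ⟨m, C, hC0, hC⟩ := hf.norm_iteratedFDeriv_le_uniform n
    have hD : ∀ x : E, 1 ≤ (1 + C) * (1 + ‖x‖) ^ m := fun x => by
      have : 1 ≤ (1 + ‖x‖) ^ m := one_le_pow₀ (by linarith [norm_nonneg x])
      nlinarith
    refine ⟨n.factorial * (1 + C) ^ n * ((k + m * n).factorial * Real.exp 2), fun x => ?_⟩
    -- Faà di Bruno estimate: derivatives of f grow polynomially, so those of exp ∘ f cost only a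
    -- polynomial factor, which exp(-‖x‖²) absorbs.
    have h1 : ‖iteratedFDeriv ℝ n (Real.exp ∘ f) x‖
        ≤ n.factorial * Real.exp (f x) * ((1 + C) * (1 + ‖x‖) ^ m) ^ n := by
      refine norm_iteratedFDeriv_comp_le (N := n) Real.contDiff_exp (hf.1.of_le (mod_cast le_top))
        le_rfl x (fun i _ => ?_) fun i hi hin => ?_
      · rw [norm_iteratedFDeriv_eq_norm_iteratedDeriv, iteratedDeriv_eq_iterate, Real.iter_deriv_exp,
          Real.norm_of_nonneg (Real.exp_pos _).le]
      · refine (hC i hin x).trans ?_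
        refine le_trans ?_ (le_self_pow₀ (hD x) (by omega))
        gcongr
        linarith
    change ‖x‖ ^ k * ‖iteratedFDeriv ℝ n (Real.exp ∘ f) x‖ ≤ _
    calc ‖x‖ ^ k * ‖iteratedFDeriv ℝ n (Real.exp ∘ f) x‖
        ≤ (1 + ‖x‖) ^ k *
          (n.factorial * Real.exp (-‖x‖ ^ 2) * ((1 + C) * (1 + ‖x‖) ^ m) ^ n) := by
          have := norm_nonneg x
          gcongr
          · linarith
          · refine h1.trans ?_
            gcongr
            exact hle x
      _ = n.factorial * (1 + C) ^ n * ((1 + ‖x‖) ^ (k + m * n) * Real.exp (-‖x‖ ^ 2)) := by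
          rw [mul_pow, ← pow_mul, pow_add]; ring
      _ ≤ _ := mul_le_mul_of_nonneg_left (one_add_pow_mul_exp_neg_sq_le _ (norm_nonneg x))
          (by positivity)

theorem hasTemperateGrowth_fst : (fun x : ℝ × ℝ => x.1).HasTemperateGrowth :=
  (ContinuousLinearMap.fst ℝ ℝ ℝ).hasTemperateGrowth

theorem hasTemperateGrowth_snd : (fun x : ℝ × ℝ => x.2).HasTemperateGrowth :=
  (ContinuousLinearMap.snd ℝ ℝ ℝ).hasTemperateGrowth

/-- The function `x₁ exp(-x₁² - x₂²)`. -/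
def baseGaussian : 𝓢(ℝ × ℝ, ℝ) :=
  SchwartzMap.smulLeftCLM ℝ (fun x : ℝ × ℝ => x.1)
    (expSchwartz (f := fun x : ℝ × ℝ => -(x.1 ^ 2 + x.2 ^ 2))
      (((hasTemperateGrowth_fst.pow 2).add (hasTemperateGrowth_snd.pow 2)).neg) (fun x => by
        rw [neg_le_neg_iff, Prod.norm_def]
        rcases max_choice ‖x.1‖ ‖x.2‖ with h | h <;> rw [h, Real.norm_eq_abs, sq_abs] <;>
          nlinarith [sq_nonneg x.1, sq_nonneg x.2]))

theorem baseGaussian_apply (x : ℝ × ℝ) :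
    baseGaussian x = x.1 * Real.exp (-(x.1 ^ 2 + x.2 ^ 2)) := by
  rw [baseGaussian, SchwartzMap.smulLeftCLM_apply_apply hasTemperateGrowth_fst]
  rfl

/-- The diagonal linear automorphism `(x₁, x₂) ↦ (a x₁, b x₂)`. -/
def diagEquiv {a b : ℝ} (ha : a ≠ 0) (hb : b ≠ 0) : (ℝ × ℝ) ≃L[ℝ] (ℝ × ℝ) :=
  (ContinuousLinearEquiv.unitsEquivAut ℝ (Units.mk0 a ha)).prodCongr
    (ContinuousLinearEquiv.unitsEquivAut ℝ (Units.mk0 b hb))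

theorem diagEquiv_apply {a b : ℝ} (ha : a ≠ 0) (hb : b ≠ 0) (x : ℝ × ℝ) :
    diagEquiv ha hb x = (x.1 * a, x.2 * b) := rfl

/-- An explicit constant in the two scales makes dilates with scales in a compact subset of (0, ∞) a
bounded family of Schwartz functions. -/
theorem seminorm_comp_diagEquiv_le {a b m M : ℝ} (hm : 0 < m) (ha : m ≤ a) (hb : m ≤ b)
    (ha' : a ≤ M) (hb' : b ≤ M) (ha0 : a ≠ 0) (hb0 : b ≠ 0) (f : 𝓢(ℝ × ℝ, ℝ)) (k n : ℕ) :
    SchwartzMap.seminorm ℝ k n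
        (SchwartzMap.compCLMOfContinuousLinearEquiv ℝ (diagEquiv ha0 hb0) f)
      ≤ (1 / m) ^ k * M ^ n * SchwartzMap.seminorm ℝ k n f := by
  have hM : 0 ≤ M := by linarith
  refine SchwartzMap.seminorm_le_bound ℝ k n _ (by positivity) fun x => ?_
  have hL : ‖(diagEquiv ha0 hb0 : (ℝ × ℝ) →L[ℝ] (ℝ × ℝ))‖ ≤ M := by
    refine ContinuousLinearMap.opNorm_le_bound _ hM fun y => ?_
    rw [ContinuousLinearEquiv.coe_coe, diagEquiv_apply, Prod.norm_def, Prod.norm_def]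
    refine max_le ?_ ?_
    · rw [norm_mul, Real.norm_of_nonneg (r := a) (by linarith), mul_comm]
      gcongr; exact le_max_left _ _
    · rw [norm_mul, Real.norm_of_nonneg (r := b) (by linarith), mul_comm]
      gcongr; exact le_max_right _ _
  have hx : ‖x‖ ≤ (1 / m) * ‖diagEquiv ha0 hb0 x‖ := by
    rw [one_div, ← div_eq_inv_mul, le_div_iff₀ hm, diagEquiv_apply, Prod.norm_def, Prod.norm_def]
    rcases max_choice ‖x.1‖ ‖x.2‖ with h | h <;> rw [h]
    · refine le_trans ?_ (le_max_left _ _)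
      rw [norm_mul, Real.norm_of_nonneg (r := a) (by linarith)]
      gcongr
    · refine le_trans ?_ (le_max_right _ _)
      rw [norm_mul, Real.norm_of_nonneg (r := b) (by linarith)]
      gcongr
  have hd : ‖iteratedFDeriv ℝ n (⇑f ∘ (diagEquiv ha0 hb0 : (ℝ × ℝ) →L[ℝ] (ℝ × ℝ))) x‖
      ≤ ‖iteratedFDeriv ℝ n f (diagEquiv ha0 hb0 x)‖ * M ^ n := by
    rw [ContinuousLinearMap.iteratedFDeriv_comp_right (n := n) _ (f.smooth n) x le_rfl]
    refine (ContinuousMultilinearMap.norm_compContinuousLinearMap_le _ _).trans ?_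
    rw [Finset.prod_const, Finset.card_univ, Fintype.card_fin]
    gcongr
    rfl
  calc ‖x‖ ^ k * ‖iteratedFDeriv ℝ n (⇑f ∘ (diagEquiv ha0 hb0 : (ℝ × ℝ) →L[ℝ] (ℝ × ℝ))) x‖
      ≤ ((1 / m) * ‖diagEquiv ha0 hb0 x‖) ^ k *
        (‖iteratedFDeriv ℝ n f (diagEquiv ha0 hb0 x)‖ * M ^ n) := by gcongr
    _ = (1 / m) ^ k * M ^ n *
        (‖diagEquiv ha0 hb0 x‖ ^ k * ‖iteratedFDeriv ℝ n f (diagEquiv ha0 hb0 x)‖) := by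
        rw [mul_pow]; ring
    _ ≤ _ := by
        gcongr
        exact f.le_seminorm ℝ k n _

/-- The Gaussian `x₁ τ^{-3/2} exp(-x₁²/4τ) σ^{-1/2} exp(-(x₂-c)²/4σ)`, written as an exponential;
for `σ = τ + ε` it solves the heat equation in `τ` and vanishes on the boundary. -/
def heatFun (τ σ c : ℝ) (x : ℝ × ℝ) : ℝ :=
  x.1 * Real.exp (-(3 / 2) * Real.log τ - x.1 ^ 2 / (4 * τ)
    - 1 / 2 * Real.log σ - (x.2 - c) ^ 2 / (4 * σ))

/-- All these Gaussians are dilates and translates of `baseGaussian`. The seminorm bounds, uniform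
for τ and σ in a compact subset of (0, ∞), are what Banach–Steinhaus and dominated convergence use
later. -/
theorem exists_heatSchwartz (c : ℝ) : ∃ Q : ℝ → ℝ → 𝓢(ℝ × ℝ, ℝ),
    (∀ τ σ, 0 < τ → 0 < σ → ⇑(Q τ σ) = heatFun τ σ c) ∧
    ∀ a b : ℝ, 0 < a → ∀ k n : ℕ, ∃ C, ∀ τ ∈ Icc a b, ∀ σ ∈ Icc a b,
      SchwartzMap.seminorm ℝ k n (Q τ σ) ≤ C := by
  classical
  have hpos : ∀ s : ℝ, 0 < s → 1 / (2 * √s) ≠ 0 := fun s hs => by positivity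
  -- Scaling by 1/(2√τ) leaves a factor x₁/(2√τ); the prefactor 2/(τ√σ) turns it into x₁ τ^(-3/2)
  -- σ^(-1/2). Outside τ, σ > 0 the value is junk.
  let Q : ℝ → ℝ → 𝓢(ℝ × ℝ, ℝ) := fun τ σ => if h : 0 < τ ∧ 0 < σ then
    (2 / (τ * √σ)) • SchwartzMap.compSubConstCLM ℝ ((0, c) : ℝ × ℝ)
      (SchwartzMap.compCLMOfContinuousLinearEquiv ℝ (diagEquiv (hpos τ h.1) (hpos σ h.2))
        baseGaussian) else 0
  refine ⟨Q, ?_, ?_⟩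
  · intro τ σ hτ hσ
    ext x
    simp only [Q, dif_pos (And.intro hτ hσ)]
    rw [smul_apply, SchwartzMap.compSubConstCLM_apply]
    change _ • baseGaussian (diagEquiv _ _ _) = _
    rw [diagEquiv_apply, baseGaussian_apply, heatFun, smul_eq_mul]
    have e1 : ∀ s : ℝ, 0 < s → Real.exp (-(1 / 2) * Real.log s) = 1 / √s := fun s hs => by
      rw [Real.sqrt_eq_rpow, Real.rpow_def_of_pos hs, one_div (Real.exp _), ← Real.exp_neg]
      ring_nf
    have e2 : Real.exp (-(3 / 2) * Real.log τ) = 1 / (τ * √τ) := by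
      rw [show -(3 / 2) * Real.log τ = -Real.log τ + -(1 / 2) * Real.log τ by ring, Real.exp_add,
        e1 τ hτ, Real.exp_neg, Real.exp_log hτ]
      field_simp
    rw [show -(3 / 2) * Real.log τ - x.1 ^ 2 / (4 * τ) - 1 / 2 * Real.log σ
      - (x.2 - c) ^ 2 / (4 * σ) = -(3 / 2) * Real.log τ + -(1 / 2) * Real.log σ +
        (-(x.1 ^ 2 / (4 * τ) + (x.2 - c) ^ 2 / (4 * σ))) by ring, Real.exp_add, Real.exp_add,
        e2, e1 σ hσ]
    have e3 : -((((x - (0, c)).1 * (1 / (2 * √τ)), (x - (0, c)).2 * (1 / (2 * √σ))) : ℝ × ℝ).1 ^ 2 +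
        (((x - (0, c)).1 * (1 / (2 * √τ)), (x - (0, c)).2 * (1 / (2 * √σ))) : ℝ × ℝ).2 ^ 2)
        = (-(x.1 ^ 2 / (4 * τ) + (x.2 - c) ^ 2 / (4 * σ))) := by
      simp only [Prod.fst_sub, Prod.snd_sub, sub_zero, mul_pow, div_pow, Real.sq_sqrt hτ.le,
        Real.sq_sqrt hσ.le]
      ring
    rw [e3]
    simp only [Prod.fst_sub, sub_zero]
    field_simp
  · intro a b ha k n
    rcases le_or_gt a b with hab | hab
    swap
    · exact ⟨0, fun τ hτ => absurd (hτ.1.trans hτ.2) (by linarith)⟩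
    let T := SchwartzMap.compSubConstCLM (F := ℝ) ℝ ((0, c) : ℝ × ℝ)
    let p : Seminorm ℝ 𝓢(ℝ × ℝ, ℝ) := (SchwartzMap.seminorm ℝ k n).comp T.toLinearMap
    have hp : Continuous p :=
      ((schwartz_withSeminorms ℝ (ℝ × ℝ) ℝ).continuous_seminorm (k, n)).comp T.continuous
    obtain ⟨s, C, -, hsC⟩ := Seminorm.bound_of_continuous (schwartz_withSeminorms ℝ _ ℝ) p hp
    have hb0 : 0 < b := by linarith
    refine ⟨(2 / (a * √a)) * (C * ∑ m ∈ s, (1 / (1 / (2 * √b))) ^ m.1 * (1 / (2 * √a)) ^ m.2 *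
      SchwartzMap.seminorm ℝ m.1 m.2 baseGaussian), fun τ hτ σ hσ => ?_⟩
    have hτ0 : 0 < τ := by linarith [hτ.1]
    have hσ0 : 0 < σ := by linarith [hσ.1]
    simp only [Q, dif_pos (And.intro hτ0 hσ0)]
    rw [map_smul_eq_mul, Real.norm_of_nonneg (by positivity)]
    have h1 := hsC (SchwartzMap.compCLMOfContinuousLinearEquiv ℝ
      (diagEquiv (hpos τ hτ0) (hpos σ hσ0)) baseGaussian)
    refine mul_le_mul ?_ (h1.trans ?_) (apply_nonneg _ _) (by positivity)
    · have := hτ.1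
      have := hσ.1
      gcongr
    · rw [smul_apply, NNReal.smul_def, smul_eq_mul]
      refine mul_le_mul_of_nonneg_left ?_ C.2
      refine Seminorm.finset_sup_apply_le (Finset.sum_nonneg fun _ _ => by positivity)
        fun m hm => ?_
      have h2 := seminorm_comp_diagEquiv_le (a := 1 / (2 * √τ)) (b := 1 / (2 * √σ))
        (m := 1 / (2 * √b)) (M := 1 / (2 * √a)) (by positivity)
        (by have := hτ.2; gcongr) (by have := hσ.2; gcongr) (by have := hτ.1; gcongr)
        (by have := hσ.1; gcongr) (hpos τ hτ0) (hpos σ hσ0) baseGaussian m.1 m.2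
      refine h2.trans ?_
      exact Finset.single_le_sum (f := fun m : ℕ × ℕ => (1 / (1 / (2 * √b))) ^ m.1 *
        (1 / (2 * √a)) ^ m.2 * SchwartzMap.seminorm ℝ m.1 m.2 baseGaussian)
        (fun _ _ => by positivity) hm

/-- The function `heatFun τ σ c` as a Schwartz function (for `τ, σ > 0`). -/
def heatSchwartz (τ σ c : ℝ) : 𝓢(ℝ × ℝ, ℝ) := (exists_heatSchwartz c).choose τ σ

theorem heatSchwartz_coe {τ σ : ℝ} (hτ : 0 < τ) (hσ : 0 < σ) (c : ℝ) :
    ⇑(heatSchwartz τ σ c) = heatFun τ σ c :=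
  (exists_heatSchwartz c).choose_spec.1 τ σ hτ hσ

theorem heatSchwartz_bounded (c : ℝ) {a : ℝ} (b : ℝ) (ha : 0 < a) (k n : ℕ) :
    ∃ C, ∀ τ ∈ Icc a b, ∀ σ ∈ Icc a b,
      SchwartzMap.seminorm ℝ k n (heatSchwartz τ σ c) ≤ C :=
  (exists_heatSchwartz c).choose_spec.2 a b ha k n

/-! ### The heat equation for the Gaussian test functions -/

theorem hasDerivAt_lineDerivOp_fst (φ : 𝓢(ℝ × ℝ, ℝ)) (a b : ℝ) :
    HasDerivAt (fun t => φ (t, b)) ((∂_{((1, 0) : ℝ × ℝ)} φ) (a, b)) a := by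
  rw [SchwartzMap.lineDerivOp_apply_eq_fderiv]
  have h : HasDerivAt (fun t : ℝ => ((t, b) : ℝ × ℝ)) ((1, 0) : ℝ × ℝ) a :=
    (hasDerivAt_id a).prodMk (hasDerivAt_const a b)
  exact (φ.hasFDerivAt (a, b)).comp_hasDerivAt a h

theorem hasDerivAt_lineDerivOp_snd (φ : 𝓢(ℝ × ℝ, ℝ)) (a b : ℝ) :
    HasDerivAt (fun t => φ (a, t)) ((∂_{((0, 1) : ℝ × ℝ)} φ) (a, b)) b := by
  rw [SchwartzMap.lineDerivOp_apply_eq_fderiv]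
  have h : HasDerivAt (fun t : ℝ => ((a, t) : ℝ × ℝ)) ((0, 1) : ℝ × ℝ) b :=
    (hasDerivAt_const b a).prodMk (hasDerivAt_id b)
  exact (φ.hasFDerivAt (a, b)).comp_hasDerivAt b h

theorem lap_heatSchwartz {τ σ : ℝ} (hτ : 0 < τ) (hσ : 0 < σ) (c : ℝ) (x : ℝ × ℝ) :
    lap (heatSchwartz τ σ c) x = heatFun τ σ c x *
      (-(3 / 2) / τ + x.1 ^ 2 / (4 * τ ^ 2) - 1 / 2 / σ + (x.2 - c) ^ 2 / (4 * σ ^ 2)) := by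
  set Q := heatSchwartz τ σ c with hQdef
  have hQ : ⇑Q = heatFun τ σ c := heatSchwartz_coe hτ hσ c
  let E : ℝ → ℝ → ℝ := fun a b => Real.exp (-(3 / 2) * Real.log τ - a ^ 2 / (4 * τ)
    - 1 / 2 * Real.log σ - (b - c) ^ 2 / (4 * σ))
  have hE1 : ∀ a b, HasDerivAt (fun t => E t b) (E a b * (-(a / (2 * τ)))) a := by
    intro a b
    have h := ((((hasDerivAt_const a (-(3 / 2) * Real.log τ)).sub
      ((hasDerivAt_pow 2 a).div_const (4 * τ))).sub_const (1 / 2 * Real.log σ)).sub_const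
      ((b - c) ^ 2 / (4 * σ))).exp
    refine h.congr_deriv ?_
    change E a b * (0 - ((2 : ℕ) : ℝ) * a ^ (2 - 1) / (4 * τ)) = _
    norm_num
    left
    ring
  have hE2 : ∀ a b, HasDerivAt (fun t => E a t) (E a b * (-((b - c) / (2 * σ)))) b := by
    intro a b
    have h := (((hasDerivAt_const b (-(3 / 2) * Real.log τ - a ^ 2 / (4 * τ)
      - 1 / 2 * Real.log σ)).sub
      ((((hasDerivAt_id b).sub_const c).pow 2).div_const (4 * σ)))).exp
    refine h.congr_deriv ?_
    change E a b * (0 - ((2 : ℕ) : ℝ) * (b - c) ^ (2 - 1) * 1 / (4 * σ)) = _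
    norm_num
    left
    ring
  have h1 : ∀ a b, (∂_{((1, 0) : ℝ × ℝ)} Q) (a, b) = E a b * (1 - a ^ 2 / (2 * τ)) := by
    intro a b
    refine (hasDerivAt_lineDerivOp_fst Q a b).unique ?_
    have h := (hasDerivAt_id a).mul (hE1 a b)
    rw [hQ]
    refine h.congr_deriv ?_
    change 1 * E a b + a * (E a b * (-(a / (2 * τ)))) = _
    ring
  have h2 : ∀ a b, (∂_{((0, 1) : ℝ × ℝ)} Q) (a, b) = a * E a b * (-((b - c) / (2 * σ))) := by
    intro a b
    refine (hasDerivAt_lineDerivOp_snd Q a b).unique ?_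
    have h := (hE2 a b).const_mul a
    rw [hQ]
    exact h.congr_deriv (by ring)
  have h11 : ∀ a b, (∂_{((1, 0) : ℝ × ℝ)} (∂_{((1, 0) : ℝ × ℝ)} Q)) (a, b)
      = E a b * (-(a / (2 * τ))) * (1 - a ^ 2 / (2 * τ)) + E a b * (-(a / τ)) := by
    intro a b
    refine (hasDerivAt_lineDerivOp_fst _ a b).unique ?_
    simp only [h1]
    have h := (hE1 a b).mul (((hasDerivAt_pow 2 a).div_const (2 * τ)).const_sub 1)
    refine h.congr_deriv ?_
    norm_num
    left
    field_simp
  have h22 : ∀ a b, (∂_{((0, 1) : ℝ × ℝ)} (∂_{((0, 1) : ℝ × ℝ)} Q)) (a, b)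
      = a * (E a b * (-((b - c) / (2 * σ)))) * (-((b - c) / (2 * σ)))
        + a * E a b * (-(1 / (2 * σ))) := by
    intro a b
    refine (hasDerivAt_lineDerivOp_snd _ a b).unique ?_
    simp only [h2]
    exact ((hE2 a b).const_mul a).mul
      ((((hasDerivAt_id b).sub_const c).div_const (2 * σ)).neg)
  obtain ⟨a, b⟩ := x
  rw [lap, add_apply, h11, h22]
  change _ = a * E a b * _
  field_simp
  ring

/-- The bracket in `lap_heatSchwartz` is the τ-derivative of the exponent when σ moves with τ at
unit speed, so the offset ε is free. -/
theorem hasDerivAt_heatFun {τ σ : ℝ} (hτ : 0 < τ) {ε : ℝ} (hσ : σ = τ + ε) (hσ0 : 0 < σ) (c : ℝ)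
    (x : ℝ × ℝ) :
    HasDerivAt (fun s => heatFun s (s + ε) c x) (lap (heatSchwartz τ σ c) x) τ := by
  rw [lap_heatSchwartz hτ hσ0]
  subst hσ
  have h1 := (Real.hasDerivAt_log hτ.ne').const_mul (-(3 / 2))
  have h2 : HasDerivAt (fun s : ℝ => x.1 ^ 2 / (4 * s)) (-(x.1 ^ 2 / (4 * τ ^ 2))) τ := by
    refine ((hasDerivAt_const τ (x.1 ^ 2)).div ((hasDerivAt_id τ).const_mul 4)
      (show 4 * τ ≠ 0 by positivity)).congr_deriv ?_
    change (0 * (4 * τ) - x.1 ^ 2 * (4 * 1)) / (4 * τ) ^ 2 = _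
    field_simp
    ring
  have h3 : HasDerivAt (fun s : ℝ => 1 / 2 * Real.log (s + ε)) (1 / 2 / (τ + ε)) τ :=
    ((((hasDerivAt_id τ).add_const ε).log hσ0.ne').const_mul (1 / 2)).congr_deriv
      (by change 1 / 2 * (1 / (τ + ε)) = _; ring)
  have h4 : HasDerivAt (fun s : ℝ => (x.2 - c) ^ 2 / (4 * (s + ε)))
      (-((x.2 - c) ^ 2 / (4 * (τ + ε) ^ 2))) τ := by
    refine ((hasDerivAt_const τ ((x.2 - c) ^ 2)).div
      (((hasDerivAt_id τ).add_const ε).const_mul 4)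
      (show 4 * (τ + ε) ≠ 0 by positivity)).congr_deriv ?_
    change (0 * (4 * (τ + ε)) - (x.2 - c) ^ 2 * (4 * 1)) / (4 * (τ + ε)) ^ 2 = _
    field_simp
    ring
  refine (((((h1.sub h2).sub h3).sub h4).exp).const_mul x.1).congr_deriv ?_
  simp only [heatFun, Pi.sub_apply]
  ring

theorem heatFun_neg (τ σ c : ℝ) (x : ℝ × ℝ) : heatFun τ σ c (-x.1, x.2) = -heatFun τ σ c x := by
  simp [heatFun]

theorem heatFun_boundary (τ σ c b : ℝ) : heatFun τ σ c (0, b) = 0 := by simp [heatFun]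

/-! ### Test functions as elements of `L²` -/

section L2

variable (𝕜 : Type*) [RCLike 𝕜]

instance halfVol_hasTemperateGrowth : halfVol.HasTemperateGrowth := by
  obtain ⟨n, hn⟩ := (inferInstance : (volume : Measure (ℝ × ℝ)).HasTemperateGrowth).exists_integrable
  exact ⟨n, hn.restrict⟩

/-- A real test function as an element of `L²(μ; 𝕜)`. -/
def toL2 (μ : Measure (ℝ × ℝ)) [μ.HasTemperateGrowth] : 𝓢(ℝ × ℝ, ℝ) →L[ℝ] Lp 𝕜 2 μ :=
  (SchwartzMap.toLpCLM ℝ 𝕜 2 μ).comp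
    (SchwartzMap.postcompCLM (𝕜 := ℝ) (RCLike.ofRealCLM : ℝ →L[ℝ] 𝕜))

variable {𝕜}

theorem toL2_coeFn (μ : Measure (ℝ × ℝ)) [μ.HasTemperateGrowth] (φ : 𝓢(ℝ × ℝ, ℝ)) :
    toL2 𝕜 μ φ =ᵐ[μ] fun x => ((φ x : ℝ) : 𝕜) := by
  filter_upwards [SchwartzMap.coeFn_toLp (SchwartzMap.postcompCLM (𝕜 := ℝ)
    (RCLike.ofRealCLM : ℝ →L[ℝ] 𝕜) φ) 2 μ] with x hx
  exact hx

theorem inner_toL2 (μ : Measure (ℝ × ℝ)) [μ.HasTemperateGrowth] (φ : 𝓢(ℝ × ℝ, ℝ)) (f : Lp 𝕜 2 μ) :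
    inner 𝕜 (toL2 𝕜 μ φ) f = ∫ x, φ x • f x ∂μ := by
  rw [L2.inner_def]
  refine integral_congr_ae ?_
  filter_upwards [toL2_coeFn (𝕜 := 𝕜) μ φ] with x hx
  rw [hx, RCLike.inner_apply, RCLike.conj_ofReal, RCLike.real_smul_eq_coe_mul, mul_comm]

theorem inner_toL2_toL2 (μ : Measure (ℝ × ℝ)) [μ.HasTemperateGrowth] (φ ψ : 𝓢(ℝ × ℝ, ℝ)) :
    inner 𝕜 (toL2 𝕜 μ φ) (toL2 𝕜 μ ψ) = ((∫ x, φ x * ψ x ∂μ : ℝ) : 𝕜) := by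
  rw [inner_toL2, ← integral_ofReal]
  refine integral_congr_ae ?_
  filter_upwards [toL2_coeFn (𝕜 := 𝕜) μ ψ] with x hx
  rw [hx, RCLike.real_smul_eq_coe_mul, RCLike.ofReal_mul]

theorem integrable_schwartz_smul (μ : Measure (ℝ × ℝ)) [μ.HasTemperateGrowth] (φ : 𝓢(ℝ × ℝ, ℝ))
    (f : Lp 𝕜 2 μ) : Integrable (fun x => φ x • f x) μ := by
  have h := L2.integrable_inner (𝕜 := 𝕜) (toL2 𝕜 μ φ) f
  refine h.congr ?_
  filter_upwards [toL2_coeFn (𝕜 := 𝕜) μ φ] with x hx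
  rw [hx, RCLike.inner_apply, RCLike.conj_ofReal, RCLike.real_smul_eq_coe_mul, mul_comm]

end L2

/-- The Laplacian as a continuous linear map. -/
def lapCLM : 𝓢(ℝ × ℝ, ℝ) →L[ℝ] 𝓢(ℝ × ℝ, ℝ) :=
  (LineDeriv.lineDerivOpCLM ℝ 𝓢(ℝ × ℝ, ℝ) ((1, 0) : ℝ × ℝ)).comp
      (LineDeriv.lineDerivOpCLM ℝ 𝓢(ℝ × ℝ, ℝ) ((1, 0) : ℝ × ℝ)) +
    (LineDeriv.lineDerivOpCLM ℝ 𝓢(ℝ × ℝ, ℝ) ((0, 1) : ℝ × ℝ)).comp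
      (LineDeriv.lineDerivOpCLM ℝ 𝓢(ℝ × ℝ, ℝ) ((0, 1) : ℝ × ℝ))

theorem lapCLM_apply (φ : 𝓢(ℝ × ℝ, ℝ)) : lapCLM φ = lap φ := rfl

/-! ### Bounded families of test functions and dominating functions -/

theorem schwartz_bounded_map {ι : Type*} {f : ι → 𝓢(ℝ × ℝ, ℝ)}
    (hf : ∀ k n : ℕ, ∃ C, ∀ i, SchwartzMap.seminorm ℝ k n (f i) ≤ C)
    (S : 𝓢(ℝ × ℝ, ℝ) →L[ℝ] 𝓢(ℝ × ℝ, ℝ)) (k n : ℕ) :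
    ∃ C, ∀ i, SchwartzMap.seminorm ℝ k n (S (f i)) ≤ C := by
  let p : Seminorm ℝ 𝓢(ℝ × ℝ, ℝ) := (SchwartzMap.seminorm ℝ k n).comp S.toLinearMap
  have hp : Continuous p :=
    ((schwartz_withSeminorms ℝ (ℝ × ℝ) ℝ).continuous_seminorm (k, n)).comp S.continuous
  obtain ⟨s, C, -, hsC⟩ := Seminorm.bound_of_continuous (schwartz_withSeminorms ℝ _ ℝ) p hp
  choose B hB using hf
  refine ⟨C * ∑ m ∈ s, |B m.1 m.2|, fun i => (hsC (f i)).trans ?_⟩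
  rw [smul_apply, NNReal.smul_def, smul_eq_mul]
  refine mul_le_mul_of_nonneg_left ?_ C.2
  refine Seminorm.finset_sup_apply_le (Finset.sum_nonneg fun _ _ => abs_nonneg _) fun m hm => ?_
  refine ((hB m.1 m.2 i).trans (le_abs_self _)).trans ?_
  exact Finset.single_le_sum (f := fun m : ℕ × ℕ => |B m.1 m.2|) (fun _ _ => abs_nonneg _) hm

/-- Provides the common dominating function for differentiation under the integral: in dimension
two, (1 + ‖x‖)^(-2) is square integrable, so its product with an L² function is integrable. -/
theorem schwartz_bounded_decay {ι : Type*} {f : ι → 𝓢(ℝ × ℝ, ℝ)}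
    (hf : ∀ k n : ℕ, ∃ C, ∀ i, SchwartzMap.seminorm ℝ k n (f i) ≤ C) :
    ∃ C, 0 ≤ C ∧ ∀ i x, ‖f i x‖ ≤ C * (1 + ‖x‖) ^ (-2 : ℝ) := by
  choose B hB using hf
  refine ⟨2 ^ 2 * ∑ m ∈ Finset.Iic ((2, 0) : ℕ × ℕ), |B m.1 m.2|, by positivity, fun i x => ?_⟩
  have h := SchwartzMap.one_add_le_sup_seminorm_apply (𝕜 := ℝ) (m := (2, 0)) (k := 2) (n := 0)
    le_rfl le_rfl (f i) x
  have hx : 0 < 1 + ‖x‖ := by positivity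
  rw [norm_iteratedFDeriv_zero] at h
  rw [Real.rpow_neg hx.le, ← div_eq_mul_inv, le_div_iff₀ (by positivity), mul_comm,
    Real.rpow_two]
  refine h.trans (mul_le_mul_of_nonneg_left ?_ (by norm_num))
  refine Seminorm.finset_sup_apply_le (Finset.sum_nonneg fun _ _ => abs_nonneg _) fun m hm => ?_
  refine ((hB m.1 m.2 i).trans (le_abs_self _)).trans ?_
  exact Finset.single_le_sum (f := fun m : ℕ × ℕ => |B m.1 m.2|) (fun _ _ => abs_nonneg _) hm

theorem memLp_decay (μ : Measure (ℝ × ℝ)) (hμ : μ ≤ volume) :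
    MemLp (fun x : ℝ × ℝ => (1 + ‖x‖) ^ (-2 : ℝ)) 2 μ := by
  refine MemLp.mono_measure hμ ?_
  rw [memLp_two_iff_integrable_sq (Measurable.aestronglyMeasurable (by fun_prop))]
  have h := integrable_one_add_norm (μ := (volume : Measure (ℝ × ℝ))) (r := 4) (by simp; norm_num)
  refine h.congr (ae_of_all _ fun x => ?_)
  have hx : 0 ≤ 1 + ‖x‖ := by positivity
  simp only
  rw [← Real.rpow_natCast, ← Real.rpow_mul hx]
  norm_num

theorem heatSchwartz_family_bounded (c ε : ℝ) (hε : 0 ≤ ε) {a : ℝ} (b : ℝ) (ha : 0 < a) (k n : ℕ) :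
    ∃ C, ∀ τ : Icc a b, SchwartzMap.seminorm ℝ k n (heatSchwartz τ (τ + ε) c) ≤ C := by
  obtain ⟨C, hC⟩ := heatSchwartz_bounded c (b + ε) ha k n
  exact ⟨C, fun τ => hC τ ⟨τ.2.1, by linarith [τ.2.2]⟩ (τ + ε)
    ⟨by linarith [τ.2.1], by linarith [τ.2.2]⟩⟩

/-- The heat equation for the Gaussians, tested against a function in `L²`. -/
theorem hasDerivAt_inner_heatSchwartz {𝕜 : Type*} [RCLike 𝕜] (c : ℝ) {ε τ : ℝ} (hε : 0 ≤ ε)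
    (hτ : 0 < τ) (f : Lp 𝕜 2 halfVol) :
    HasDerivAt (fun s => inner 𝕜 (toL2 𝕜 halfVol (heatSchwartz s (s + ε) c)) f)
      (inner 𝕜 (toL2 𝕜 halfVol (lap (heatSchwartz τ (τ + ε) c))) f) τ := by
  simp only [inner_toL2]
  obtain ⟨C, hC0, hC⟩ := schwartz_bounded_decay (schwartz_bounded_map
    (heatSchwartz_family_bounded c ε hε (2 * τ) (half_pos hτ)) lapCLM)
  refine (hasDerivAt_integral_of_dominated_loc_of_deriv_le
    (F := fun s x => heatSchwartz s (s + ε) c x • f x)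
    (F' := fun s x => lap (heatSchwartz s (s + ε) c) x • f x)
    (bound := fun x => C * ‖(1 + ‖x‖) ^ (-2 : ℝ) * ‖f x‖‖) (s := Icc (τ / 2) (2 * τ))
    (Icc_mem_nhds (by linarith) (by linarith)) (Eventually.of_forall fun s =>
      (integrable_schwartz_smul halfVol _ f).aestronglyMeasurable)
    (integrable_schwartz_smul halfVol _ f)
    (integrable_schwartz_smul halfVol _ f).aestronglyMeasurable ?_ ?_ ?_).2
  · refine ae_of_all _ fun x s hs => ?_
    have h := hC ⟨s, hs⟩ x
    rw [lapCLM_apply] at h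
    rw [norm_smul, norm_mul, norm_norm, ← mul_assoc, Real.norm_of_nonneg
      (r := (1 + ‖x‖) ^ (-2 : ℝ)) (by positivity)]
    gcongr
  · refine Integrable.const_mul ?_ C
    refine Integrable.norm ?_
    exact (memLp_decay halfVol Measure.restrict_le_self).integrable_mul (Lp.memLp f).norm
  · refine ae_of_all _ fun x s hs => ?_
    have hs0 : 0 < s := by linarith [hs.1]
    have h := hasDerivAt_heatFun (ε := ε) hs0 rfl (by linarith) c x
    refine (h.congr_of_eventuallyEq ?_).smul_const (f x)
    filter_upwards [lt_mem_nhds hs0] with r hr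
    rw [heatSchwartz_coe hr (by linarith)]

/-! ### Green's formula on the half-plane -/

theorem halfVol_eq : halfVol = (volume.restrict (Ioi (0 : ℝ))).prod (volume : Measure ℝ) := by
  rw [halfVol, Measure.volume_eq_prod, ← Measure.prod_restrict, Measure.restrict_univ]

theorem integrable_schwartz_mul (μ : Measure (ℝ × ℝ)) [μ.HasTemperateGrowth]
    (φ ψ : 𝓢(ℝ × ℝ, ℝ)) : Integrable (fun x => φ x * ψ x) μ :=
  (φ.memLp 2 μ).integrable_mul (ψ.memLp 2 μ)

/-- Integration by parts on each ray x₂ = b; the boundary term at x₁ = 0 vanishes with φ alone, so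
no condition on ψ is needed. -/
theorem integral_half_lineDerivOp_fst {φ : 𝓢(ℝ × ℝ, ℝ)} (hφ : ∀ b, φ (0, b) = 0)
    (ψ : 𝓢(ℝ × ℝ, ℝ)) :
    ∫ x, φ x * (∂_{((1, 0) : ℝ × ℝ)} ψ) x ∂halfVol
      = -∫ x, (∂_{((1, 0) : ℝ × ℝ)} φ) x * ψ x ∂halfVol := by
  have i1 := integrable_schwartz_mul halfVol φ (∂_{((1, 0) : ℝ × ℝ)} ψ)
  have i2 := integrable_schwartz_mul halfVol (∂_{((1, 0) : ℝ × ℝ)} φ) ψ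
  have i0 := integrable_schwartz_mul halfVol φ ψ
  rw [← add_eq_zero_iff_eq_neg, ← integral_add i1 i2]
  have i3 : Integrable (fun x => φ x * (∂_{((1, 0) : ℝ × ℝ)} ψ) x
    + (∂_{((1, 0) : ℝ × ℝ)} φ) x * ψ x) halfVol := i1.add i2
  rw [halfVol_eq] at i0 i3 ⊢
  rw [integral_prod_symm _ i3]
  refine integral_eq_zero_of_ae ?_
  filter_upwards [i3.prod_left_ae, i0.prod_left_ae] with b h3 h0
  have hd : ∀ t ∈ Ici (0 : ℝ), HasDerivAt (fun t => φ (t, b) * ψ (t, b))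
      (φ (t, b) * (∂_{((1, 0) : ℝ × ℝ)} ψ) (t, b) + (∂_{((1, 0) : ℝ × ℝ)} φ) (t, b) * ψ (t, b)) t :=
    fun t _ => ((hasDerivAt_lineDerivOp_fst φ t b).mul
      (hasDerivAt_lineDerivOp_fst ψ t b)).congr_deriv (add_comm _ _)
  have ht := tendsto_zero_of_hasDerivAt_of_integrableOn_Ioi (a := (0 : ℝ))
    (fun t ht => hd t (mem_Ici.2 (le_of_lt ht))) h3 h0
  have h := integral_Ioi_of_hasDerivAt_of_tendsto' hd h3 ht
  simpa [hφ] using h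

theorem integral_half_lineDerivOp_snd (φ ψ : 𝓢(ℝ × ℝ, ℝ)) :
    ∫ x, φ x * (∂_{((0, 1) : ℝ × ℝ)} ψ) x ∂halfVol
      = -∫ x, (∂_{((0, 1) : ℝ × ℝ)} φ) x * ψ x ∂halfVol := by
  have i1 := integrable_schwartz_mul halfVol φ (∂_{((0, 1) : ℝ × ℝ)} ψ)
  have i2 := integrable_schwartz_mul halfVol (∂_{((0, 1) : ℝ × ℝ)} φ) ψ
  have i0 := integrable_schwartz_mul halfVol φ ψ
  rw [← add_eq_zero_iff_eq_neg, ← integral_add i1 i2]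
  have i3 : Integrable (fun x => φ x * (∂_{((0, 1) : ℝ × ℝ)} ψ) x
    + (∂_{((0, 1) : ℝ × ℝ)} φ) x * ψ x) halfVol := i1.add i2
  rw [halfVol_eq] at i0 i3 ⊢
  rw [integral_prod _ i3]
  refine integral_eq_zero_of_ae ?_
  filter_upwards [i3.prod_right_ae, i0.prod_right_ae] with a h3 h0
  exact integral_eq_zero_of_hasDerivAt_of_integrable
    (fun t => ((hasDerivAt_lineDerivOp_snd φ a t).mul
      (hasDerivAt_lineDerivOp_snd ψ a t)).congr_deriv (add_comm _ _)) h3 h0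

theorem integral_half_mul_lap {φ ψ : 𝓢(ℝ × ℝ, ℝ)} (hφ : ∀ b, φ (0, b) = 0) :
    ∫ x, φ x * lap ψ x ∂halfVol
      = -(∫ x, (∂_{((1, 0) : ℝ × ℝ)} φ) x * (∂_{((1, 0) : ℝ × ℝ)} ψ) x ∂halfVol)
        - ∫ x, (∂_{((0, 1) : ℝ × ℝ)} φ) x * (∂_{((0, 1) : ℝ × ℝ)} ψ) x ∂halfVol := by
  simp only [lap, add_apply, mul_add]
  rw [integral_add (integrable_schwartz_mul _ _ _) (integrable_schwartz_mul _ _ _),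
    integral_half_lineDerivOp_fst hφ, integral_half_lineDerivOp_snd, sub_eq_add_neg]

/-- Both sides equal minus the Dirichlet form ∫ ∇φ · ∇ψ. -/
theorem green_half (𝕜 : Type*) [RCLike 𝕜] {φ ψ : 𝓢(ℝ × ℝ, ℝ)} (hφ : ∀ b, φ (0, b) = 0)
    (hψ : ∀ b, ψ (0, b) = 0) :
    inner 𝕜 (toL2 𝕜 halfVol φ) (toL2 𝕜 halfVol (lap ψ))
      = inner 𝕜 (toL2 𝕜 halfVol (lap φ)) (toL2 𝕜 halfVol ψ) := by
  rw [inner_toL2_toL2, inner_toL2_toL2]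
  congr 1
  simp only [mul_comm (lap φ _)]
  rw [integral_half_mul_lap hφ, integral_half_mul_lap hψ]
  simp only [mul_comm]

/-! ### The Gram matrix of the Gaussians -/

/-- The `L²` inner product of two Gaussians on the half-plane, as a function of the sums of the
variances and the difference of the centres. -/
def heatGram (s r d : ℝ) : ℝ :=
  Real.Gamma (3 / 2) / 2 * Real.exp (-(3 / 2) * (Real.log s - Real.log 4)
    + 1 / 2 * (Real.log Real.pi + Real.log 4 - Real.log r) - d ^ 2 / (4 * r))

theorem integral_sq_mul_exp_neg_mul_sq {b : ℝ} (hb : 0 < b) :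
    ∫ x in Ioi (0 : ℝ), x ^ 2 * Real.exp (-b * x ^ 2)
      = Real.exp (-(3 / 2) * Real.log b) * (Real.Gamma (3 / 2) / 2) := by
  have h := integral_rpow_mul_exp_neg_mul_rpow (p := 2) (q := 2) (b := b) (by norm_num)
    (by norm_num) hb
  norm_num [Real.rpow_two] at h
  rw [Real.rpow_def_of_pos hb] at h
  simp only [neg_mul]
  rw [h]
  ring_nf

theorem integral_exp_neg_sq_add_sq {σ σ' : ℝ} (hσ : 0 < σ) (hσ' : 0 < σ') (c c' : ℝ) :
    ∫ x : ℝ, Real.exp (-((x - c) ^ 2 / (4 * σ)) - (x - c') ^ 2 / (4 * σ'))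
      = Real.exp (1 / 2 * (Real.log Real.pi - (Real.log (σ + σ') - Real.log 4 - Real.log σ
          - Real.log σ'))) * Real.exp (-((c - c') ^ 2 / (4 * (σ + σ')))) := by
  have hA : 0 < (σ + σ') / (4 * σ * σ') := by positivity
  have e1 : ∀ x : ℝ, Real.exp (-((x - c) ^ 2 / (4 * σ)) - (x - c') ^ 2 / (4 * σ'))
      = Real.exp (-((σ + σ') / (4 * σ * σ')) * (x - (σ' * c + σ * c') / (σ + σ')) ^ 2)
        * Real.exp (-((c - c') ^ 2 / (4 * (σ + σ')))) := by
    intro x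
    rw [← Real.exp_add]
    congr 1
    field_simp
    ring
  simp only [e1]
  rw [integral_mul_const, integral_sub_right_eq_self
    (fun x : ℝ => Real.exp (-((σ + σ') / (4 * σ * σ')) * x ^ 2)), integral_gaussian]
  congr 1
  rw [Real.sqrt_eq_rpow, Real.rpow_def_of_pos (by positivity),
    Real.log_div (by positivity) hA.ne', Real.log_div (by positivity) (by positivity),
    Real.log_mul (by positivity) hσ'.ne', Real.log_mul (by positivity) hσ.ne']
  ring_nf

/-- Completing the square produces prefactors in the separate variances that cancel the
normalisations, leaving only the sums τ + τ' and σ + σ'. This is the symmetric semigroup law in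
integrated form, and the contraction estimate for the free evolution rests on it. -/
theorem integral_heatSchwartz_mul {τ σ τ' σ' : ℝ} (hτ : 0 < τ) (hσ : 0 < σ) (hτ' : 0 < τ')
    (hσ' : 0 < σ') (c c' : ℝ) :
    ∫ x, heatSchwartz τ σ c x * heatSchwartz τ' σ' c' x ∂halfVol
      = heatGram (τ + τ') (σ + σ') (c - c') := by
  rw [heatSchwartz_coe hτ hσ, heatSchwartz_coe hτ' hσ', halfVol_eq]
  have hb : 0 < (τ + τ') / (4 * τ * τ') := by positivity
  have e1 : ∀ x : ℝ × ℝ, heatFun τ σ c x * heatFun τ' σ' c' x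
      = (x.1 ^ 2 * Real.exp (-((τ + τ') / (4 * τ * τ')) * x.1 ^ 2)) *
        (Real.exp (-((x.2 - c) ^ 2 / (4 * σ)) - (x.2 - c') ^ 2 / (4 * σ')) *
        Real.exp (-(3 / 2) * (Real.log τ + Real.log τ') - 1 / 2 * (Real.log σ + Real.log σ'))) := by
    intro x
    rw [heatFun, heatFun, mul_mul_mul_comm, ← Real.exp_add, mul_assoc (x.1 ^ 2), ← Real.exp_add,
      ← Real.exp_add, sq x.1]
    congr 2
    field_simp
    ring
  simp only [e1]
  rw [integral_prod_mul (fun x : ℝ => x ^ 2 * Real.exp (-((τ + τ') / (4 * τ * τ')) * x ^ 2))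
    (fun y : ℝ => Real.exp (-((y - c) ^ 2 / (4 * σ)) - (y - c') ^ 2 / (4 * σ')) *
        Real.exp (-(3 / 2) * (Real.log τ + Real.log τ') - 1 / 2 * (Real.log σ + Real.log σ'))),
    integral_mul_const, integral_sq_mul_exp_neg_mul_sq hb, integral_exp_neg_sq_add_sq hσ hσ',
    heatGram, Real.log_div (by positivity) (by positivity), Real.log_mul (by positivity) hτ'.ne',
    Real.log_mul (by positivity) hτ.ne', mul_comm (Real.exp _) (Real.Gamma _ / 2), mul_assoc,
    ← Real.exp_add, ← Real.exp_add, ← Real.exp_add]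
  congr 2
  ring

section

variable {𝕜 : Type*} [RCLike 𝕜]

theorem inner_heatSchwartz {τ σ τ' σ' : ℝ} (hτ : 0 < τ) (hσ : 0 < σ) (hτ' : 0 < τ')
    (hσ' : 0 < σ') (c c' : ℝ) :
    inner 𝕜 (toL2 𝕜 halfVol (heatSchwartz τ σ c)) (toL2 𝕜 halfVol (heatSchwartz τ' σ' c'))
      = ((heatGram (τ + τ') (σ + σ') (c - c') : ℝ) : 𝕜) := by
  rw [inner_toL2_toL2, integral_heatSchwartz_mul hτ hσ hτ' hσ']

variable (𝕜) in
theorem norm_sq_heatSchwartz {τ σ : ℝ} (hτ : 0 < τ) (hσ : 0 < σ) (c : ℝ) :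
    ‖toL2 𝕜 halfVol (heatSchwartz τ σ c)‖ ^ 2 = heatGram (τ + τ) (σ + σ) 0 := by
  have h := inner_self_eq_norm_sq_to_K (𝕜 := 𝕜) (toL2 𝕜 halfVol (heatSchwartz τ σ c))
  rw [inner_heatSchwartz hτ hσ hτ hσ, sub_self] at h
  exact_mod_cast h.symm

variable (𝕜) in
theorem norm_sub_sq_heatSchwartz {τ σ τ' σ' : ℝ} (hτ : 0 < τ) (hσ : 0 < σ) (hτ' : 0 < τ')
    (hσ' : 0 < σ') (c : ℝ) :
    ‖toL2 𝕜 halfVol (heatSchwartz τ σ c) - toL2 𝕜 halfVol (heatSchwartz τ' σ' c)‖ ^ 2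
      = heatGram (τ + τ) (σ + σ) 0 - 2 * heatGram (τ + τ') (σ + σ') 0
        + heatGram (τ' + τ') (σ' + σ') 0 := by
  rw [@norm_sub_sq 𝕜, norm_sq_heatSchwartz 𝕜 hτ hσ, norm_sq_heatSchwartz 𝕜 hτ' hσ',
    inner_heatSchwartz hτ hσ hτ' hσ', sub_self, RCLike.ofReal_re]

theorem continuousAt_heatGram {s r : ℝ} (hs : 0 < s) (hr : 0 < r) :
    ContinuousAt (fun p : ℝ × ℝ => heatGram p.1 p.2 0) (s, r) := by
  unfold heatGram
  have h1 : ContinuousAt (fun p : ℝ × ℝ => Real.log p.1) (s, r) :=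
    continuousAt_fst.log hs.ne'
  have h2 : ContinuousAt (fun p : ℝ × ℝ => Real.log p.2) (s, r) :=
    continuousAt_snd.log hr.ne'
  have h3 : (fun p : ℝ × ℝ => (0 : ℝ) ^ 2 / (4 * p.2)) = fun _ => 0 := by ext; simp
  refine ContinuousAt.mul continuousAt_const (ContinuousAt.rexp ?_)
  refine ContinuousAt.sub ?_ (by rw [h3]; exact continuousAt_const)
  fun_prop

/-- The squared distance of two Gaussians with the same centre is a combination of three Gram
values, which cancel in the limit. -/
theorem continuousAt_heatSchwartz (c : ℝ) {ε τ : ℝ} (hε : 0 ≤ ε) (hτ : 0 < τ) :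
    ContinuousAt (fun s => toL2 𝕜 halfVol (heatSchwartz s (s + ε) c)) τ := by
  rw [ContinuousAt, tendsto_iff_norm_sub_tendsto_zero]
  have hev : ∀ᶠ s in 𝓝 τ, 0 < s := lt_mem_nhds hτ
  have key : Tendsto (fun s => ‖toL2 𝕜 halfVol (heatSchwartz s (s + ε) c)
      - toL2 𝕜 halfVol (heatSchwartz τ (τ + ε) c)‖ ^ 2) (𝓝 τ) (𝓝 0) := by
    have h1 : ContinuousAt (fun s => heatGram (s + s) ((s + ε) + (s + ε)) 0) τ :=
      ContinuousAt.comp (f := fun s : ℝ => ((s + s, (s + ε) + (s + ε)) : ℝ × ℝ))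
        (continuousAt_heatGram (by linarith) (by linarith))
        (by fun_prop)
    have h2 : ContinuousAt (fun s => heatGram (s + τ) ((s + ε) + (τ + ε)) 0) τ :=
      ContinuousAt.comp (f := fun s : ℝ => ((s + τ, (s + ε) + (τ + ε)) : ℝ × ℝ))
        (continuousAt_heatGram (by linarith) (by linarith))
        (by fun_prop)
    have h3 := (h1.sub (h2.const_mul 2)).add_const (heatGram (τ + τ) ((τ + ε) + (τ + ε)) 0)
    have h4 : Tendsto _ (𝓝 τ) (𝓝 _) := h3
    have e : heatGram (τ + τ) ((τ + ε) + (τ + ε)) 0 - 2 * heatGram (τ + τ) ((τ + ε) + (τ + ε)) 0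
        + heatGram (τ + τ) ((τ + ε) + (τ + ε)) 0 = 0 := by ring
    simp only [Pi.sub_apply] at h4
    rw [e] at h4
    refine h4.congr' ?_
    filter_upwards [hev] with s hs
    rw [norm_sub_sq_heatSchwartz 𝕜 hs (by linarith) hτ (by linarith)]
  have := key.sqrt
  simpa using this

variable (𝕜) in
/-- The singularity of the Gaussians at time zero is integrable in `L²`. -/
theorem exists_norm_heatSchwartz_le (c : ℝ) {ε : ℝ} (hε : 0 < ε) :
    ∃ C, 0 ≤ C ∧ ∀ τ, 0 < τ →
      ‖toL2 𝕜 halfVol (heatSchwartz τ (τ + ε) c)‖ ≤ C * τ ^ (-(3 / 4) : ℝ) := by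
  -- In the squared norm only the factor τ^(-3/2) blows up: the x₂-variance stays above ε, so
  -- log(2ε) bounds its logarithm from below.
  refine ⟨√(Real.Gamma (3 / 2) / 2 * Real.exp ((3 / 2) * Real.log 4
    + 1 / 2 * (Real.log Real.pi + Real.log 4 - Real.log (2 * ε)))), by positivity,
    fun τ hτ => ?_⟩
  have hG : 0 < Real.Gamma (3 / 2) := Real.Gamma_pos_of_pos (by norm_num)
  refine le_of_sq_le_sq ?_ (by positivity)
  rw [norm_sq_heatSchwartz 𝕜 hτ (by linarith), mul_pow, Real.sq_sqrt (by positivity), heatGram,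
    mul_assoc]
  gcongr
  have e1 : (τ ^ (-(3 / 4) : ℝ)) ^ 2 = Real.exp (Real.log τ * (-(3 / 2))) := by
    rw [← Real.rpow_natCast, ← Real.rpow_mul hτ.le, Real.rpow_def_of_pos hτ]
    norm_num
  rw [e1, ← Real.exp_add]
  gcongr
  have h1 : Real.log (2 * ε) ≤ Real.log (τ + ε + (τ + ε)) :=
    Real.log_le_log (by linarith) (by linarith)
  have h2 : Real.log τ ≤ Real.log (τ + τ) := Real.log_le_log hτ (by linarith)
  norm_num
  linarith

end

/-! ### The boundary trace of the Gaussians at time zero -/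

/-- The boundary datum produced by the Gaussian `heatFun τ (τ + ε) c` at `τ = 0`. -/
def traceProfile (ε c b : ℝ) : ℝ :=
  (∫ y in Ioi (0 : ℝ), y ^ 2 * Real.exp (-(1 / 4) * y ^ 2)) *
    Real.exp (-(1 / 2) * Real.log ε - (b - c) ^ 2 / (4 * ε))

theorem integrable_sq_mul_exp :
    IntegrableOn (fun y : ℝ => y ^ 2 * Real.exp (-(1 / 4) * y ^ 2)) (Ioi 0) := by
  have h := integrable_rpow_mul_exp_neg_mul_sq (b := 1 / 4) (by norm_num) (s := 2) (by norm_num)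
  simp only [Real.rpow_two] at h
  exact h.integrableOn

theorem integrable_shifted_gaussian {σ : ℝ} (hσ : 0 < σ) (K c : ℝ) :
    Integrable (fun b : ℝ => Real.exp (K - (b - c) ^ 2 / (4 * σ))) := by
  have h := ((integrable_exp_neg_mul_sq (b := 1 / (4 * σ)) (by positivity)).comp_sub_right c).const_mul
    (Real.exp K)
  refine h.congr (ae_of_all _ fun b => ?_)
  simp only
  rw [← Real.exp_add]
  congr 1
  ring

/-- Mean value inequality in x₁; it keeps φ(s y, b) / s bounded by a multiple of |y| as s → 0. -/
theorem exists_abs_le_mul_fst (φ : 𝓢(ℝ × ℝ, ℝ)) (hφ : ∀ b, φ (0, b) = 0) :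
    ∃ M, 0 ≤ M ∧ ∀ y b, |φ (y, b)| ≤ M * |y| := by
  refine ⟨SchwartzMap.seminorm ℝ 0 0 (∂_{((1, 0) : ℝ × ℝ)} φ), apply_nonneg _ _, fun y b => ?_⟩
  have h := Convex.norm_image_sub_le_of_norm_hasDerivWithin_le (s := univ) (x := (0 : ℝ)) (y := y)
    (f := fun t => φ (t, b)) (f' := fun t => (∂_{((1, 0) : ℝ × ℝ)} φ) (t, b))
    (fun t _ => (hasDerivAt_lineDerivOp_fst φ t b).hasDerivWithinAt)
    (fun t _ => SchwartzMap.norm_le_seminorm ℝ (∂_{((1, 0) : ℝ × ℝ)} φ) (t, b)) convex_univ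
    (mem_univ _) (mem_univ _)
  simpa [hφ] using h

/-- The integrand of the pairing with a Gaussian after the parabolic rescaling in `x₁`. -/
def rescaledPairing (φ : 𝓢(ℝ × ℝ, ℝ)) (ε c s : ℝ) (x : ℝ × ℝ) : ℝ :=
  x.1 * Real.exp (-(1 / 4) * x.1 ^ 2) * (φ (s * x.1, x.2) / s) *
    Real.exp (-(1 / 2) * Real.log (s ^ 2 + ε) - (x.2 - c) ^ 2 / (4 * (s ^ 2 + ε)))

theorem rescaledPairing_bound {φ : 𝓢(ℝ × ℝ, ℝ)} {M : ℝ} (hM0 : 0 ≤ M)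
    (hM : ∀ y b, |φ (y, b)| ≤ M * |y|) {ε s : ℝ} (hε : 0 < ε) (hs : 0 < s) (hs1 : s ≤ 1) (c : ℝ)
    (x : ℝ × ℝ) :
    ‖rescaledPairing φ ε c s x‖ ≤ M * ((x.1 ^ 2 * Real.exp (-(1 / 4) * x.1 ^ 2)) *
      Real.exp (-(1 / 2) * Real.log ε - (x.2 - c) ^ 2 / (4 * (1 + ε)))) := by
  have h1 : |φ (s * x.1, x.2) / s| ≤ M * |x.1| := by
    rw [abs_div, abs_of_pos hs, div_le_iff₀ hs]
    refine (hM _ _).trans (le_of_eq ?_)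
    rw [abs_mul, abs_of_pos hs]
    ring
  have h2 : Real.exp (-(1 / 2) * Real.log (s ^ 2 + ε) - (x.2 - c) ^ 2 / (4 * (s ^ 2 + ε)))
      ≤ Real.exp (-(1 / 2) * Real.log ε - (x.2 - c) ^ 2 / (4 * (1 + ε))) := by
    have h3 : Real.log ε ≤ Real.log (s ^ 2 + ε) := Real.log_le_log hε (by nlinarith)
    have h4 : (x.2 - c) ^ 2 / (4 * (1 + ε)) ≤ (x.2 - c) ^ 2 / (4 * (s ^ 2 + ε)) := by
      gcongr
      nlinarith
    exact Real.exp_le_exp.2 (by linarith)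
  rw [rescaledPairing, norm_mul, norm_mul, norm_mul, Real.norm_eq_abs, Real.norm_eq_abs,
    Real.norm_eq_abs, Real.norm_eq_abs, Real.abs_exp, Real.abs_exp]
  calc |x.1| * Real.exp (-(1 / 4) * x.1 ^ 2) * |φ (s * x.1, x.2) / s| *
        Real.exp (-(1 / 2) * Real.log (s ^ 2 + ε) - (x.2 - c) ^ 2 / (4 * (s ^ 2 + ε)))
      ≤ |x.1| * Real.exp (-(1 / 4) * x.1 ^ 2) * (M * |x.1|) *
        Real.exp (-(1 / 2) * Real.log ε - (x.2 - c) ^ 2 / (4 * (1 + ε))) := by gcongr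
    _ = _ := by rw [← sq_abs x.1]; ring

theorem integrable_rescaled_bound {ε : ℝ} (hε : 0 < ε) (c M : ℝ) :
    Integrable (fun x : ℝ × ℝ => M * ((x.1 ^ 2 * Real.exp (-(1 / 4) * x.1 ^ 2)) *
      Real.exp (-(1 / 2) * Real.log ε - (x.2 - c) ^ 2 / (4 * (1 + ε)))))
      ((volume.restrict (Ioi (0 : ℝ))).prod (volume : Measure ℝ)) :=
  (Integrable.mul_prod integrable_sq_mul_exp
    (integrable_shifted_gaussian (by linarith) _ c)).const_mul M

theorem rescaledPairing_measurable (φ : 𝓢(ℝ × ℝ, ℝ)) (ε c s : ℝ) (μ : Measure (ℝ × ℝ)) :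
    AEStronglyMeasurable (rescaledPairing φ ε c s) μ := by
  refine Measurable.aestronglyMeasurable ?_
  unfold rescaledPairing
  have : Measurable fun x : ℝ × ℝ => φ (s * x.1, x.2) :=
    φ.continuous.measurable.comp (by fun_prop)
  fun_prop

/-- Substitution x₁ = s y with s = √τ. The singular factor τ^(-3/2) = s^(-3) is used up by the
Jacobian, by the factor x₁, and by the quotient φ(s y, b) / s. -/
theorem integral_half_heatSchwartz_mul {φ : 𝓢(ℝ × ℝ, ℝ)} (hφ : ∀ b, φ (0, b) = 0) {ε s : ℝ}
    (hε : 0 < ε) (hs : 0 < s) (hs1 : s ≤ 1) (c : ℝ) :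
    ∫ x, φ x * heatSchwartz (s ^ 2) (s ^ 2 + ε) c x ∂halfVol
      = ∫ x, rescaledPairing φ ε c s x
          ∂((volume.restrict (Ioi (0 : ℝ))).prod (volume : Measure ℝ)) := by
  obtain ⟨M, hM0, hM⟩ := exists_abs_le_mul_fst φ hφ
  have hint : Integrable (rescaledPairing φ ε c s)
      ((volume.restrict (Ioi (0 : ℝ))).prod (volume : Measure ℝ)) :=
    (integrable_rescaled_bound hε c M).mono' (rescaledPairing_measurable φ ε c s _)
      (ae_of_all _ (rescaledPairing_bound hM0 hM hε hs hs1 c))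
  have hint' := integrable_schwartz_mul halfVol φ (heatSchwartz (s ^ 2) (s ^ 2 + ε) c)
  rw [halfVol_eq] at hint' ⊢
  rw [integral_prod_symm _ hint', integral_prod_symm _ hint]
  congr 1
  ext b
  have h := integral_comp_mul_left_Ioi
    (fun t => φ (t, b) * heatSchwartz (s ^ 2) (s ^ 2 + ε) c (t, b)) 0 hs
  rw [mul_zero, smul_eq_mul, eq_inv_mul_iff_mul_eq₀ hs.ne', ← integral_const_mul] at h
  rw [← h]
  congr 1
  ext y
  rw [heatSchwartz_coe (by positivity) (by positivity), heatFun, rescaledPairing]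
  have e1 : Real.exp (-(3 / 2) * Real.log (s ^ 2) - (s * y) ^ 2 / (4 * s ^ 2)
      - 1 / 2 * Real.log (s ^ 2 + ε) - (b - c) ^ 2 / (4 * (s ^ 2 + ε)))
      = (s ^ 3)⁻¹ * Real.exp (-(1 / 4) * y ^ 2) *
        Real.exp (-(1 / 2) * Real.log (s ^ 2 + ε) - (b - c) ^ 2 / (4 * (s ^ 2 + ε))) := by
    have e2 : (s ^ 3)⁻¹ = Real.exp (-(3 * Real.log s)) := by
      rw [Real.exp_neg, mul_comm, Real.exp_mul, Real.exp_log hs]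
      norm_cast
    rw [e2, ← Real.exp_add, ← Real.exp_add, Real.log_pow]
    congr 1
    field_simp
    push_cast
    ring
  simp only
  rw [e1]
  field_simp

theorem tendsto_rescaledPairing {φ : 𝓢(ℝ × ℝ, ℝ)} (hφ : ∀ b, φ (0, b) = 0) {ε : ℝ} (hε : 0 < ε)
    (c : ℝ) (x : ℝ × ℝ) :
    Tendsto (fun s => rescaledPairing φ ε c s x) (𝓝[>] 0)
      (𝓝 ((x.1 ^ 2 * Real.exp (-(1 / 4) * x.1 ^ 2)) * ((∂_{((1, 0) : ℝ × ℝ)} φ) (0, x.2) *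
        Real.exp (-(1 / 2) * Real.log ε - (x.2 - c) ^ 2 / (4 * ε))))) := by
  have h1 : Tendsto (fun s : ℝ => φ (s * x.1, x.2) / s) (𝓝[>] 0)
      (𝓝 ((∂_{((1, 0) : ℝ × ℝ)} φ) (0, x.2) * x.1)) := by
    have hd : HasDerivAt (fun s : ℝ => φ (s * x.1, x.2))
        ((∂_{((1, 0) : ℝ × ℝ)} φ) (0, x.2) * x.1) 0 := by
      have h := hasDerivAt_lineDerivOp_fst φ (0 * x.1) x.2
      have h2 : HasDerivAt (fun s : ℝ => s * x.1) x.1 0 := by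
        simpa using (hasDerivAt_id (0 : ℝ)).mul_const x.1
      have h3 := h.comp (0 : ℝ) h2
      rw [zero_mul] at h3
      exact h3
    have h := hd.tendsto_slope_zero_right
    refine h.congr fun s => ?_
    simp [hφ, div_eq_inv_mul]
  have h2 : Tendsto (fun s : ℝ => Real.exp (-(1 / 2) * Real.log (s ^ 2 + ε)
      - (x.2 - c) ^ 2 / (4 * (s ^ 2 + ε)))) (𝓝[>] 0)
      (𝓝 (Real.exp (-(1 / 2) * Real.log ε - (x.2 - c) ^ 2 / (4 * ε)))) := by
    refine tendsto_nhdsWithin_of_tendsto_nhds ?_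
    have hc : ContinuousAt (fun s : ℝ => Real.exp (-(1 / 2) * Real.log (s ^ 2 + ε)
      - (x.2 - c) ^ 2 / (4 * (s ^ 2 + ε)))) 0 := by
      have : (0 : ℝ) ^ 2 + ε ≠ 0 := by simpa using hε.ne'
      have : 4 * ((0 : ℝ) ^ 2 + ε) ≠ 0 := by simpa using hε.ne'
      fun_prop (disch := assumption)
    have := hc.tendsto
    simpa using this
  have h := (h1.const_mul (x.1 * Real.exp (-(1 / 4) * x.1 ^ 2))).mul h2
  have e : (x.1 ^ 2 * Real.exp (-(1 / 4) * x.1 ^ 2)) * ((∂_{((1, 0) : ℝ × ℝ)} φ) (0, x.2) *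
        Real.exp (-(1 / 2) * Real.log ε - (x.2 - c) ^ 2 / (4 * ε)))
      = x.1 * Real.exp (-(1 / 4) * x.1 ^ 2) * ((∂_{((1, 0) : ℝ × ℝ)} φ) (0, x.2) * x.1) *
        Real.exp (-(1 / 2) * Real.log ε - (x.2 - c) ^ 2 / (4 * ε)) := by ring
  rw [e]
  exact h

/-- After the rescaling the integrand converges to a difference quotient's limit, ∂₁φ(0, x₂), times
a fixed Gaussian, with an integrable majorant. The limit identifies the boundary datum that the
Gaussians emit at time zero. -/
theorem tendsto_inner_heatSchwartz (𝕜 : Type*) [RCLike 𝕜] {φ : 𝓢(ℝ × ℝ, ℝ)}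
    (hφ : ∀ b, φ (0, b) = 0) {ε : ℝ} (hε : 0 < ε) (c : ℝ) :
    Tendsto (fun τ => inner 𝕜 (toL2 𝕜 halfVol φ) (toL2 𝕜 halfVol (heatSchwartz τ (τ + ε) c)))
      (𝓝[>] 0) (𝓝 (normalTrace (fun b => ((traceProfile ε c b : ℝ) : 𝕜)) φ)) := by
  obtain ⟨M, hM0, hM⟩ := exists_abs_le_mul_fst φ hφ
  have h1 : Tendsto (fun s => ∫ x, rescaledPairing φ ε c s x
      ∂((volume.restrict (Ioi (0 : ℝ))).prod (volume : Measure ℝ))) (𝓝[>] 0)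
      (𝓝 (∫ b, (∂_{((1, 0) : ℝ × ℝ)} φ) (0, b) * traceProfile ε c b)) := by
    have e : ∫ b, (∂_{((1, 0) : ℝ × ℝ)} φ) (0, b) * traceProfile ε c b
        = ∫ x : ℝ × ℝ, (x.1 ^ 2 * Real.exp (-(1 / 4) * x.1 ^ 2)) *
          ((∂_{((1, 0) : ℝ × ℝ)} φ) (0, x.2) *
            Real.exp (-(1 / 2) * Real.log ε - (x.2 - c) ^ 2 / (4 * ε)))
          ∂((volume.restrict (Ioi (0 : ℝ))).prod (volume : Measure ℝ)) := by
      have hp := integral_prod_mul (μ := volume.restrict (Ioi (0 : ℝ))) (ν := (volume : Measure ℝ))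
        (fun y : ℝ => y ^ 2 * Real.exp (-(1 / 4) * y ^ 2))
        (fun b : ℝ => (∂_{((1, 0) : ℝ × ℝ)} φ) (0, b) *
            Real.exp (-(1 / 2) * Real.log ε - (b - c) ^ 2 / (4 * ε)))
      rw [hp, ← integral_const_mul]
      congr 1
      ext b
      rw [traceProfile]
      ring
    rw [e]
    refine tendsto_integral_filter_of_dominated_convergence _ ?_ ?_
      (integrable_rescaled_bound hε c M) (ae_of_all _ fun x => tendsto_rescaledPairing hφ hε c x)
    · exact Eventually.of_forall fun s => rescaledPairing_measurable φ ε c s _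
    · have : Ioc (0 : ℝ) 1 ∈ 𝓝[>] (0 : ℝ) := Ioc_mem_nhdsGT one_pos
      filter_upwards [this] with s hs
      exact ae_of_all _ (rescaledPairing_bound hM0 hM hε hs.1 hs.2 c)
  have hsq : Tendsto (fun τ : ℝ => √τ) (𝓝[>] 0) (𝓝[>] 0) := by
    refine tendsto_nhdsWithin_iff.2 ⟨?_, ?_⟩
    · have := Real.continuous_sqrt.tendsto 0
      rw [Real.sqrt_zero] at this
      exact this.mono_left nhdsWithin_le_nhds
    · filter_upwards [self_mem_nhdsWithin] with τ hτ
      exact Real.sqrt_pos.2 hτ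
  have h2 := (RCLike.continuous_ofReal (K := 𝕜)).continuousAt.tendsto.comp (h1.comp hsq)
  have e : normalTrace (fun b => ((traceProfile ε c b : ℝ) : 𝕜)) φ
      = ((∫ b, (∂_{((1, 0) : ℝ × ℝ)} φ) (0, b) * traceProfile ε c b : ℝ) : 𝕜) := by
    rw [normalTrace, ← integral_ofReal]
    congr 1
    ext b
    rw [RCLike.real_smul_eq_coe_mul, RCLike.ofReal_mul]
  rw [e]
  refine h2.congr' ?_
  have : Ioc (0 : ℝ) 1 ∈ 𝓝[>] (0 : ℝ) := Ioc_mem_nhdsGT one_pos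
  filter_upwards [this] with τ hτ
  have hs : 0 < √τ := Real.sqrt_pos.2 hτ.1
  have hs1 : √τ ≤ 1 := Real.sqrt_le_one.2 hτ.2
  have h := integral_half_heatSchwartz_mul hφ hε hs hs1 c
  rw [Real.sq_sqrt hτ.1.le] at h
  simp only [Function.comp]
  rw [inner_toL2_toL2, h]

section

open BoundedContinuousFunction NNReal

/-! ### Totality of the Gaussians in `L²` of the half-plane -/

/-- The exponentials of the functions `-(α y₁ + (α/2) y₂² + γ y₂ + δ)` that are bounded on
`[0,∞) × ℝ`; they form a multiplicative monoid. -/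
def expMonoid : Submonoid ((ℝ≥0 × ℝ) →ᵇ ℝ) where
  -- The ratio of the coefficients of y₁ and y₂² matches σ = 2τ in `heatFun`, with y₁ standing for
  -- x₁².
  carrier := {g | ∃ α γ δ : ℝ, 0 ≤ α ∧ (α = 0 → γ = 0) ∧
    ∀ y : ℝ≥0 × ℝ, g y = Real.exp (-(α * y.1 + α / 2 * y.2 ^ 2 + γ * y.2 + δ))}
  one_mem' := ⟨0, 0, 0, le_rfl, fun _ => rfl, fun y => by simp⟩
  mul_mem' := by
    rintro g g' ⟨α, γ, δ, h0, h1, h2⟩ ⟨α', γ', δ', h0', h1', h2'⟩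
    refine ⟨α + α', γ + γ', δ + δ', by positivity, fun h => ?_, fun y => ?_⟩
    · rw [h1 (by linarith), h1' (by linarith), add_zero]
    · rw [BoundedContinuousFunction.mul_apply, h2, h2', ← Real.exp_add]
      congr 1
      ring

/-- The bounded function `exp(-(y₁ + (y₂ - c)²/2))`. -/
def expElement (c : ℝ) : (ℝ≥0 × ℝ) →ᵇ ℝ :=
  BoundedContinuousFunction.ofNormedAddCommGroup
    (fun y : ℝ≥0 × ℝ => Real.exp (-((y.1 : ℝ) + (y.2 - c) ^ 2 / 2))) (by fun_prop) 1 (fun y => by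
      rw [Real.norm_eq_abs, Real.abs_exp, Real.exp_le_one_iff, neg_nonpos]
      positivity)

theorem expElement_apply (c : ℝ) (y : ℝ≥0 × ℝ) :
    expElement c y = Real.exp (-((y.1 : ℝ) + (y.2 - c) ^ 2 / 2)) := rfl

theorem expElement_mem (c : ℝ) : expElement c ∈ expMonoid :=
  ⟨1, -c, c ^ 2 / 2, zero_le_one, fun h => absurd h one_ne_zero, fun y => by
    rw [expElement_apply]
    congr 1
    ring⟩

/-- Being closed under products and fixed by the star operation, the monoid spans the star
subalgebra it generates; a point-separating subalgebra of bounded continuous functions determines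
finite measures on a Polish space. -/
theorem measure_ext_of_integral_expMonoid {P P' : Measure (ℝ≥0 × ℝ)} [IsFiniteMeasure P]
    [IsFiniteMeasure P'] (h : ∀ g ∈ expMonoid, ∫ y, g y ∂P = ∫ y, g y ∂P') : P = P' := by
  have hstar : star (expMonoid : Set ((ℝ≥0 × ℝ) →ᵇ ℝ)) = expMonoid := by
    have e : ∀ g : (ℝ≥0 × ℝ) →ᵇ ℝ, star g = g := fun g => by ext y; simp
    ext g
    rw [Set.mem_star, e]
  refine ext_of_forall_mem_subalgebra_integral_eq_of_polish (𝕜 := ℝ)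
    (A := StarAlgebra.adjoin ℝ (expMonoid : Set ((ℝ≥0 × ℝ) →ᵇ ℝ))) ?_ ?_
  · intro x y hxy
    by_contra hcon
    push Not at hcon
    -- The centres 0 and 1 suffice: subtracting the two exponents isolates y₂, and then y₁ is
    -- determined.
    have key : ∀ c, expElement c x = expElement c y := fun c => by
      refine hcon _ ⟨(expElement c).toContinuousMapStarₐ ℝ, ?_, rfl⟩
      exact ⟨expElement c, StarAlgebra.subset_adjoin ℝ _ (expElement_mem c), rfl⟩
    have h0 := Real.exp_injective (key 0)
    have h1 := Real.exp_injective (key 1)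
    have h2 : x.2 = y.2 := by nlinarith
    have h3 : (x.1 : ℝ) = y.1 := by rw [h2] at h0; linarith
    exact hxy (Prod.ext (NNReal.coe_injective h3) h2)
  · intro g hg
    have hg' : g ∈ Submodule.span ℝ (expMonoid : Set ((ℝ≥0 × ℝ) →ᵇ ℝ)) := by
      have h1 := StarAlgebra.adjoin_eq_span (R := ℝ) (expMonoid : Set ((ℝ≥0 × ℝ) →ᵇ ℝ))
      rw [hstar, union_self, Submonoid.closure_eq] at h1
      rw [← h1]
      exact hg
    clear hg
    induction hg' using Submodule.span_induction with
    | mem g hg1 => exact h g hg1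
    | zero => simp
    | add g g' _ _ h1 h2 =>
      simp only [BoundedContinuousFunction.coe_add, Pi.add_apply]
      rw [integral_add (g.integrable P) (g'.integrable P), h1, h2,
        integral_add (g.integrable P') (g'.integrable P')]
    | smul r g _ h1 =>
      simp only [BoundedContinuousFunction.coe_smul]
      rw [integral_smul, h1, integral_smul]

/-- The difference of the integrals against the positive and the negative part. -/
theorem integral_withDensity_sub {μ : Measure (ℝ × ℝ)} [SFinite μ] {h : ℝ × ℝ → ℝ}
    (hh : Integrable h μ) {k : ℝ × ℝ → ℝ} (hk : Measurable k) {C : ℝ} (hC : ∀ x, |k x| ≤ C) :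
    ∫ x, k x ∂μ.withDensity (fun x => ENNReal.ofReal (h x))
      - ∫ x, k x ∂μ.withDensity (fun x => ENNReal.ofReal (-h x)) = ∫ x, k x * h x ∂μ := by
  have key : ∀ g : ℝ × ℝ → ℝ, Integrable g μ →
      ∫ x, k x ∂μ.withDensity (fun x => ENNReal.ofReal (g x)) = ∫ x, max (g x) 0 * k x ∂μ := by
    intro g hg
    rw [integral_withDensity_eq_integral_toReal_smul₀ hg.aestronglyMeasurable.aemeasurable.ennreal_ofReal
      (ae_of_all _ fun _ => ENNReal.ofReal_lt_top)]
    simp only [ENNReal.toReal_ofReal', smul_eq_mul]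
  have hi : ∀ g : ℝ × ℝ → ℝ, Integrable g μ → Integrable (fun x => max (g x) 0 * k x) μ :=
    fun g hg => hg.pos_part.mul_bdd (c := C) hk.aestronglyMeasurable (ae_of_all _ hC)
  rw [key h hh, key (fun x => -h x) hh.neg, ← integral_sub (hi h hh) (hi (fun x => -h x) hh.neg)]
  congr 1
  ext x
  rcases le_total (h x) 0 with h0 | h0
  · rw [max_eq_right h0, max_eq_left (by linarith)]; ring
  · rw [max_eq_left h0, max_eq_right (by linarith)]; ring

/-- The weighted function h is integrable, and multiplying it by an element of `expMonoid` gives a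
constant times some Gaussian times g, so the product integrates to zero. Hence the positive and
negative parts of h define measures with equal images under (x₁², x₂), a map invertible on the
half-plane, and h = 0. -/
theorem ae_eq_zero_of_integral_heatFun {T : ℝ} (hT : 0 < T) {g : ℝ × ℝ → ℝ}
    (hg : MemLp g 2 halfVol)
    (h0 : ∀ τ ∈ Ioo 0 T, ∀ c, ∫ x, heatFun τ (τ + τ) c x * g x ∂halfVol = 0) :
    g =ᵐ[halfVol] 0 := by
  -- Then every A ≥ a corresponds to a time 1/(4A) ≤ T/2 < T.
  set a : ℝ := 1 / (2 * T) with ha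
  have ha0 : 0 < a := by positivity
  set h : ℝ × ℝ → ℝ := fun x => x.1 * Real.exp (-(a * x.1 ^ 2 + a / 2 * x.2 ^ 2)) * g x with hh
  -- Completing the square in x₂ with τ = 1/(4A) and σ = 2τ; the linear term moves the centre to
  -- -γ/A.
  have hexp : ∀ A : ℝ, a ≤ A → ∀ γ δ : ℝ, ∃ C : ℝ, ∀ x : ℝ × ℝ,
      x.1 * Real.exp (-(A * x.1 ^ 2 + A / 2 * x.2 ^ 2 + γ * x.2 + δ))
        = C * heatFun (1 / (4 * A)) (1 / (4 * A) + 1 / (4 * A)) (-(γ / A)) x := by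
    intro A hA γ δ
    have hA0 : 0 < A := by linarith
    refine ⟨Real.exp (-(δ - γ ^ 2 / (2 * A)) + (3 / 2) * Real.log (1 / (4 * A)) +
      1 / 2 * Real.log (1 / (4 * A) + 1 / (4 * A))), fun x => ?_⟩
    rw [heatFun, mul_left_comm, ← Real.exp_add]
    congr 2
    field_simp
    ring
  have hτ : ∀ A : ℝ, a ≤ A → 1 / (4 * A) ∈ Ioo 0 T := by
    intro A hA
    have hA0 : 0 < A := by linarith
    refine ⟨by positivity, ?_⟩
    rw [div_lt_iff₀ (by positivity)]
    have : a * T = 1 / 2 := by rw [ha]; field_simp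
    nlinarith
  have hint : Integrable h halfVol := by
    obtain ⟨C, hC⟩ := hexp a le_rfl 0 0
    have h1 := (((heatSchwartz (1 / (4 * a)) (1 / (4 * a) + 1 / (4 * a)) (-(0 / a))).memLp 2
      halfVol).integrable_mul hg).const_mul C
    refine h1.congr (ae_of_all _ fun x => ?_)
    have h2 := hC x
    simp only [zero_mul, add_zero] at h2
    simp only [hh, h2, Pi.mul_apply]
    rw [heatSchwartz_coe (by positivity) (by positivity)]
    ring
  have : SFinite halfVol := by rw [halfVol]; infer_instance
  set P := halfVol.withDensity (fun x => ENNReal.ofReal (h x)) with hP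
  set P' := halfVol.withDensity (fun x => ENNReal.ofReal (-h x)) with hP'
  have : IsFiniteMeasure P := isFiniteMeasure_withDensity_ofReal hint.2
  have : IsFiniteMeasure P' := isFiniteMeasure_withDensity_ofReal hint.neg.2
  -- In the coordinates (x₁², x₂) the Gaussians become exponentials of the form in `expMonoid`; `m'`
  -- is a left inverse of `m` where x₁ > 0.
  let m : ℝ × ℝ → ℝ≥0 × ℝ := fun x => (Real.toNNReal (x.1 ^ 2), x.2)
  let m' : ℝ≥0 × ℝ → ℝ × ℝ := fun y => (√(y.1 : ℝ), y.2)
  have hm : Measurable m := by fun_prop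
  have hm' : Measurable m' := by fun_prop
  have hmap : P.map m = P'.map m := by
    refine measure_ext_of_integral_expMonoid fun g' hg' => ?_
    rw [integral_map hm.aemeasurable g'.continuous.aestronglyMeasurable,
      integral_map hm.aemeasurable g'.continuous.aestronglyMeasurable, ← sub_eq_zero]
    refine (integral_withDensity_sub hint (k := fun x => g' (m x))
      (g'.continuous.measurable.comp hm) (fun x => g'.norm_coe_le_norm (m x))).trans ?_
    obtain ⟨α, γ, δ, hα, -, hform⟩ := hg'
    obtain ⟨C, hC⟩ := hexp (a + α) (by linarith) γ δ
    have e : ∀ x, g' (m x) * h x = C * (heatFun (1 / (4 * (a + α)))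
        (1 / (4 * (a + α)) + 1 / (4 * (a + α))) (-(γ / (a + α))) x * g x) := by
      intro x
      have e3 : g' (m x) * Real.exp (-(a * x.1 ^ 2 + a / 2 * x.2 ^ 2))
          = Real.exp (-((a + α) * x.1 ^ 2 + (a + α) / 2 * x.2 ^ 2 + γ * x.2 + δ)) := by
        rw [hform, ← Real.exp_add]
        simp only [m]
        rw [Real.coe_toNNReal _ (sq_nonneg _)]
        congr 1
        ring
      rw [← mul_assoc C, ← hC, ← e3]
      simp only [hh]
      ring
    simp only [e]
    rw [integral_const_mul, h0 _ (hτ _ (by linarith)), mul_zero]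
  have hpos : ∀ᵐ x ∂halfVol, 0 < x.1 := by
    rw [halfVol]
    filter_upwards [ae_restrict_mem (measurableSet_Ioi.prod MeasurableSet.univ)] with x hx
    exact hx.1
  have hid : ∀ᵐ x ∂halfVol, m' (m x) = x := by
    filter_upwards [hpos] with x hx
    simp only [m, m']
    rw [Real.coe_toNNReal _ (sq_nonneg _), Real.sqrt_sq hx.le]
  have hback : ∀ R : Measure (ℝ × ℝ), R ≪ halfVol → (R.map m).map m' = R := by
    intro R hR
    rw [Measure.map_map hm' hm]
    have : (m' ∘ m) =ᵐ[R] id := hR.ae_le hid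
    rw [Measure.map_congr this, Measure.map_id]
  have hPP : P = P' := by
    rw [← hback P (withDensity_absolutelyContinuous _ _), hmap,
      hback P' (withDensity_absolutelyContinuous _ _)]
  rw [hP, hP', withDensity_eq_iff hint.aestronglyMeasurable.aemeasurable.ennreal_ofReal
    (hint.aestronglyMeasurable.aemeasurable.fun_neg.ennreal_ofReal)] at hPP
  · filter_upwards [hPP, hpos] with x hx hx1
    have h3 : h x = 0 := by
      rcases lt_trichotomy (h x) 0 with hlt | heq | hgt
      · rw [ENNReal.ofReal_of_nonpos hlt.le] at hx
        have := ENNReal.ofReal_eq_zero.1 hx.symm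
        linarith
      · exact heq
      · rw [ENNReal.ofReal_of_nonpos (p := -h x) (by linarith)] at hx
        have := ENNReal.ofReal_eq_zero.1 hx
        linarith
    rw [hh] at h3
    simpa [hx1.ne', Real.exp_ne_zero] using h3
  · exact hint.lintegral_lt_top.ne

theorem eq_zero_of_inner_heatSchwartz {𝕜 : Type*} [RCLike 𝕜] {T : ℝ} (hT : 0 < T)
    {f : Lp 𝕜 2 halfVol}
    (h : ∀ τ ∈ Ioo 0 T, ∀ c, inner 𝕜 (toL2 𝕜 halfVol (heatSchwartz τ (τ + τ) c)) f = 0) :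
    f = 0 := by
  have hre : (fun x => RCLike.re (f x)) =ᵐ[halfVol] 0 := by
    refine ae_eq_zero_of_integral_heatFun hT (Lp.memLp f).re fun τ hτ c => ?_
    have h1 := congrArg RCLike.re (h τ hτ c)
    rw [inner_toL2, ← integral_re (integrable_schwartz_smul _ _ _), map_zero] at h1
    rw [← h1, heatSchwartz_coe hτ.1 (add_pos hτ.1 hτ.1)]
    simp only [RCLike.smul_re]
  have him : (fun x => RCLike.im (f x)) =ᵐ[halfVol] 0 := by
    refine ae_eq_zero_of_integral_heatFun hT (Lp.memLp f).im fun τ hτ c => ?_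
    have h1 := congrArg RCLike.im (h τ hτ c)
    rw [inner_toL2, ← integral_im (integrable_schwartz_smul _ _ _), map_zero] at h1
    rw [← h1, heatSchwartz_coe hτ.1 (add_pos hτ.1 hτ.1)]
    simp only [RCLike.smul_im]
  rw [Lp.eq_zero_iff_ae_eq_zero]
  filter_upwards [hre, him] with x h1 h2
  exact RCLike.ext (by simpa using h1) (by simpa using h2)

end

/-! ### Reflection of test functions -/

/-- Precomposition with the reflection `(x₁, x₂) ↦ (-x₁, x₂)`. -/
def reflCLM : 𝓢(ℝ × ℝ, ℝ) →L[ℝ] 𝓢(ℝ × ℝ, ℝ) :=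
  SchwartzMap.compCLMOfContinuousLinearEquiv ℝ
    (diagEquiv (a := -1) (b := 1) (by norm_num) one_ne_zero)

theorem reflCLM_apply (φ : 𝓢(ℝ × ℝ, ℝ)) (x : ℝ × ℝ) : reflCLM φ x = φ (-x.1, x.2) := by
  change φ (diagEquiv _ _ x) = _
  rw [diagEquiv_apply]
  simp

theorem lineDerivOp_fst_reflCLM (φ : 𝓢(ℝ × ℝ, ℝ)) :
    ∂_{((1, 0) : ℝ × ℝ)} (reflCLM φ) = -reflCLM (∂_{((1, 0) : ℝ × ℝ)} φ) := by
  rw [reflCLM, SchwartzMap.lineDerivOp_compCLMOfContinuousLinearEquiv, diagEquiv_apply]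
  ext x
  change (∂_{((1 * -1, 0 * 1) : ℝ × ℝ)} φ) (diagEquiv _ _ x)
    = -(∂_{((1, 0) : ℝ × ℝ)} φ) (diagEquiv _ _ x)
  rw [show ((1 * -1, 0 * 1) : ℝ × ℝ) = -(1, 0) by ext <;> simp,
    SchwartzMap.lineDerivOp_apply_eq_fderiv, SchwartzMap.lineDerivOp_apply_eq_fderiv, map_neg]

theorem lap_reflCLM (φ : 𝓢(ℝ × ℝ, ℝ)) : lap (reflCLM φ) = reflCLM (lap φ) := by
  have e2 : ∀ ψ : 𝓢(ℝ × ℝ, ℝ), ∂_{((0, 1) : ℝ × ℝ)} (reflCLM ψ)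
      = reflCLM (∂_{((0, 1) : ℝ × ℝ)} ψ) := by
    intro ψ
    rw [reflCLM, SchwartzMap.lineDerivOp_compCLMOfContinuousLinearEquiv, diagEquiv_apply]
    rw [show ((0 * -1, 1 * 1) : ℝ × ℝ) = (0, 1) by ext <;> simp]
  have e3 : ∂_{((1, 0) : ℝ × ℝ)} (-reflCLM (∂_{((1, 0) : ℝ × ℝ)} φ))
      = -∂_{((1, 0) : ℝ × ℝ)} (reflCLM (∂_{((1, 0) : ℝ × ℝ)} φ)) :=
    map_neg (LineDeriv.lineDerivOpCLM ℝ 𝓢(ℝ × ℝ, ℝ) ((1, 0) : ℝ × ℝ)) _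
  rw [lap, lineDerivOp_fst_reflCLM, e3, lineDerivOp_fst_reflCLM, neg_neg, e2, e2, lap, map_add]

theorem reflCLM_lap_of_odd {φ : 𝓢(ℝ × ℝ, ℝ)} (hφ : reflCLM φ = -φ) : reflCLM (lap φ) = -lap φ := by
  rw [← lap_reflCLM, hφ, ← lapCLM_apply, ← lapCLM_apply, map_neg]

theorem reflCLM_reflCLM (φ : 𝓢(ℝ × ℝ, ℝ)) : reflCLM (reflCLM φ) = φ := by
  ext x
  simp [reflCLM_apply]

/-- The odd part of a test function. -/
def oddPartCLM : 𝓢(ℝ × ℝ, ℝ) →L[ℝ] 𝓢(ℝ × ℝ, ℝ) :=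
  (1 / 2 : ℝ) • (ContinuousLinearMap.id ℝ _ - reflCLM)

theorem oddPartCLM_eq (φ : 𝓢(ℝ × ℝ, ℝ)) : oddPartCLM φ = (1 / 2 : ℝ) • (φ - reflCLM φ) := rfl

theorem reflCLM_oddPartCLM (φ : 𝓢(ℝ × ℝ, ℝ)) : reflCLM (oddPartCLM φ) = -oddPartCLM φ := by
  rw [oddPartCLM_eq, map_smul, map_sub, reflCLM_reflCLM, ← smul_neg, neg_sub]

theorem oddPartCLM_of_odd {φ : 𝓢(ℝ × ℝ, ℝ)} (hφ : reflCLM φ = -φ) : oddPartCLM φ = φ := by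
  rw [oddPartCLM_eq, hφ, sub_neg_eq_add, ← two_smul ℝ φ, smul_smul]
  norm_num

theorem odd_boundary {φ : 𝓢(ℝ × ℝ, ℝ)} (hφ : reflCLM φ = -φ) (b : ℝ) : φ (0, b) = 0 := by
  have h := congrArg (fun ψ : 𝓢(ℝ × ℝ, ℝ) => ψ (0, b)) hφ
  simp only [reflCLM_apply, neg_zero, neg_apply] at h
  linarith

theorem heatSchwartz_odd {τ σ : ℝ} (hτ : 0 < τ) (hσ : 0 < σ) (c : ℝ) :
    reflCLM (heatSchwartz τ σ c) = -heatSchwartz τ σ c := by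
  ext x
  rw [reflCLM_apply, neg_apply, heatSchwartz_coe hτ hσ, heatFun_neg]

theorem heatSchwartz_boundary {τ σ : ℝ} (hτ : 0 < τ) (hσ : 0 < σ) (c b : ℝ) :
    heatSchwartz τ σ c (0, b) = 0 := by
  rw [heatSchwartz_coe hτ hσ, heatFun_boundary]

/-! ### Uniqueness of weak solutions -/

section Uniqueness

variable {𝕜 : Type*} [RCLike 𝕜]

theorem continuousAt_inner_lap_heatSchwartz (c : ℝ) {ε τ : ℝ} (hε : 0 ≤ ε) (hτ : 0 < τ)
    (f : Lp 𝕜 2 halfVol) :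
    ContinuousAt (fun s => inner 𝕜 (toL2 𝕜 halfVol (lap (heatSchwartz s (s + ε) c))) f) τ := by
  simp only [inner_toL2]
  obtain ⟨C, hC0, hC⟩ := schwartz_bounded_decay (schwartz_bounded_map
    (heatSchwartz_family_bounded c ε hε (2 * τ) (half_pos hτ)) lapCLM)
  have hnhds : Icc (τ / 2) (2 * τ) ∈ 𝓝 τ := Icc_mem_nhds (by linarith) (by linarith)
  refine continuousAt_of_dominated (bound := fun x => C * ‖(1 + ‖x‖) ^ (-2 : ℝ) * ‖f x‖‖) ?_ ?_ ?_ ?_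
  · exact Eventually.of_forall fun s =>
      (integrable_schwartz_smul halfVol _ f).aestronglyMeasurable
  · filter_upwards [hnhds] with s hs
    refine ae_of_all _ fun x => ?_
    have h := hC ⟨s, hs⟩ x
    rw [lapCLM_apply] at h
    rw [norm_smul, norm_mul, norm_norm, ← mul_assoc, Real.norm_of_nonneg
      (r := (1 + ‖x‖) ^ (-2 : ℝ)) (by positivity)]
    gcongr
  · refine Integrable.const_mul (Integrable.norm ?_) C
    exact (memLp_decay halfVol Measure.restrict_le_self).integrable_mul (Lp.memLp f).norm
  · refine ae_of_all _ fun x => ContinuousAt.smul ?_ continuousAt_const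
    have h1 : (fun s => lap (heatSchwartz s (s + ε) c) x) =ᶠ[𝓝 τ] fun s => heatFun s (s + ε) c x *
      (-(3 / 2) / s + x.1 ^ 2 / (4 * s ^ 2) - 1 / 2 / (s + ε)
        + (x.2 - c) ^ 2 / (4 * (s + ε) ^ 2)) := by
      filter_upwards [lt_mem_nhds hτ] with s hs
      exact lap_heatSchwartz hs (by linarith) c x
    refine ContinuousAt.congr ?_ h1.symm
    have hσ : 0 < τ + ε := by linarith
    have g1 : ContinuousAt (fun s => heatFun s (s + ε) c x) τ :=
      (hasDerivAt_heatFun hτ rfl hσ c x).continuousAt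
    have n1 : τ ≠ 0 := hτ.ne'
    have n2 : 4 * τ ^ 2 ≠ 0 := by positivity
    have n3 : τ + ε ≠ 0 := hσ.ne'
    have n4 : 4 * (τ + ε) ^ 2 ≠ 0 := by positivity
    refine g1.mul ?_
    fun_prop (disch := assumption)

/-- The vanishing factor y - x makes continuity of w at x enough. -/
theorem hasDerivAt_sub_smul {F : Type*} [NormedAddCommGroup F] [NormedSpace ℝ F] {w : ℝ → F}
    {x : ℝ} (hw : ContinuousAt w x) : HasDerivAt (fun y => (y - x) • w y) (w x) x := by
  rw [hasDerivAt_iff_tendsto_slope]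
  refine (hw.tendsto.mono_left nhdsWithin_le_nhds).congr' ?_
  filter_upwards [self_mem_nhdsWithin] with y hy
  rw [slope_def_module]
  simp only [sub_self, zero_smul, sub_zero]
  rw [smul_smul, inv_mul_cancel₀ (sub_ne_zero.2 hy), one_smul]

/-- A pointwise bounded family of elements of `L²` (tested with odd functions) is bounded on bounded
families of odd test functions. -/
theorem exists_bound_inner_odd {κ ι : Type*} (d : κ → Lp 𝕜 2 halfVol)
    (hd : ∀ φ : 𝓢(ℝ × ℝ, ℝ), reflCLM φ = -φ →
      ∃ C, ∀ s, ‖inner 𝕜 (toL2 𝕜 halfVol φ) (d s)‖ ≤ C)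
    {f : ι → 𝓢(ℝ × ℝ, ℝ)} (hodd : ∀ i, reflCLM (f i) = -f i)
    (hf : ∀ k n : ℕ, ∃ C, ∀ i, SchwartzMap.seminorm ℝ k n (f i) ≤ C) :
    ∃ C, ∀ s i, ‖inner 𝕜 (toL2 𝕜 halfVol (f i)) (d s)‖ ≤ C := by
  let Λ : κ → 𝓢(ℝ × ℝ, ℝ) →L[ℝ] 𝕜 := fun s =>
    (((innerSL 𝕜 (d s)).restrictScalars ℝ).comp (toL2 𝕜 halfVol)).comp oddPartCLM
  have hΛ : ∀ s φ, ‖Λ s φ‖ = ‖inner 𝕜 (toL2 𝕜 halfVol (oddPartCLM φ)) (d s)‖ := fun s φ => by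
    rw [norm_inner_symm]
    rfl
  obtain ⟨C, hC⟩ := schwartz_banach_steinhaus Λ (fun φ => by
    obtain ⟨C, hC⟩ := hd (oddPartCLM φ) (reflCLM_oddPartCLM φ)
    exact ⟨C, fun s => by rw [hΛ]; exact hC s⟩) f hf
  refine ⟨C, fun s i => ?_⟩
  have h := hC s i
  rwa [hΛ, oddPartCLM_of_odd (hodd i)] at h

/-- Duality with the backward heat flow: h(s) = ⟨Q(τ₀ + t - s), d s⟩ is constant, is 0 at s = 0, and
equals ⟨Q(τ₀), d t⟩ at s = t. Since these Gaussians are total, d t = 0. Only odd test functions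
occur, so the result serves both the plane and the half-plane. -/
theorem eq_zero_of_odd_weak_heat {T : ℝ} {d : ℝ → Lp 𝕜 2 halfVol}
    (hint : ∀ φ : 𝓢(ℝ × ℝ, ℝ), reflCLM φ = -φ → IntervalIntegrable
      (fun s => inner 𝕜 (toL2 𝕜 halfVol (lap φ)) (d s)) volume 0 T)
    (hweak : ∀ φ : 𝓢(ℝ × ℝ, ℝ), reflCLM φ = -φ → ∀ t ∈ Icc 0 T,
      inner 𝕜 (toL2 𝕜 halfVol φ) (d t)
        = ∫ s in (0 : ℝ)..t, inner 𝕜 (toL2 𝕜 halfVol (lap φ)) (d s)) :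
    ∀ t ∈ Icc 0 T, d t = 0 := by
  intro t ht
  have hT : 0 ≤ T := ht.1.trans ht.2
  -- The range of τ₀ is unrelated to the time horizon; any positive bound would do. Starting at τ₀ >
  -- 0 keeps the backward flow away from the singularity.
  refine eq_zero_of_inner_heatSchwartz (T := 1) one_pos fun τ₀ hτ₀ c => ?_
  have hε : (0 : ℝ) ≤ τ₀ := hτ₀.1.le
  set Q : ℝ → 𝓢(ℝ × ℝ, ℝ) := fun τ => heatSchwartz τ (τ + τ₀) c with hQ
  have hQodd : ∀ τ, 0 < τ → reflCLM (Q τ) = -Q τ := fun τ hτ =>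
    heatSchwartz_odd hτ (by linarith [hτ₀.1]) c
  -- Pointwise boundedness over s, read off from the integrated equation; it is the hypothesis of
  -- Banach–Steinhaus.
  have hpt : ∀ φ : 𝓢(ℝ × ℝ, ℝ), reflCLM φ = -φ →
      ∃ C, ∀ s : Icc 0 T, ‖inner 𝕜 (toL2 𝕜 halfVol φ) (d s)‖ ≤ C := by
    intro φ hφ
    refine ⟨∫ s in (0 : ℝ)..T, ‖inner 𝕜 (toL2 𝕜 halfVol (lap φ)) (d s)‖, fun s => ?_⟩
    rw [hweak φ hφ s s.2]
    refine (intervalIntegral.norm_integral_le_integral_norm s.2.1).trans ?_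
    exact intervalIntegral.integral_mono_interval le_rfl s.2.1 s.2.2
      (ae_of_all _ fun _ => norm_nonneg _) (hint φ hφ).norm
  have hbdd := heatSchwartz_family_bounded c τ₀ hε (τ₀ + T) hτ₀.1
  have hodd0 : ∀ τ : Icc τ₀ (τ₀ + T), reflCLM (Q τ) = -Q τ := fun τ =>
    hQodd τ (hτ₀.1.trans_le τ.2.1)
  -- `C₁` is a Lipschitz constant for s ↦ ⟨Q τ, d s⟩ and `C₂` below one for s ↦ ⟨ΔQ τ, d s⟩, both
  -- uniform in τ.
  obtain ⟨C₁, hC₁⟩ := exists_bound_inner_odd (𝕜 := 𝕜) (fun s : Icc 0 T => d s) hpt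
    (f := fun τ : Icc τ₀ (τ₀ + T) => lapCLM (Q τ)) (fun τ => reflCLM_lap_of_odd (hodd0 τ))
    (schwartz_bounded_map hbdd lapCLM)
  obtain ⟨C₂, hC₂⟩ := exists_bound_inner_odd (𝕜 := 𝕜) (fun s : Icc 0 T => d s) hpt
    (f := fun τ : Icc τ₀ (τ₀ + T) => lapCLM (lapCLM (Q τ)))
    (fun τ => reflCLM_lap_of_odd (reflCLM_lap_of_odd (hodd0 τ)))
    (schwartz_bounded_map (schwartz_bounded_map hbdd lapCLM) lapCLM)
  have hdiff : ∀ φ : 𝓢(ℝ × ℝ, ℝ), reflCLM φ = -φ → ∀ r ∈ Icc 0 T, ∀ s ∈ Icc 0 T, r ≤ s →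
      inner 𝕜 (toL2 𝕜 halfVol φ) (d s) - inner 𝕜 (toL2 𝕜 halfVol φ) (d r)
        = ∫ q in r..s, inner 𝕜 (toL2 𝕜 halfVol (lap φ)) (d q) := by
    intro φ hφ r hr s hs _
    rw [hweak φ hφ s hs, hweak φ hφ r hr]
    refine intervalIntegral.integral_interval_sub_left ?_ ?_
    · exact (hint φ hφ).mono_set (uIcc_subset_uIcc left_mem_uIcc (by rwa [uIcc_of_le hT]))
    · exact (hint φ hφ).mono_set (uIcc_subset_uIcc left_mem_uIcc (by rwa [uIcc_of_le hT]))
  have hlip : ∀ (φ : 𝓢(ℝ × ℝ, ℝ)) (C : ℝ), reflCLM φ = -φ →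
      (∀ q ∈ Icc 0 T, ‖inner 𝕜 (toL2 𝕜 halfVol (lap φ)) (d q)‖ ≤ C) →
      ∀ r ∈ Icc 0 T, ∀ s ∈ Icc 0 T, r ≤ s →
      ‖inner 𝕜 (toL2 𝕜 halfVol φ) (d s) - inner 𝕜 (toL2 𝕜 halfVol φ) (d r)‖ ≤ C * (s - r) := by
    intro φ C hφ hC r hr s hs hrs
    rw [hdiff φ hφ r hr s hs hrs]
    have h := intervalIntegral.norm_integral_le_of_norm_le_const (a := r) (b := s) (C := C)
      (f := fun q => inner 𝕜 (toL2 𝕜 halfVol (lap φ)) (d q)) (fun q hq => by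
        rw [uIoc_of_le hrs] at hq
        exact hC q ⟨hr.1.trans hq.1.le, hq.2.trans hs.2⟩)
    rwa [abs_of_nonneg (by linarith)] at h
  set h : ℝ → 𝕜 := fun s => inner 𝕜 (toL2 𝕜 halfVol (Q (τ₀ + t - s))) (d s) with hh
  have hsub : ∀ s ∈ Icc 0 t, s ∈ Icc 0 T := fun s hs => ⟨hs.1, hs.2.trans ht.2⟩
  have hτmem : ∀ s ∈ Icc 0 t, τ₀ + t - s ∈ Icc τ₀ (τ₀ + T) := fun s hs =>
    ⟨by linarith [hs.2], by linarith [hs.1, ht.2]⟩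
  have hv : ∀ s ∈ Icc 0 t, HasDerivAt (fun r => inner 𝕜 (toL2 𝕜 halfVol (Q (τ₀ + t - r))) (d s))
      (-inner 𝕜 (toL2 𝕜 halfVol (lap (Q (τ₀ + t - s)))) (d s)) s := by
    intro s hs
    have h1 := hasDerivAt_inner_heatSchwartz c hε
      (show 0 < τ₀ + t - s by linarith [hτ₀.1, hs.2]) (d s)
    have h2 : HasDerivAt (fun r : ℝ => τ₀ + t - r) (-1) s := (hasDerivAt_id s).const_sub (τ₀ + t)
    have h3 := h1.scomp s h2
    rw [neg_one_smul] at h3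
    exact h3
  have hcont : ContinuousOn h (Icc 0 t) := by
    intro s hs
    rw [ContinuousWithinAt, tendsto_iff_norm_sub_tendsto_zero]
    have hB : Tendsto (fun r => C₁ * |r - s| +
        ‖inner 𝕜 (toL2 𝕜 halfVol (Q (τ₀ + t - r))) (d s) - h s‖) (𝓝[Icc 0 t] s) (𝓝 0) := by
      have c1 := (hv s hs).continuousAt
      have c2 : ContinuousAt (fun r => C₁ * |r - s| +
        ‖inner 𝕜 (toL2 𝕜 halfVol (Q (τ₀ + t - r))) (d s) - h s‖) s := by
        refine ContinuousAt.add (by fun_prop) ?_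
        exact (c1.sub continuousAt_const).norm
      have c3 := c2.tendsto
      simp only [sub_self, abs_zero, mul_zero, zero_add] at c3
      have c4 : ‖inner 𝕜 (toL2 𝕜 halfVol (Q (τ₀ + t - s))) (d s) - h s‖ = 0 := by
        rw [hh]; simp
      rw [c4] at c3
      exact tendsto_nhdsWithin_of_tendsto_nhds c3
    refine squeeze_zero' (Eventually.of_forall fun _ => norm_nonneg _) ?_ hB
    filter_upwards [self_mem_nhdsWithin] with r hr
    have e : h r - h s = (inner 𝕜 (toL2 𝕜 halfVol (Q (τ₀ + t - r))) (d r)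
        - inner 𝕜 (toL2 𝕜 halfVol (Q (τ₀ + t - r))) (d s))
        + (inner 𝕜 (toL2 𝕜 halfVol (Q (τ₀ + t - r))) (d s) - h s) := by
      rw [hh]; ring
    rw [e]
    refine (norm_add_le _ _).trans (add_le_add ?_ le_rfl)
    have hq : ∀ q ∈ Icc 0 T, ‖inner 𝕜 (toL2 𝕜 halfVol (lap (Q (τ₀ + t - r)))) (d q)‖ ≤ C₁ :=
      fun q hq => hC₁ ⟨q, hq⟩ ⟨_, hτmem r hr⟩
    rcases le_total s r with hsr | hrs
    · rw [abs_of_nonneg (by linarith)]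
      exact hlip _ C₁ (hodd0 ⟨_, hτmem r hr⟩) hq s (hsub s hs) r (hsub r hr) hsr
    · rw [abs_of_nonpos (by linarith), neg_sub, norm_sub_rev]
      exact hlip _ C₁ (hodd0 ⟨_, hτmem r hr⟩) hq r (hsub r hr) s (hsub s hs) hrs
  have hderiv : ∀ s ∈ Ico 0 t, HasDerivWithinAt h 0 (Ici s) s := by
    intro s hs
    have hs' : s ∈ Icc 0 t := ⟨hs.1, hs.2.le⟩
    set w : ℝ → 𝕜 := fun r => inner 𝕜 (toL2 𝕜 halfVol (lap (Q (τ₀ + t - r)))) (d s) with hw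
    have hwc : ContinuousAt w s := by
      have h1 := continuousAt_inner_lap_heatSchwartz c hε
        (show 0 < τ₀ + t - s by linarith [hτ₀.1, hs.2]) (d s)
      exact ContinuousAt.comp (f := fun r : ℝ => τ₀ + t - r) h1 (by fun_prop)
    have h1 := (hasDerivAt_sub_smul hwc).add (hv s hs')
    have h2 : w s + -inner 𝕜 (toL2 𝕜 halfVol (lap (Q (τ₀ + t - s)))) (d s) = 0 := by
      rw [hw]; simp
    rw [h2] at h1
    -- Decomposition h(r) = R(r) + (r - s) w(r) + ⟨Q(τ₀ + t - r), d s⟩. The last two terms have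
    -- opposite derivatives at s. R is the integral over [s, r] of ⟨ΔQ, d q - d s⟩ with Q taken at
    -- time τ₀ + t - r, hence at most C₂ (r - s)².
    set R : ℝ → 𝕜 := fun r => inner 𝕜 (toL2 𝕜 halfVol (Q (τ₀ + t - r))) (d r)
      - inner 𝕜 (toL2 𝕜 halfVol (Q (τ₀ + t - r))) (d s) - (r - s) • w r with hR
    have hRd : HasDerivWithinAt R 0 (Ici s) s := by
      have hRs : R s = 0 := by simp [hR]
      rw [hasDerivWithinAt_iff_isLittleO, hRs]
      simp only [sub_zero, smul_zero]
      have hO : R =O[𝓝[≥] s] fun r => (r - s) ^ 2 := by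
        refine Asymptotics.IsBigO.of_bound C₂ ?_
        filter_upwards [Ico_mem_nhdsGE hs.2] with r hr
        have hr' : r ∈ Icc 0 t := ⟨hs.1.trans hr.1, hr.2.le⟩
        have hodd := hodd0 ⟨_, hτmem r hr'⟩
        have hq : ∀ q ∈ Icc 0 T, ‖inner 𝕜 (toL2 𝕜 halfVol (lap (lap (Q (τ₀ + t - r))))) (d q)‖
            ≤ C₂ := fun q hq => hC₂ ⟨q, hq⟩ ⟨_, hτmem r hr'⟩
        have hiI : IntervalIntegrable (fun q => inner 𝕜 (toL2 𝕜 halfVol (lap (Q (τ₀ + t - r))))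
            (d q)) volume s r := by
          refine (hint _ hodd).mono_set (uIcc_subset_uIcc ?_ ?_)
          · rw [uIcc_of_le hT]; exact hsub s hs'
          · rw [uIcc_of_le hT]; exact hsub r hr'
        have e : R r = ∫ q in s..r, (inner 𝕜 (toL2 𝕜 halfVol (lap (Q (τ₀ + t - r)))) (d q)
            - w r) := by
          rw [intervalIntegral.integral_sub hiI intervalIntegrable_const,
            intervalIntegral.integral_const, ← hdiff _ hodd s (hsub s hs') r (hsub r hr') hr.1]
        rw [e, Real.norm_of_nonneg (sq_nonneg _), sq, ← mul_assoc]
        have hn := intervalIntegral.norm_integral_le_of_norm_le_const (a := s) (b := r)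
          (C := C₂ * (r - s))
          (f := fun q => inner 𝕜 (toL2 𝕜 halfVol (lap (Q (τ₀ + t - r)))) (d q) - w r)
          (fun q hq1 => by
            rw [uIoc_of_le hr.1] at hq1
            have hqT : q ∈ Icc 0 T := ⟨hs.1.trans hq1.1.le, hq1.2.trans (hsub r hr').2⟩
            have hC2 : 0 ≤ C₂ := (norm_nonneg _).trans (hq q hqT)
            refine (hlip _ C₂ (reflCLM_lap_of_odd hodd) hq s (hsub s hs') q hqT hq1.1.le).trans ?_
            have := hq1.2
            gcongr)
        rwa [abs_of_nonneg (by linarith [hr.1])] at hn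
      refine hO.trans_isLittleO ?_
      have hsq : (fun r : ℝ => (r - s) ^ 2) =o[𝓝 s] fun r => r - s := by
        have := (Asymptotics.isLittleO_pow_id (n := 2) one_lt_two).comp_tendsto
          (show Tendsto (fun r : ℝ => r - s) (𝓝 s) (𝓝 0) from by
            have : ContinuousAt (fun r : ℝ => r - s) s := by fun_prop
            simpa using this.tendsto)
        exact this
      exact hsq.mono nhdsWithin_le_nhds
    have h3 := hRd.add h1.hasDerivWithinAt
    rw [add_zero] at h3
    refine h3.congr_of_mem (fun r _ => ?_) self_mem_Ici
    simp only [hR, hh, Pi.add_apply]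
    ring
  have hconst := constant_of_has_deriv_right_zero hcont hderiv t ⟨ht.1, le_rfl⟩
  have h0 : h 0 = 0 := by
    rw [hh]
    simp only
    rw [hweak _ (hodd0 ⟨_, hτmem 0 ⟨le_rfl, ht.1⟩⟩) 0 ⟨le_rfl, hT⟩, intervalIntegral.integral_same]
  rw [h0, hh] at hconst
  simpa [hQ] using hconst

end Uniqueness

/-! ### Superposition and uniqueness for the half-plane system -/

section Dirichlet

variable {𝕜 : Type*} [RCLike 𝕜]

/-- Controls dominated, uniformly in time, by a bounded function in `L¹ ∩ L²`. -/
def IsDominatedControl (u : ℝ × ℝ → 𝕜) : Prop :=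
  Measurable u ∧ ∃ (A : ℝ → ℝ) (M : ℝ), Integrable A ∧ MemLp A 2 ∧ (∀ b, A b ≤ M) ∧
    ∀ b s, ‖u (b, s)‖ ≤ A b

theorem IsDominatedControl.isControl {u : ℝ × ℝ → 𝕜} (hu : IsDominatedControl u) (T : ℝ) :
    IsControl T u := by
  obtain ⟨hm, A, M, -, hA2, hAM, huA⟩ := hu
  refine ⟨memLp_top_of_bound hm.aestronglyMeasurable M
    (ae_of_all _ fun x => (huA x.1 x.2).trans (hAM _)), ?_⟩
  refine lt_of_le_of_lt (eLpNorm_mono_enorm (g := A) fun b => ?_) hA2.2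
  rw [enorm_eq_self]
  refine essSup_le_of_ae_le _ (ae_of_all _ fun s => ?_)
  change ‖u (b, s)‖ₑ ≤ ‖A b‖ₑ
  rw [← ofReal_norm, ← ofReal_norm]
  exact ENNReal.ofReal_le_ofReal ((huA b s).trans (le_abs_self _))

theorem IsDominatedControl.zero : IsDominatedControl (fun _ : ℝ × ℝ => (0 : 𝕜)) :=
  ⟨measurable_const, fun _ => 0, 0, integrable_zero _ _ _, MemLp.zero', fun _ => le_rfl,
    fun _ _ => by simp⟩

theorem IsDominatedControl.add {u v : ℝ × ℝ → 𝕜} (hu : IsDominatedControl u)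
    (hv : IsDominatedControl v) : IsDominatedControl (fun x => u x + v x) := by
  obtain ⟨hm, A, M, hA1, hA2, hAM, huA⟩ := hu
  obtain ⟨hm', A', M', hA1', hA2', hAM', huA'⟩ := hv
  exact ⟨hm.add hm', fun b => A b + A' b, M + M', hA1.add hA1', hA2.add hA2',
    fun b => add_le_add (hAM b) (hAM' b),
    fun b s => (norm_add_le _ _).trans (add_le_add (huA b s) (huA' b s))⟩

theorem IsDominatedControl.const_smul {u : ℝ × ℝ → 𝕜} (hu : IsDominatedControl u) (r : 𝕜) :
    IsDominatedControl (fun x => r * u x) := by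
  obtain ⟨hm, A, M, hA1, hA2, hAM, huA⟩ := hu
  exact ⟨hm.const_mul r, fun b => ‖r‖ * A b, ‖r‖ * M, hA1.const_mul _, hA2.const_mul _,
    fun b => mul_le_mul_of_nonneg_left (hAM b) (norm_nonneg _),
    fun b s => by rw [norm_mul]; exact mul_le_mul_of_nonneg_left (huA b s) (norm_nonneg _)⟩

theorem IsDominatedControl.integrable {u : ℝ × ℝ → 𝕜} (hu : IsDominatedControl u)
    (φ : 𝓢(ℝ × ℝ, ℝ)) (s : ℝ) :
    Integrable (fun b : ℝ => (∂_{((1, 0) : ℝ × ℝ)} φ) (0, b) • u (b, s)) := by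
  obtain ⟨hm, A, M, hA1, hA2, hAM, huA⟩ := hu
  have hc : Continuous fun b : ℝ => (∂_{((1, 0) : ℝ × ℝ)} φ) (0, b) :=
    (∂_{((1, 0) : ℝ × ℝ)} φ).continuous.comp (by fun_prop)
  refine (hA1.const_mul (SchwartzMap.seminorm ℝ 0 0 (∂_{((1, 0) : ℝ × ℝ)} φ))).mono' ?_ ?_
  · exact (hc.measurable.smul (hm.comp (by fun_prop))).aestronglyMeasurable
  · refine ae_of_all _ fun b => ?_
    rw [norm_smul]
    exact mul_le_mul (SchwartzMap.norm_le_seminorm ℝ _ _) (huA b s) (norm_nonneg _)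
      (apply_nonneg _ _)

/-- The integrable majorant is needed at every time s: the Bochner integral of a non-integrable
function is 0, and additivity could fail. -/
theorem normalTrace_add {u v : ℝ × ℝ → 𝕜} (hu : IsDominatedControl u)
    (hv : IsDominatedControl v) (φ : 𝓢(ℝ × ℝ, ℝ)) (s : ℝ) :
    normalTrace (fun b => u (b, s) + v (b, s)) φ
      = normalTrace (fun b => u (b, s)) φ + normalTrace (fun b => v (b, s)) φ := by
  simp only [normalTrace, smul_add]
  exact integral_add (hu.integrable φ s) (hv.integrable φ s)

theorem normalTrace_const_mul (v : ℝ → 𝕜) (r : 𝕜) (φ : 𝓢(ℝ × ℝ, ℝ)) :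
    normalTrace (fun b => r * v b) φ = r * normalTrace v φ := by
  simp only [normalTrace]
  rw [← integral_const_mul]
  congr 1
  ext b
  rw [RCLike.real_smul_eq_coe_mul, RCLike.real_smul_eq_coe_mul]
  ring

theorem normalTrace_zero (φ : 𝓢(ℝ × ℝ, ℝ)) : normalTrace (fun _ => (0 : 𝕜)) φ = 0 := by
  simp [normalTrace]

theorem isDirichletSolution_iff {T : ℝ} {w0 : Lp 𝕜 2 halfVol} {u : ℝ × ℝ → 𝕜}
    {w : ℝ → Lp 𝕜 2 halfVol} : IsDirichletSolution T w0 u w ↔ w 0 = w0 ∧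
      (∀ φ : 𝓢(ℝ × ℝ, ℝ), (∀ b : ℝ, φ (0, b) = 0) → IntervalIntegrable
        (fun s => inner 𝕜 (toL2 𝕜 halfVol (lap φ)) (w s) + normalTrace (fun b => u (b, s)) φ)
          volume 0 T) ∧
      ∀ φ : 𝓢(ℝ × ℝ, ℝ), (∀ b : ℝ, φ (0, b) = 0) → ∀ t ∈ Icc 0 T,
        inner 𝕜 (toL2 𝕜 halfVol φ) (w t) = inner 𝕜 (toL2 𝕜 halfVol φ) w0
          + ∫ s in (0 : ℝ)..t, (inner 𝕜 (toL2 𝕜 halfVol (lap φ)) (w s)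
            + normalTrace (fun b => u (b, s)) φ) := by
  simp only [inner_toL2]
  exact ⟨fun h => ⟨h.1, h.2, h.3⟩, fun h => ⟨h.1, h.2.1, h.2.2⟩⟩

theorem IsDirichletSolution.add {T : ℝ} {w0 v0 : Lp 𝕜 2 halfVol} {u v : ℝ × ℝ → 𝕜}
    {w w' : ℝ → Lp 𝕜 2 halfVol} (h : IsDirichletSolution T w0 u w)
    (h' : IsDirichletSolution T v0 v w') (hu : IsDominatedControl u) (hv : IsDominatedControl v) :
    IsDirichletSolution T (w0 + v0) (fun x => u x + v x) (fun t => w t + w' t) := by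
  rw [isDirichletSolution_iff] at h h' ⊢
  obtain ⟨h1, h2, h3⟩ := h
  obtain ⟨h1', h2', h3'⟩ := h'
  have e : ∀ (φ : 𝓢(ℝ × ℝ, ℝ)) (s : ℝ), inner 𝕜 (toL2 𝕜 halfVol (lap φ)) (w s + w' s)
      + normalTrace (fun b => u (b, s) + v (b, s)) φ
      = (inner 𝕜 (toL2 𝕜 halfVol (lap φ)) (w s) + normalTrace (fun b => u (b, s)) φ)
      + (inner 𝕜 (toL2 𝕜 halfVol (lap φ)) (w' s) + normalTrace (fun b => v (b, s)) φ) := by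
    intro φ s
    rw [normalTrace_add hu hv, inner_add_right]
    ring
  refine ⟨by rw [h1, h1'], fun φ hφ => ?_, fun φ hφ t ht => ?_⟩
  · simp only [e]
    exact (h2 φ hφ).add (h2' φ hφ)
  · have hsub : uIcc 0 t ⊆ uIcc 0 T := by
      rw [uIcc_of_le ht.1, uIcc_of_le (ht.1.trans ht.2)]
      exact Icc_subset_Icc_right ht.2
    simp only [e]
    rw [intervalIntegral.integral_add ((h2 φ hφ).mono_set hsub) ((h2' φ hφ).mono_set hsub),
      inner_add_right, inner_add_right, h3 φ hφ t ht, h3' φ hφ t ht]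
    ring

theorem IsDirichletSolution.const_smul {T : ℝ} {w0 : Lp 𝕜 2 halfVol} {u : ℝ × ℝ → 𝕜}
    {w : ℝ → Lp 𝕜 2 halfVol} (h : IsDirichletSolution T w0 u w) (r : 𝕜) :
    IsDirichletSolution T (r • w0) (fun x => r * u x) (fun t => r • w t) := by
  rw [isDirichletSolution_iff] at h ⊢
  obtain ⟨h1, h2, h3⟩ := h
  have e : ∀ (φ : 𝓢(ℝ × ℝ, ℝ)) (s : ℝ), inner 𝕜 (toL2 𝕜 halfVol (lap φ)) (r • w s)
      + normalTrace (fun b => r * u (b, s)) φ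
      = r * (inner 𝕜 (toL2 𝕜 halfVol (lap φ)) (w s) + normalTrace (fun b => u (b, s)) φ) := by
    intro φ s
    rw [normalTrace_const_mul, inner_smul_right]
    ring
  refine ⟨by rw [h1], fun φ hφ => ?_, fun φ hφ t ht => ?_⟩
  · simp only [e]
    exact (h2 φ hφ).const_mul r
  · simp only [e]
    rw [intervalIntegral.integral_const_mul, inner_smul_right, inner_smul_right, h3 φ hφ t ht]
    ring

theorem IsDirichletSolution.unique {T : ℝ} {w0 : Lp 𝕜 2 halfVol} {u : ℝ × ℝ → 𝕜}
    {w w' : ℝ → Lp 𝕜 2 halfVol} (h : IsDirichletSolution T w0 u w)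
    (h' : IsDirichletSolution T w0 u w') : EqOn w' w (Icc 0 T) := by
  rw [isDirichletSolution_iff] at h h'
  obtain ⟨h1, h2, h3⟩ := h
  obtain ⟨h1', h2', h3'⟩ := h'
  have e : ∀ (φ : 𝓢(ℝ × ℝ, ℝ)) (s : ℝ), inner 𝕜 (toL2 𝕜 halfVol (lap φ)) (w' s - w s)
      = (inner 𝕜 (toL2 𝕜 halfVol (lap φ)) (w' s) + normalTrace (fun b => u (b, s)) φ)
      - (inner 𝕜 (toL2 𝕜 halfVol (lap φ)) (w s) + normalTrace (fun b => u (b, s)) φ) := by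
    intro φ s
    rw [inner_sub_right]
    ring
  intro t ht
  refine sub_eq_zero.1 (eq_zero_of_odd_weak_heat (T := T) (d := fun t => w' t - w t)
    (fun φ hφ => ?_) (fun φ hφ t ht => ?_) t ht)
  · simp only [e]
    exact (h2' φ (odd_boundary hφ)).sub (h2 φ (odd_boundary hφ))
  · have hsub : uIcc 0 t ⊆ uIcc 0 T := by
      rw [uIcc_of_le ht.1, uIcc_of_le (ht.1.trans ht.2)]
      exact Icc_subset_Icc_right ht.2
    simp only [e]
    rw [intervalIntegral.integral_sub ((h2' φ (odd_boundary hφ)).mono_set hsub)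
      ((h2 φ (odd_boundary hφ)).mono_set hsub), inner_sub_right, h3' φ (odd_boundary hφ) t ht,
      h3 φ (odd_boundary hφ) t ht]
    ring

/-! ### The uncontrolled evolution -/

/-- The heat equation puts the Laplacian on the Gaussian; `green_half` moves it to φ. -/
theorem hasDerivAt_inner_heatSchwartz_right {φ : 𝓢(ℝ × ℝ, ℝ)} (hφ : ∀ b : ℝ, φ (0, b) = 0) (c : ℝ)
    {ε τ : ℝ} (hε : 0 ≤ ε) (hτ : 0 < τ) :
    HasDerivAt (fun s => inner 𝕜 (toL2 𝕜 halfVol φ) (toL2 𝕜 halfVol (heatSchwartz s (s + ε) c)))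
      (inner 𝕜 (toL2 𝕜 halfVol (lap φ)) (toL2 𝕜 halfVol (heatSchwartz τ (τ + ε) c))) τ := by
  have e : ∀ φ ψ : 𝓢(ℝ × ℝ, ℝ), inner 𝕜 (toL2 𝕜 halfVol φ) (toL2 𝕜 halfVol ψ)
      = inner 𝕜 (toL2 𝕜 halfVol ψ) (toL2 𝕜 halfVol φ) := fun φ ψ => by
    rw [inner_toL2_toL2, inner_toL2_toL2]
    simp only [mul_comm]
  have h := hasDerivAt_inner_heatSchwartz (𝕜 := 𝕜) c hε hτ (toL2 𝕜 halfVol φ)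
  rw [e, green_half 𝕜 hφ (heatSchwartz_boundary hτ (by linarith) c)] at h
  simp only [e _ φ] at h
  exact h

theorem continuousOn_inner_heatSchwartz (f : Lp 𝕜 2 halfVol) (c : ℝ) {ε : ℝ} (hε : 0 ≤ ε) :
    ContinuousOn (fun s => inner 𝕜 f (toL2 𝕜 halfVol (heatSchwartz s (s + ε) c))) (Ioi 0) := by
  intro τ hτ
  have h := continuousAt_heatSchwartz (𝕜 := 𝕜) c hε hτ
  exact (continuousAt_const.inner h).continuousWithinAt

/-- The truncation `max t 0` keeps the variances positive for every real t, so the pairings are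
continuous on the whole line. -/
theorem isDirichletSolution_heatSchwartz (T : ℝ) {τ ε : ℝ} (hτ : 0 < τ) (hε : 0 ≤ ε) (c : ℝ) :
    IsDirichletSolution T (toL2 𝕜 halfVol (heatSchwartz τ (τ + ε) c)) (fun _ => 0)
      (fun t => toL2 𝕜 halfVol (heatSchwartz (τ + max t 0) (τ + max t 0 + ε) c)) := by
  have hc : ∀ f : Lp 𝕜 2 halfVol, Continuous fun s : ℝ =>
      inner 𝕜 f (toL2 𝕜 halfVol (heatSchwartz (τ + max s 0) (τ + max s 0 + ε) c)) := fun f => by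
    refine (continuousOn_inner_heatSchwartz f c hε).comp_continuous
      (f := fun s : ℝ => τ + max s 0) (by fun_prop) fun s => ?_
    have := le_max_right s 0
    exact mem_Ioi.2 (by linarith)
  rw [isDirichletSolution_iff]
  simp only [normalTrace_zero, add_zero]
  refine ⟨by simp, fun φ hφ => (hc _).intervalIntegrable _ _, fun φ hφ t ht => ?_⟩
  rw [intervalIntegral.integral_eq_sub_of_hasDerivAt (f := fun s => inner 𝕜 (toL2 𝕜 halfVol φ)
    (toL2 𝕜 halfVol (heatSchwartz (τ + s) (τ + s + ε) c))) (fun s hs => ?_)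
    ((hc _).intervalIntegrable _ _)]
  · simp [max_eq_left ht.1]
  · rw [uIcc_of_le ht.1] at hs
    rw [max_eq_left hs.1]
    have h := hasDerivAt_inner_heatSchwartz_right (𝕜 := 𝕜) hφ c hε
      (show 0 < τ + s by linarith [hs.1])
    exact HasDerivAt.comp_const_add τ s h

/-- A bounded function with `f(t)² ≤ f(0) f(2t)` is maximal at `0`. -/
theorem le_of_sq_le_mul_double {f : ℝ → ℝ} {C : ℝ} (h0 : ∀ t, 0 ≤ t → 0 ≤ f t)
    (hC : ∀ t, 0 ≤ t → f t ≤ C) (h : ∀ t, 0 ≤ t → f t ^ 2 ≤ f 0 * f (2 * t)) {t : ℝ} (ht : 0 ≤ t) :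
    f t ≤ f 0 := by
  by_contra hlt
  push Not at hlt
  have hf0 : 0 < f 0 := by
    rcases (h0 0 le_rfl).lt_or_eq with h1 | h1
    · exact h1
    · have h2 := h t ht
      rw [← h1, zero_mul] at h2
      rw [← h1] at hlt
      nlinarith
  set q := f t / f 0 with hq
  have hq1 : 1 < q := (one_lt_div hf0).2 hlt
  -- Iterated doubling turns one value q > 1 into the unbounded powers q^(2^n), against the bound C.
  have key : ∀ n : ℕ, q ^ (2 ^ n) ≤ f (2 ^ n * t) / f 0 := by
    intro n
    induction n with
    | zero => simp [hq]
    | succ n ih =>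
      have ht' : 0 ≤ 2 ^ n * t := by positivity
      have h1 := h _ ht'
      have h2 : (f (2 ^ n * t) / f 0) ^ 2 ≤ f (2 ^ (n + 1) * t) / f 0 := by
        rw [div_pow, div_le_div_iff₀ (by positivity) hf0]
        have e : 2 * (2 ^ n * t) = 2 ^ (n + 1) * t := by ring
        rw [e] at h1
        nlinarith
      refine le_trans ?_ h2
      rw [pow_succ 2 n, pow_mul]
      exact pow_le_pow_left₀ (by positivity) ih 2
  have hb : ∀ n : ℕ, q ^ n ≤ C / f 0 := fun n => by
    refine (pow_le_pow_right₀ hq1.le (Nat.lt_two_pow_self (n := n)).le).trans ((key n).trans ?_)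
    exact div_le_div_of_nonneg_right (hC _ (by positivity)) hf0.le
  obtain ⟨n, hn⟩ := pow_unbounded_of_one_lt (C / f 0) hq1
  exact absurd (hb n) (not_le.2 hn)

variable (𝕜) in
/-- The set of all Gaussians `heatFun τ (2τ) c`. -/
def gaussianSet (T : ℝ) : Set (Lp 𝕜 2 halfVol) :=
  {f | ∃ τ ∈ Ioo 0 T, ∃ c, f = toL2 𝕜 halfVol (heatSchwartz τ (τ + τ) c)}

theorem span_gaussianSet_dense {T : ℝ} (hT : 0 < T) :
    (Submodule.span 𝕜 (gaussianSet 𝕜 T)).topologicalClosure = ⊤ := by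
  rw [Submodule.topologicalClosure_eq_top_iff, Submodule.eq_bot_iff]
  intro f hf
  exact eq_zero_of_inner_heatSchwartz hT fun τ hτ c =>
    (Submodule.mem_orthogonal _ f).1 hf _ (Submodule.subset_span ⟨τ, hτ, c, rfl⟩)

/-- Superposition gives the solution; the norm bound needs neither an energy estimate nor spectral
theory. It follows from the Gram identity ⟨w t, w t⟩ = ⟨w 0, w (2t)⟩, Cauchy–Schwarz and
`le_of_sq_le_mul_double`. -/
theorem exists_free_solution_of_mem_span (T : ℝ) {f : Lp 𝕜 2 halfVol}
    (hf : f ∈ Submodule.span 𝕜 (gaussianSet 𝕜 1)) :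
    ∃ w, IsDirichletSolution T f (fun _ => 0) w ∧ ∀ t ∈ Icc 0 T, ‖w t‖ ≤ ‖f‖ := by
  obtain ⟨n, a, g, rfl⟩ := Submodule.mem_span_set'.1 hf
  choose τ hτ c hg using fun i => (g i).2
  let κ : Fin n → ℝ → Lp 𝕜 2 halfVol := fun i t =>
    toL2 𝕜 halfVol (heatSchwartz (τ i + max t 0) (τ i + max t 0 + τ i) (c i))
  have hsol : ∀ s : Finset (Fin n), IsDirichletSolution T (∑ i ∈ s, a i • (g i : Lp 𝕜 2 halfVol))
      (fun _ => 0) (fun t => ∑ i ∈ s, a i • κ i t) := by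
    intro s
    classical
    induction s using Finset.induction_on with
    | empty =>
      rw [isDirichletSolution_iff]
      simp [normalTrace_zero]
    | insert i s hi ih =>
      have h1 := ((isDirichletSolution_heatSchwartz (𝕜 := 𝕜) T (hτ i).1 (hτ i).1.le
        (c i)).const_smul (a i))
      simp only [mul_zero] at h1
      have h2 := h1.add ih IsDominatedControl.zero IsDominatedControl.zero
      simp only [add_zero] at h2
      simp only [Finset.sum_insert hi]
      rw [hg i]
      exact h2
  refine ⟨_, hsol Finset.univ, fun t ht => ?_⟩
  set w : ℝ → Lp 𝕜 2 halfVol := fun t => ∑ i, a i • κ i t with hw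
  have hw0 : w 0 = ∑ i, a i • (g i : Lp 𝕜 2 halfVol) := (hsol Finset.univ).initial
  have hpos : ∀ i t, 0 < τ i + max t 0 := fun i t => by
    have := (hτ i).1
    positivity
  -- Any bound will do, however dependent on the chosen representation: doubling improves it to the
  -- sharp one.
  have hbd : ∃ C, ∀ t, 0 ≤ t → ‖w t‖ ≤ C := by
    choose B hB0 hB using fun i => exists_norm_heatSchwartz_le 𝕜 (c i) (hτ i).1
    refine ⟨∑ i, ‖a i‖ * (B i * (τ i) ^ (-(3 / 4) : ℝ)), fun t ht => ?_⟩
    refine (norm_sum_le _ _).trans (Finset.sum_le_sum fun i _ => ?_)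
    rw [norm_smul]
    refine mul_le_mul_of_nonneg_left ((hB i _ (hpos i t)).trans ?_) (norm_nonneg _)
    refine mul_le_mul_of_nonneg_left ?_ (hB0 i)
    exact Real.rpow_le_rpow_of_nonpos (hτ i).1 (by linarith [le_max_right t 0]) (by norm_num)
  -- Term by term, (τᵢ + t) + (τⱼ + t) = (τᵢ + 2t) + τⱼ.
  have hinner : ∀ t, 0 ≤ t → inner 𝕜 (w t) (w t) = inner 𝕜 (w 0) (w (2 * t)) := by
    intro t ht
    simp only [hw, sum_inner, inner_sum, inner_smul_left, inner_smul_right]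
    refine Finset.sum_congr rfl fun i _ => congrArg (a i * ·) (Finset.sum_congr rfl fun j _ => ?_)
    simp only [κ]
    have h1 := (hτ i).1
    have h2 := (hτ j).1
    have h3 := hpos i t
    have h4 := hpos j t
    have h5 := hpos j 0
    have h6 := hpos i (2 * t)
    rw [inner_heatSchwartz h4 (add_pos h4 h2) h3 (add_pos h3 h1),
      inner_heatSchwartz h5 (add_pos h5 h2) h6 (add_pos h6 h1), max_eq_left ht, max_self,
      max_eq_left (show 0 ≤ 2 * t by linarith)]
    ring_nf
  obtain ⟨C, hC⟩ := hbd
  rw [← hw0]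
  refine le_of_sq_le_mul_double (f := fun t => ‖w t‖) (fun _ _ => norm_nonneg _) hC
    (fun t ht => ?_) ht.1
  have h1 : ‖w t‖ ^ 2 = ‖inner 𝕜 (w t) (w t)‖ := by
    rw [inner_self_eq_norm_sq_to_K]
    simp
  rw [h1, hinner t ht]
  exact norm_inner_le_norm _ _

/-- Contraction on a dense subspace gives convergence of the approximations at each time, and the
uniform norm bound lets the weak equation pass to the limit. -/
theorem exists_free_solution {T : ℝ} (hT : 0 ≤ T) (w0 : Lp 𝕜 2 halfVol) :
    ∃ w, IsDirichletSolution T w0 (fun _ => 0) w := by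
  have hmem : w0 ∈ closure (Submodule.span 𝕜 (gaussianSet 𝕜 1) : Set (Lp 𝕜 2 halfVol)) := by
    have h := span_gaussianSet_dense (𝕜 := 𝕜) one_pos
    rw [← Submodule.topologicalClosure_coe, h]
    trivial
  obtain ⟨x, hx, hlim⟩ := mem_closure_iff_seq_limit.1 hmem
  choose w hw hwn using fun n => exists_free_solution_of_mem_span T (hx n)
  -- The contraction bound holds for some solution starting at `x n - x m`; uniqueness identifies it
  -- with the difference of the chosen ones.
  have hdiff : ∀ n m, ∀ t ∈ Icc 0 T, ‖w n t - w m t‖ ≤ ‖x n - x m‖ := by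
    intro n m t ht
    obtain ⟨v, hv, hvn⟩ := exists_free_solution_of_mem_span T (Submodule.sub_mem _ (hx n) (hx m))
    have h1 := (hw n).add ((hw m).const_smul (-1)) IsDominatedControl.zero
      (IsDominatedControl.zero.const_smul (-1))
    simp only [mul_zero, add_zero, neg_smul, one_smul, ← sub_eq_add_neg] at h1
    have h2 := hv.unique h1 ht
    rw [h2]
    exact hvn t ht
  have hcau : ∀ t ∈ Icc 0 T, ∃ y, Tendsto (fun n => w n t) atTop (𝓝 y) := by
    intro t ht
    refine cauchySeq_tendsto_of_complete (Metric.cauchySeq_iff.2 fun δ hδ => ?_)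
    obtain ⟨N, hN⟩ := Metric.cauchySeq_iff.1 hlim.cauchySeq δ hδ
    refine ⟨N, fun m hm n hn => ?_⟩
    rw [dist_eq_norm]
    exact (hdiff m n t ht).trans_lt (by rw [← dist_eq_norm]; exact hN m hm n hn)
  classical
  let v : ℝ → Lp 𝕜 2 halfVol := fun t => if ht : t ∈ Icc 0 T then (hcau t ht).choose else 0
  have hv : ∀ t ∈ Icc 0 T, Tendsto (fun n => w n t) atTop (𝓝 (v t)) := by
    intro t ht
    simp only [v, dif_pos ht]
    exact (hcau t ht).choose_spec
  obtain ⟨B, hB⟩ := (hlim.norm.bddAbove_range)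
  have hwB : ∀ n, ∀ t ∈ Icc 0 T, ‖w n t‖ ≤ B := fun n t ht =>
    (hwn n t ht).trans (hB ⟨n, rfl⟩)
  have hw' := fun n => isDirichletSolution_iff.1 (hw n)
  simp only [normalTrace_zero, add_zero] at hw'
  have hvin : ∀ (φ : 𝓢(ℝ × ℝ, ℝ)), ∀ t ∈ Icc 0 T, Tendsto (fun n =>
      inner 𝕜 (toL2 𝕜 halfVol φ) (w n t)) atTop (𝓝 (inner 𝕜 (toL2 𝕜 halfVol φ) (v t))) :=
    fun φ t ht => tendsto_const_nhds.inner (hv t ht)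
  have hIoc : ∀ s ∈ uIoc 0 T, s ∈ Icc 0 T := fun s hs => by
    rw [uIoc_of_le hT] at hs
    exact ⟨hs.1.le, hs.2⟩
  have hmeas : ∀ φ : 𝓢(ℝ × ℝ, ℝ), (∀ b : ℝ, φ (0, b) = 0) → AEStronglyMeasurable
      (fun s => inner 𝕜 (toL2 𝕜 halfVol (lap φ)) (v s)) (volume.restrict (uIoc 0 T)) := by
    intro φ hφ
    refine aestronglyMeasurable_of_tendsto_ae atTop
      (fun n => ((hw' n).2.1 φ hφ).def'.aestronglyMeasurable) ?_
    filter_upwards [ae_restrict_mem measurableSet_uIoc] with s hs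
    exact hvin _ s (hIoc s hs)
  refine ⟨v, ?_⟩
  rw [isDirichletSolution_iff]
  simp only [normalTrace_zero, add_zero]
  have h0 : (0 : ℝ) ∈ Icc 0 T := ⟨le_rfl, hT⟩
  refine ⟨?_, fun φ hφ => ?_, fun φ hφ t ht => ?_⟩
  · refine tendsto_nhds_unique (hv 0 h0) ?_
    simp only [fun n => (hw' n).1]
    exact hlim
  · rw [intervalIntegrable_iff]
    refine Integrable.mono' (g := fun _ => ‖toL2 𝕜 halfVol (lap φ)‖ * B)
      ((intervalIntegrable_iff (a := 0) (b := T)).1 intervalIntegrable_const) (hmeas φ hφ) ?_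
    filter_upwards [ae_restrict_mem measurableSet_uIoc] with s hs
    refine (norm_inner_le_norm _ _).trans (mul_le_mul_of_nonneg_left ?_ (norm_nonneg _))
    exact le_of_tendsto (hv s (hIoc s hs)).norm
      (Eventually.of_forall fun n => hwB n s (hIoc s hs))
  · have hsub : uIoc 0 t ⊆ uIoc 0 T := by
      rw [uIoc_of_le ht.1, uIoc_of_le hT]
      exact Ioc_subset_Ioc_right ht.2
    have h1 : Tendsto (fun n => ∫ s in (0 : ℝ)..t, inner 𝕜 (toL2 𝕜 halfVol (lap φ)) (w n s)) atTop
        (𝓝 (∫ s in (0 : ℝ)..t, inner 𝕜 (toL2 𝕜 halfVol (lap φ)) (v s))) := by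
      refine intervalIntegral.tendsto_integral_filter_of_dominated_convergence
        (fun _ => ‖toL2 𝕜 halfVol (lap φ)‖ * B) ?_ ?_ intervalIntegrable_const ?_
      · refine Eventually.of_forall fun n => ?_
        exact ((hw' n).2.1 φ hφ).def'.aestronglyMeasurable.mono_set hsub
      · refine Eventually.of_forall fun n => ae_of_all _ fun s hs => ?_
        exact (norm_inner_le_norm _ _).trans
          (mul_le_mul_of_nonneg_left (hwB n s (hIoc s (hsub hs))) (norm_nonneg _))
      · exact ae_of_all _ fun s hs => hvin _ s (hIoc s (hsub hs))
    have h2 : Tendsto (fun n => inner 𝕜 (toL2 𝕜 halfVol φ) (x n)) atTop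
        (𝓝 (inner 𝕜 (toL2 𝕜 halfVol φ) w0)) := tendsto_const_nhds.inner hlim
    refine tendsto_nhds_unique (hvin φ t ht) ?_
    simp only [fun n => (hw' n).2.2 φ hφ t ht]
    exact h2.add h1

end Dirichlet

/-! ### Solutions generated by a control switched on at a fixed time -/

section Controlled

variable {𝕜 : Type*} [RCLike 𝕜]

theorem traceProfile_nonneg (ε c b : ℝ) : 0 ≤ traceProfile ε c b :=
  mul_nonneg (setIntegral_nonneg measurableSet_Ioi fun y _ => by positivity) (Real.exp_pos _).le

theorem continuous_traceProfile (ε c : ℝ) : Continuous (traceProfile ε c) := by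
  unfold traceProfile
  fun_prop

theorem integrable_traceProfile {ε : ℝ} (hε : 0 < ε) (c : ℝ) : Integrable (traceProfile ε c) :=
  (integrable_shifted_gaussian hε _ c).const_mul _

theorem memLp_traceProfile {ε : ℝ} (hε : 0 < ε) (c : ℝ) : MemLp (traceProfile ε c) 2 := by
  rw [memLp_two_iff_integrable_sq (continuous_traceProfile ε c).aestronglyMeasurable]
  refine ((integrable_shifted_gaussian (half_pos hε) (2 * (-(1 / 2) * Real.log ε)) c).const_mul
    ((∫ y in Ioi (0 : ℝ), y ^ 2 * Real.exp (-(1 / 4) * y ^ 2)) ^ 2)).congr (ae_of_all _ fun b => ?_)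
  simp only [traceProfile]
  rw [mul_pow, ← Real.exp_nat_mul]
  congr 2
  field_simp
  push_cast
  ring

theorem traceProfile_le {ε : ℝ} (hε : 0 < ε) (c b : ℝ) :
    traceProfile ε c b ≤ traceProfile ε c c := by
  unfold traceProfile
  refine mul_le_mul_of_nonneg_left (Real.exp_le_exp.2 ?_)
    (setIntegral_nonneg measurableSet_Ioi fun y _ => by positivity)
  rw [sub_self]
  have : 0 ≤ (b - c) ^ 2 / (4 * ε) := by positivity
  linarith [show (0 : ℝ) ^ 2 / (4 * ε) = 0 by simp]

variable (𝕜) in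
/-- The profile `traceProfile ε c`, switched on at time `s₀`. -/
def switchedControl (ε c s₀ : ℝ) (x : ℝ × ℝ) : 𝕜 :=
  if s₀ < x.2 then ((traceProfile ε c x.1 : ℝ) : 𝕜) else 0

theorem isDominatedControl_switchedControl {ε : ℝ} (hε : 0 < ε) (c s₀ : ℝ) :
    IsDominatedControl (switchedControl 𝕜 ε c s₀) := by
  refine ⟨?_, traceProfile ε c, _, integrable_traceProfile hε c, memLp_traceProfile hε c,
    traceProfile_le hε c, fun b s => ?_⟩
  · refine Measurable.ite (measurableSet_lt measurable_const measurable_snd) ?_ measurable_const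
    exact (RCLike.continuous_ofReal.comp
      ((continuous_traceProfile ε c).comp continuous_fst)).measurable
  · unfold switchedControl
    split_ifs
    · rw [RCLike.norm_ofReal, abs_of_nonneg (traceProfile_nonneg _ _ _)]
    · simpa using traceProfile_nonneg ε c b

/-- The norm is O(τ^(-3/4)), and -3/4 > -1. -/
theorem intervalIntegrable_heatSchwartz {ε : ℝ} (hε : 0 < ε) (c : ℝ) {r : ℝ} (hr : 0 ≤ r) :
    IntervalIntegrable (fun τ => toL2 𝕜 halfVol (heatSchwartz τ (τ + ε) c)) volume 0 r := by
  obtain ⟨C, -, hC⟩ := exists_norm_heatSchwartz_le 𝕜 c hε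
  have hb : IntervalIntegrable (fun τ : ℝ => C * τ ^ (-(3 / 4) : ℝ)) volume 0 r :=
    (intervalIntegral.intervalIntegrable_rpow' (by norm_num)).const_mul C
  rw [intervalIntegrable_iff, uIoc_of_le hr] at hb ⊢
  refine Integrable.mono' hb ?_ ?_
  · refine ContinuousOn.aestronglyMeasurable (fun τ hτ => ?_) measurableSet_Ioc
    exact (continuousAt_heatSchwartz c hε.le hτ.1).continuousWithinAt
  · filter_upwards [ae_restrict_mem measurableSet_Ioc] with τ hτ
    exact hC τ hτ.1

variable (𝕜) in
/-- The state reached from `0` after time `r` under the constant control `traceProfile ε c`. -/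
def accumulatedHeat (ε c r : ℝ) : Lp 𝕜 2 halfVol :=
  ∫ τ in (0 : ℝ)..r, toL2 𝕜 halfVol (heatSchwartz τ (τ + ε) c)

theorem hasDerivAt_accumulatedHeat {ε : ℝ} (hε : 0 < ε) (c : ℝ) {r : ℝ} (hr : 0 < r) :
    HasDerivAt (accumulatedHeat 𝕜 ε c) (toL2 𝕜 halfVol (heatSchwartz r (r + ε) c)) r := by
  refine intervalIntegral.integral_hasDerivAt_right (intervalIntegrable_heatSchwartz hε c hr.le) ?_
    (continuousAt_heatSchwartz c hε.le hr)
  refine ContinuousOn.stronglyMeasurableAtFilter isOpen_Ioi (fun τ hτ => ?_) r (mem_Ioi.2 hr)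
  exact (continuousAt_heatSchwartz c hε.le hτ).continuousWithinAt

theorem continuousOn_accumulatedHeat {ε : ℝ} (hε : 0 < ε) (c : ℝ) {r : ℝ} (hr : 0 ≤ r) :
    ContinuousOn (accumulatedHeat 𝕜 ε c) (uIcc 0 r) :=
  intervalIntegral.continuousOn_primitive_interval' (intervalIntegrable_heatSchwartz hε c hr)
    left_mem_uIcc

theorem inner_accumulatedHeat {ε : ℝ} (hε : 0 < ε) (c : ℝ) {r : ℝ} (hr : 0 ≤ r)
    (f : Lp 𝕜 2 halfVol) : inner 𝕜 f (accumulatedHeat 𝕜 ε c r)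
      = ∫ τ in (0 : ℝ)..r, inner 𝕜 f (toL2 𝕜 halfVol (heatSchwartz τ (τ + ε) c)) :=
  ((innerSL 𝕜 f).intervalIntegral_comp_comm (intervalIntegrable_heatSchwartz hε c hr)).symm

/-- Fundamental theorem of calculus on (0, τ): the limit at the lower endpoint is the boundary
trace, and this is how the control enters the weak equation. -/
theorem inner_heatSchwartz_eq_trace_add {φ : 𝓢(ℝ × ℝ, ℝ)} (hφ : ∀ b : ℝ, φ (0, b) = 0) {ε : ℝ}
    (hε : 0 < ε) (c : ℝ) {τ : ℝ} (hτ : 0 < τ) :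
    inner 𝕜 (toL2 𝕜 halfVol φ) (toL2 𝕜 halfVol (heatSchwartz τ (τ + ε) c))
      = inner 𝕜 (toL2 𝕜 halfVol (lap φ)) (accumulatedHeat 𝕜 ε c τ)
        + normalTrace (fun b => ((traceProfile ε c b : ℝ) : 𝕜)) φ := by
  rw [inner_accumulatedHeat hε c hτ.le, intervalIntegral.integral_eq_sub_of_hasDerivAt_of_tendsto
    hτ (fun s hs => hasDerivAt_inner_heatSchwartz_right hφ c hε.le hs.1) ?_
    (tendsto_inner_heatSchwartz 𝕜 hφ hε c)
    ((hasDerivAt_inner_heatSchwartz_right hφ c hε.le hτ).continuousAt.tendsto.mono_left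
      nhdsWithin_le_nhds)]
  · ring
  · have h := intervalIntegrable_heatSchwartz (𝕜 := 𝕜) hε c hτ.le
    exact ⟨(innerSL 𝕜 _).integrable_comp h.1, (innerSL 𝕜 _).integrable_comp h.2⟩

theorem inner_accumulatedHeat_eq {φ : 𝓢(ℝ × ℝ, ℝ)} (hφ : ∀ b : ℝ, φ (0, b) = 0) {ε : ℝ}
    (hε : 0 < ε) (c : ℝ) {r : ℝ} (hr : 0 ≤ r) :
    inner 𝕜 (toL2 𝕜 halfVol φ) (accumulatedHeat 𝕜 ε c r)
      = ∫ τ in (0 : ℝ)..r, (inner 𝕜 (toL2 𝕜 halfVol (lap φ)) (accumulatedHeat 𝕜 ε c τ)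
        + normalTrace (fun b => ((traceProfile ε c b : ℝ) : 𝕜)) φ) := by
  rw [inner_accumulatedHeat hε c hr]
  refine intervalIntegral.integral_congr_ae (ae_of_all _ fun τ hτ => ?_)
  rw [uIoc_of_le hr] at hτ
  exact inner_heatSchwartz_eq_trace_add hφ hε c hτ.1

/-- Delaying a function: `∫₀ᵗ 1_{s > s₀} G(s - s₀) ds = ∫₀^{(t - s₀)⁺} G`. -/
theorem intervalIntegral_delayed {E : Type*} [NormedAddCommGroup E] [NormedSpace ℝ E] {F G : ℝ → E}
    {s₀ : ℝ} (hs₀ : 0 ≤ s₀) (h0 : ∀ s ≤ s₀, F s = 0) (h1 : ∀ s, s₀ < s → F s = G (s - s₀))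
    {t : ℝ} (ht : 0 ≤ t)
    (hG : IntervalIntegrable G volume 0 (max (t - s₀) 0)) :
    IntervalIntegrable F volume 0 t ∧
      ∫ s in (0 : ℝ)..t, F s = ∫ s in (0 : ℝ)..max (t - s₀) 0, G s := by
  have hz : ∀ a ≤ s₀, 0 ≤ a → IntervalIntegrable F volume 0 a ∧ ∫ s in (0 : ℝ)..a, F s = 0 := by
    intro a ha ha0
    have e : EqOn (fun _ => (0 : E)) F (uIoc 0 a) := fun s hs => by
      rw [uIoc_of_le ha0] at hs
      exact (h0 s (hs.2.trans ha)).symm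
    refine ⟨(intervalIntegrable_const (c := (0 : E))).congr e, ?_⟩
    rw [← intervalIntegral.integral_congr_ae (ae_of_all _ fun s hs => e hs)]
    simp
  rcases le_total t s₀ with hts | hts
  · rw [max_eq_right (by linarith), intervalIntegral.integral_same]
    exact hz t hts ht
  · rw [max_eq_left (by linarith)] at hG ⊢
    have e : EqOn (fun s => G (s - s₀)) F (uIoc s₀ t) := fun s hs => by
      rw [uIoc_of_le hts] at hs
      exact (h1 s hs.1).symm
    have h2 := hG.comp_sub_right s₀
    rw [zero_add, sub_add_cancel] at h2
    have h3 := h2.congr e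
    obtain ⟨h4, h5⟩ := hz s₀ le_rfl hs₀
    refine ⟨h4.trans h3, ?_⟩
    rw [← intervalIntegral.integral_add_adjacent_intervals h4 h3, h5, zero_add,
      ← intervalIntegral.integral_congr_ae (ae_of_all _ fun s hs => e hs),
      intervalIntegral.integral_comp_sub_right, sub_self]

/-- Duhamel's principle: nothing happens before s₀, and afterwards the state depends only on the
elapsed time t - s₀. -/
theorem isDirichletSolution_switchedControl (T : ℝ) {ε : ℝ} (hε : 0 < ε) (c : ℝ) {s₀ : ℝ}
    (hs₀ : 0 ≤ s₀) (hT : 0 ≤ T) :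
    IsDirichletSolution T 0 (switchedControl 𝕜 ε c s₀)
      (fun t => accumulatedHeat 𝕜 ε c (max (t - s₀) 0)) := by
  have hzero : accumulatedHeat 𝕜 ε c 0 = 0 := intervalIntegral.integral_same
  have hGint : ∀ (φ : 𝓢(ℝ × ℝ, ℝ)) (r : ℝ), 0 ≤ r → IntervalIntegrable (fun τ =>
      inner 𝕜 (toL2 𝕜 halfVol (lap φ)) (accumulatedHeat 𝕜 ε c τ)
        + normalTrace (fun b => ((traceProfile ε c b : ℝ) : 𝕜)) φ) volume 0 r := fun φ r hr =>
    ((continuousOn_const.inner (continuousOn_accumulatedHeat hε c hr)).add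
      continuousOn_const).intervalIntegrable
  have key := fun (φ : 𝓢(ℝ × ℝ, ℝ)) (t : ℝ) (ht : 0 ≤ t) => intervalIntegral_delayed
    (F := fun s => inner 𝕜 (toL2 𝕜 halfVol (lap φ)) (accumulatedHeat 𝕜 ε c (max (s - s₀) 0))
      + normalTrace (fun b => switchedControl 𝕜 ε c s₀ (b, s)) φ) hs₀ (fun s hs => by
        simp only [switchedControl, if_neg (not_lt.2 hs), normalTrace_zero,
          max_eq_right (sub_nonpos.2 hs), hzero, inner_zero_right, add_zero])
      (fun s hs => by
        simp only [switchedControl, if_pos hs, max_eq_left (sub_pos.2 hs).le]) ht (hGint φ _ (le_max_right _ _))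
  rw [isDirichletSolution_iff]
  refine ⟨?_, fun φ _ => (key φ T hT).1, fun φ hφ t ht => ?_⟩
  · simp only [max_eq_right (show 0 - s₀ ≤ 0 by linarith), hzero]
  · rw [(key φ t ht.1).2, inner_zero_right, zero_add,
      inner_accumulatedHeat_eq hφ hε c (le_max_right _ _)]

/-! ### Approximate controllability on the half-plane -/

variable (𝕜) in
/-- The states reachable from `0` in time `T` with dominated controls. -/
def dominatedReachable (T : ℝ) : Submodule 𝕜 (Lp 𝕜 2 halfVol) where
  carrier := {f | ∃ u : ℝ × ℝ → 𝕜, IsDominatedControl u ∧ ∃ w, IsDirichletSolution T 0 u w ∧ w T = f}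
  zero_mem' := ⟨fun _ => 0, IsDominatedControl.zero, fun _ => 0, by
    rw [isDirichletSolution_iff]
    simp [normalTrace_zero], rfl⟩
  add_mem' := by
    rintro _ _ ⟨u, hu, w, hw, rfl⟩ ⟨v, hv, w', hw', rfl⟩
    refine ⟨_, hu.add hv, fun t => w t + w' t, ?_, rfl⟩
    simpa only [add_zero] using hw.add hw' hu hv
  smul_mem' := by
    rintro r _ ⟨u, hu, w, hw, rfl⟩
    refine ⟨_, hu.const_smul r, fun t => r • w t, ?_, rfl⟩
    simpa only [smul_zero] using hw.const_smul r

/-- Wait until time T - r, then switch the profile on. -/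
theorem accumulatedHeat_mem_dominatedReachable {T ε : ℝ} (hε : 0 < ε) (c : ℝ) {r : ℝ}
    (hr : r ∈ Icc 0 T) : accumulatedHeat 𝕜 ε c r ∈ dominatedReachable 𝕜 T := by
  refine ⟨_, isDominatedControl_switchedControl hε c (T - r), _,
    isDirichletSolution_switchedControl T hε c (sub_nonneg.2 hr.2) (hr.1.trans hr.2), ?_⟩
  simp only [sub_sub_cancel, max_eq_left hr.1]

/-- Difference quotients in r of `accumulatedHeat` are reachable and converge to the Gaussian at
time r; choosing the offset ε = r makes this limit a member of the total set `gaussianSet`. -/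
theorem dominatedReachable_dense {T : ℝ} (hT : 0 < T) :
    (dominatedReachable 𝕜 T).topologicalClosure = ⊤ := by
  rw [eq_top_iff, ← span_gaussianSet_dense (𝕜 := 𝕜) hT]
  refine Submodule.topologicalClosure_minimal _ (Submodule.span_le.2 ?_)
    (Submodule.isClosed_topologicalClosure _)
  rintro _ ⟨r, hr, c, rfl⟩
  have h := hasDerivAt_iff_tendsto_slope.1 (hasDerivAt_accumulatedHeat (𝕜 := 𝕜) hr.1 c hr.1)
  refine mem_closure_of_tendsto h ?_
  have hmem : Icc 0 T ∈ 𝓝[≠] r := nhdsWithin_le_nhds (Icc_mem_nhds hr.1 hr.2)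
  filter_upwards [hmem] with y hy
  rw [slope_def_module]
  exact Submodule.smul_of_tower_mem _ _ (Submodule.sub_mem _
    (accumulatedHeat_mem_dominatedReachable hr.1 c hy)
    (accumulatedHeat_mem_dominatedReachable hr.1 c ⟨hr.1.le, hr.2.le⟩))

/-- By linearity it suffices to steer 0 close to the target minus the freely evolved initial state.
-/
theorem exists_dominated_solution_near {T : ℝ} (hT : 0 < T) (w0 wT : Lp 𝕜 2 halfVol) {δ : ℝ}
    (hδ : 0 < δ) : ∃ u, IsDominatedControl u ∧ ∃ w, IsDirichletSolution T w0 u w ∧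
      ‖w T - wT‖ < δ := by
  obtain ⟨v, hv⟩ := exists_free_solution hT.le w0
  have hmem : wT - v T ∈ closure (dominatedReachable 𝕜 T : Set (Lp 𝕜 2 halfVol)) := by
    rw [← Submodule.topologicalClosure_coe, dominatedReachable_dense hT]
    trivial
  obtain ⟨_, ⟨u, hu, w, hw, rfl⟩, hd⟩ := Metric.mem_closure_iff.1 hmem δ hδ
  refine ⟨_, IsDominatedControl.zero.add hu, fun t => v t + w t, ?_, ?_⟩
  · simpa only [add_zero] using hv.add hw IsDominatedControl.zero hu
  · rw [dist_eq_norm, norm_sub_rev] at hd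
    have e : v T + w T - wT = w T - (wT - v T) := by abel
    change ‖v T + w T - wT‖ < δ
    rwa [e]

theorem dirichletApproxControllable {T : ℝ} (hT : 0 < T) (w0 wT : Lp 𝕜 2 halfVol) :
    DirichletApproxControllable T w0 wT := by
  refine Metric.mem_closure_iff.2 fun δ hδ => ?_
  obtain ⟨u, hu, w, hw, h⟩ := exists_dominated_solution_near hT w0 wT hδ
  refine ⟨w T, ⟨u, hu.isControl T, w, hw, fun w' hw' => hw.unique hw', rfl⟩, ?_⟩
  rwa [dist_eq_norm, norm_sub_rev]

end Controlled

/-! ### Odd functions on the plane and functions on the half-plane -/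

section OddExtension

variable {𝕜 : Type*} [RCLike 𝕜]

/-- The reflection `(x₁, x₂) ↦ (-x₁, x₂)` of the plane. -/
def reflEquiv : (ℝ × ℝ) ≃ᵐ (ℝ × ℝ) :=
  (MeasurableEquiv.neg ℝ).prodCongr (MeasurableEquiv.refl ℝ)

theorem reflEquiv_apply (x : ℝ × ℝ) : reflEquiv x = (-x.1, x.2) := rfl

theorem measurePreserving_reflEquiv :
    MeasurePreserving reflEquiv (volume : Measure (ℝ × ℝ)) volume :=
  (Measure.measurePreserving_neg (volume : Measure ℝ)).prod
    (MeasurePreserving.id (volume : Measure ℝ))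

theorem volume_eq_halfVol_add_map :
    (volume : Measure (ℝ × ℝ)) = halfVol + halfVol.map reflEquiv := by
  have hS : MeasurableSet (Ioi (0 : ℝ) ×ˢ (univ : Set ℝ)) := measurableSet_Ioi.prod MeasurableSet.univ
  have h1 : halfVol.map reflEquiv = volume.restrict (Ioi (0 : ℝ) ×ˢ (univ : Set ℝ))ᶜ := by
    have e : Ioi (0 : ℝ) ×ˢ (univ : Set ℝ)
        = reflEquiv ⁻¹' (Iio (0 : ℝ) ×ˢ (univ : Set ℝ)) := by
      ext x
      simp [reflEquiv_apply]
    rw [halfVol, e, ← reflEquiv.measurableEmbedding.restrict_map,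
      measurePreserving_reflEquiv.map_eq, ← e]
    refine Measure.restrict_congr_set ?_
    have hnull : (volume : Measure (ℝ × ℝ)) ({0} ×ˢ univ) = 0 := by
      rw [Measure.volume_eq_prod, Measure.prod_prod]
      simp
    have hae := compl_mem_ae_iff.2 hnull
    filter_upwards [hae] with x hx
    refine propext ⟨fun h => ?_, fun h => ?_⟩
    · exact fun h' => lt_asymm (mem_Iio.1 (mem_prod.1 h).1) (mem_Ioi.1 (mem_prod.1 h').1)
    · refine ⟨lt_of_le_of_ne (not_lt.1 fun h' => h ⟨h', trivial⟩) fun h' => hx ⟨h', trivial⟩,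
        trivial⟩
  rw [h1, halfVol, Measure.restrict_add_restrict_compl hS]

theorem integral_eq_integral_half_add {E : Type*} [NormedAddCommGroup E] [NormedSpace ℝ E]
    {g : ℝ × ℝ → E} (hg : Integrable g) :
    ∫ x, g x = ∫ x, (g x + g (-x.1, x.2)) ∂halfVol := by
  have h := hg
  rw [volume_eq_halfVol_add_map, integrable_add_measure] at h
  have h2 := reflEquiv.measurableEmbedding.integrable_map_iff.1 h.2
  rw [volume_eq_halfVol_add_map, integral_add_measure h.1 h.2,
    reflEquiv.measurableEmbedding.integral_map]
  exact (integral_add h.1 h2).symm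

variable (𝕜) in
/-- Restriction of odd functions to the half-plane. -/
def halfRestrict : oddL2 𝕜 →L[𝕜] Lp 𝕜 2 halfVol :=
  (LpToLpRestrictCLM (ℝ × ℝ) 𝕜 𝕜 volume 2 (Ioi (0 : ℝ) ×ˢ (univ : Set ℝ))).comp (oddL2 𝕜).subtypeL

theorem halfRestrict_coeFn (W : oddL2 𝕜) : halfRestrict 𝕜 W =ᵐ[halfVol] W.1 :=
  LpToLpRestrictCLM_coeFn 𝕜 (Ioi (0 : ℝ) ×ˢ (univ : Set ℝ)) W.1

theorem ae_halfVol {p : ℝ × ℝ → Prop} (h : ∀ᵐ x, p x) : ∀ᵐ x ∂halfVol, p x :=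
  ae_restrict_of_ae h

theorem norm_sq_eq_integral (μ : Measure (ℝ × ℝ)) (f : Lp 𝕜 2 μ) :
    ‖f‖ ^ 2 = ∫ x, ‖f x‖ ^ 2 ∂μ := by
  have h := L2.inner_def (𝕜 := 𝕜) f f
  simp only [inner_self_eq_norm_sq_to_K] at h
  rw [← RCLike.ofReal_pow] at h
  simp only [← RCLike.ofReal_pow] at h
  rw [integral_ofReal] at h
  exact RCLike.ofReal_injective h

theorem norm_sq_eq_two_mul_halfRestrict (W : oddL2 𝕜) : ‖W‖ ^ 2 = 2 * ‖halfRestrict 𝕜 W‖ ^ 2 := by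
  have hW : Integrable fun x => ‖W.1 x‖ ^ 2 := (Lp.memLp W.1).norm.integrable_sq
  rw [show ‖W‖ = ‖W.1‖ from rfl, norm_sq_eq_integral (𝕜 := 𝕜), integral_eq_integral_half_add hW,
    norm_sq_eq_integral, ← integral_const_mul]
  refine integral_congr_ae ?_
  filter_upwards [halfRestrict_coeFn W, ae_halfVol W.2] with x h1 h2
  rw [h1, h2, norm_neg]
  ring

theorem norm_le_two_mul_halfRestrict (W : oddL2 𝕜) : ‖W‖ ≤ 2 * ‖halfRestrict 𝕜 W‖ := by
  refine le_of_sq_le_sq ?_ (by positivity)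
  rw [norm_sq_eq_two_mul_halfRestrict, mul_pow]
  nlinarith [sq_nonneg ‖halfRestrict 𝕜 W‖]

theorem halfRestrict_injective : Function.Injective (halfRestrict 𝕜) := by
  intro W W' h
  have h1 := norm_le_two_mul_halfRestrict (W - W')
  rw [map_sub, h, sub_self, norm_zero, mul_zero] at h1
  exact sub_eq_zero.1 (norm_le_zero_iff.1 h1)

/-- The odd extension is the extension by zero minus its reflection. -/
theorem halfRestrict_surjective : Function.Surjective (halfRestrict 𝕜) := by
  intro f
  set S : Set (ℝ × ℝ) := Ioi (0 : ℝ) ×ˢ (univ : Set ℝ) with hS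
  have hSm : MeasurableSet S := measurableSet_Ioi.prod MeasurableSet.univ
  have h1 : MemLp (S.indicator f) 2 (volume : Measure (ℝ × ℝ)) :=
    (memLp_indicator_iff_restrict hSm).2 (Lp.memLp f)
  have h2 : MemLp (S.indicator f ∘ reflEquiv) 2 (volume : Measure (ℝ × ℝ)) :=
    h1.comp_measurePreserving measurePreserving_reflEquiv
  have h3 := h1.sub h2
  have hc := h3.coeFn_toLp
  have hc' := measurePreserving_reflEquiv.quasiMeasurePreserving.ae hc
  refine ⟨⟨h3.toLp _, ?_⟩, ?_⟩
  · change ∀ᵐ x : ℝ × ℝ, h3.toLp _ (-x.1, x.2) = -h3.toLp _ x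
    filter_upwards [hc, hc'] with x e1 e2
    rw [reflEquiv_apply] at e2
    rw [e1, e2]
    simp [reflEquiv_apply]
  · refine Lp.ext ((halfRestrict_coeFn _).trans ?_)
    filter_upwards [ae_halfVol hc, ae_restrict_mem hSm] with x e1 hx
    rw [e1]
    have hx' : reflEquiv x ∉ S := fun h => by
      have h4 : 0 < -x.1 := (mem_prod.1 h).1
      have h5 : 0 < x.1 := (mem_prod.1 hx).1
      linarith
    have hx1 : x ∈ S := hx
    simp [hx1, hx']

/-! ### Transfer of the weak formulation between plane and half-plane -/

theorem integral_smul_odd (φ : 𝓢(ℝ × ℝ, ℝ)) (W : oddL2 𝕜) :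
    ∫ x : ℝ × ℝ, φ x • W.1 x
      = (2 : ℝ) • inner 𝕜 (toL2 𝕜 halfVol (oddPartCLM φ)) (halfRestrict 𝕜 W) := by
  rw [integral_eq_integral_half_add (integrable_schwartz_smul volume φ W.1), inner_toL2,
    ← integral_smul]
  refine integral_congr_ae ?_
  filter_upwards [halfRestrict_coeFn W, ae_halfVol W.2] with x h1 h2
  rw [h1, h2, smul_smul, smul_neg, ← sub_eq_add_neg, ← sub_smul, oddPartCLM_eq]
  congr 1
  simp [reflCLM_apply]

theorem normalTrace_oddPartCLM (v : ℝ → 𝕜) (φ : 𝓢(ℝ × ℝ, ℝ)) :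
    normalTrace v (oddPartCLM φ) = normalTrace v φ := by
  have e : ∂_{((1, 0) : ℝ × ℝ)} (oddPartCLM φ)
      = (1 / 2 : ℝ) • (∂_{((1, 0) : ℝ × ℝ)} φ - ∂_{((1, 0) : ℝ × ℝ)} (reflCLM φ)) :=
    (map_smul (LineDeriv.lineDerivOpCLM ℝ 𝓢(ℝ × ℝ, ℝ) ((1, 0) : ℝ × ℝ)) _ _).trans
      (congrArg _ (map_sub (LineDeriv.lineDerivOpCLM ℝ 𝓢(ℝ × ℝ, ℝ) ((1, 0) : ℝ × ℝ)) _ _))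
  unfold normalTrace
  congr 1
  ext b
  congr 1
  rw [e, lineDerivOp_fst_reflCLM, sub_neg_eq_add]
  change (1 / 2 : ℝ) * ((∂_{((1, 0) : ℝ × ℝ)} φ) (0, b)
    + reflCLM (∂_{((1, 0) : ℝ × ℝ)} φ) (0, b)) = _
  rw [reflCLM_apply, neg_zero]
  ring

theorem lap_oddPartCLM (φ : 𝓢(ℝ × ℝ, ℝ)) : lap (oddPartCLM φ) = oddPartCLM (lap φ) := by
  rw [← lapCLM_apply, oddPartCLM_eq, map_smul, map_sub, lapCLM_apply, lapCLM_apply, lap_reflCLM,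
    oddPartCLM_eq]

/-- An odd state sees only the odd part of φ, and each half-plane contributes equally; ∂₁φ on x₁ = 0
is unchanged by taking the odd part. The factor 2 in the source of the plane equation is thus the
one needed for a common factor. -/
theorem weak_integrand_eq (φ : 𝓢(ℝ × ℝ, ℝ)) (W : oddL2 𝕜) (v : ℝ → 𝕜) :
    (∫ x : ℝ × ℝ, lap φ x • W.1 x) + (2 : ℝ) • normalTrace v φ
      = (2 : ℝ) • (inner 𝕜 (toL2 𝕜 halfVol (lap (oddPartCLM φ))) (halfRestrict 𝕜 W)
        + normalTrace v (oddPartCLM φ)) := by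
  rw [integral_smul_odd, normalTrace_oddPartCLM, lap_oddPartCLM, smul_add]

theorem IsDirichletSolution.isSolution {T : ℝ} {W0 : oddL2 𝕜} {u : ℝ × ℝ → 𝕜}
    {W : ℝ → oddL2 𝕜}
    (h : IsDirichletSolution T (halfRestrict 𝕜 W0) u (fun t => halfRestrict 𝕜 (W t))) :
    IsSolution T W0 u W := by
  rw [isDirichletSolution_iff] at h
  obtain ⟨h1, h2, h3⟩ := h
  refine ⟨halfRestrict_injective h1, fun φ => ?_, fun φ t ht => ?_⟩
  · simp only [weak_integrand_eq]
    exact (h2 _ (odd_boundary (reflCLM_oddPartCLM φ))).smul (2 : ℝ)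
  · simp only [weak_integrand_eq]
    rw [intervalIntegral.integral_smul, integral_smul_odd, integral_smul_odd, ← smul_add,
      h3 _ (odd_boundary (reflCLM_oddPartCLM φ)) t ht]

/-- Not deduced from half-plane uniqueness: the plane formulation gives information for odd test
functions only, whereas `IsDirichletSolution` asks for all those vanishing on the boundary. -/
theorem IsSolution.unique {T : ℝ} {W0 : oddL2 𝕜} {u : ℝ × ℝ → 𝕜} {W W' : ℝ → oddL2 𝕜}
    (h : IsSolution T W0 u W) (h' : IsSolution T W0 u W') : EqOn W' W (Icc 0 T) := by
  intro t ht
  refine halfRestrict_injective (sub_eq_zero.1 (eq_zero_of_odd_weak_heat (T := T)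
    (d := fun t => halfRestrict 𝕜 (W' t) - halfRestrict 𝕜 (W t))
    (fun φ hφ => ?_) (fun φ hφ t ht => ?_) t ht))
  all_goals
    have e : ∀ s, inner 𝕜 (toL2 𝕜 halfVol (lap φ)) (halfRestrict 𝕜 (W' s) - halfRestrict 𝕜 (W s))
        = (1 / 2 : ℝ) • (((∫ x : ℝ × ℝ, lap φ x • (W' s).1 x)
            + (2 : ℝ) • normalTrace (fun b => u (b, s)) φ)
          - ((∫ x : ℝ × ℝ, lap φ x • (W s).1 x)
            + (2 : ℝ) • normalTrace (fun b => u (b, s)) φ)) := by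
      intro s
      rw [weak_integrand_eq, weak_integrand_eq, ← smul_sub, smul_smul, inner_sub_right,
        oddPartCLM_of_odd hφ]
      norm_num
    simp only [e]
  · exact ((h'.integrable φ).sub (h.integrable φ)).smul (1 / 2 : ℝ)
  · have hsub : uIcc 0 t ⊆ uIcc 0 T := by
      rw [uIcc_of_le ht.1, uIcc_of_le (ht.1.trans ht.2)]
      exact Icc_subset_Icc_right ht.2
    have h1 := h.weak φ t ht
    have h2 := h'.weak φ t ht
    rw [integral_smul_odd, oddPartCLM_of_odd hφ] at h1 h2
    rw [intervalIntegral.integral_smul, intervalIntegral.integral_sub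
      ((h'.integrable φ).mono_set hsub) ((h.integrable φ).mono_set hsub),
      ← sub_eq_iff_eq_add'.2 h1, ← sub_eq_iff_eq_add'.2 h2, sub_sub_sub_cancel_right, ← smul_sub,
      smul_smul, inner_sub_right]
    norm_num

theorem approxControllable {T : ℝ} (hT : 0 < T) (W0 WT : oddL2 𝕜) : ApproxControllable T W0 WT := by
  refine Metric.mem_closure_iff.2 fun δ hδ => ?_
  -- Half of δ compensates the factor 2 in `norm_le_two_mul_halfRestrict`.
  obtain ⟨u, hu, w, hw, h⟩ := exists_dominated_solution_near hT (halfRestrict 𝕜 W0)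
    (halfRestrict 𝕜 WT) (half_pos hδ)
  choose W hW using fun t => halfRestrict_surjective (w t)
  obtain rfl : (fun t => halfRestrict 𝕜 (W t)) = w := funext hW
  refine ⟨W T, ⟨u, hu.isControl T, W, hw.isSolution,
    fun W' hW' => hw.isSolution.unique hW', rfl⟩, ?_⟩
  rw [dist_eq_norm, norm_sub_rev]
  refine (norm_le_two_mul_halfRestrict _).trans_lt ?_
  rw [map_sub]
  linarith

end OddExtension

end HeatHalfPlane

end

theorem theorem4p1 (𝕜 : Type*) [RCLike 𝕜] (T : ℝ) (hT : 0 < T) :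
    (∀ W0 WT : HeatHalfPlane.oddL2 𝕜, HeatHalfPlane.ApproxControllable T W0 WT) ∧
    (∀ W0 : HeatHalfPlane.oddL2 𝕜, closure (HeatHalfPlane.reachableSet T W0) = Set.univ) ∧
    (∀ w0 wT : MeasureTheory.Lp 𝕜 2 HeatHalfPlane.halfVol,
      HeatHalfPlane.DirichletApproxControllable T w0 wT) :=
  ⟨HeatHalfPlane.approxControllable hT,
    fun W0 => Set.eq_univ_of_forall (HeatHalfPlane.approxControllable hT W0),
    HeatHalfPlane.dirichletApproxControllable hT⟩
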